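/- **Setting.** Let $N\in\mathbb N$, let $|\cdot|$ be the Euclidean norm, let $B_j$ be the closed ball of radius $j$ about $0$ in $\mathbb R^{2N}$, and let $\mathcal C=C([-1,0],\mathbb R^N)$ carry the supremum norm. Inequalities between vectors of $\mathbb R^N$ are componentwise, and those between functions in $\mathcal C$ are componentwise and pointwise. $L^1_{loc}$ is the set of locally integrable real functions on $\mathbb R$. Let $\mathfrak{LC}=\mathfrak{LC}(\mathbb R^{2N},\mathbb R^N)$ be the set of Borel functions $f:\mathbb R\times\mathbb R^N\times\mathbb R^N\to\mathbb R^N$ such that for every compact $K\subset\mathbb R^{2N}$ there are $m^K,l^K\in L^1_{loc}$ such that, for a.e. $t$, $|f(t,z)|\le m^K(t)$ and $|f(t,z)-f(t,w)|\le l^K(t)|z-w|$ for all $z,w\in K$. Any such $m^K$ is called an $m$-bound of $f$ on $K$. (Functions that differ only on a null set may be identified.) Put $f_s(t,x,y)=f(s+t,x,y)$; a set $E\subset\mathfrak{LC}$ is *invariant* if $f_s\in E$ for all $f\in E$, $s\in\mathbb R$. For $f\in\mathfrak{LC}$ and $\phi\in\mathcal C$ consider $$x'(t)=f(t,x(t),x(t-1))\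 \ (t>0),\qquad x=\phi\ \text{ on }[-1,0].$$ A solution on $[-1,T]$, $T\ge0$, is a continuous $x$ with $x=\phi$ on $[-1,0]$ and $x(t)=\phi(0)+\int_0^t f(s,x(s),x(s-1))\,ds$ for $t\in[0,T]$. Let $I_{f,\phi}$ be the union of all intervals $[-1,T]$, $T\ge0$, on which a solution exists, let $x(\cdot,f,\phi):I_{f,\phi}\to\mathbb R^N$ denote the maximal solution, and put $x_t(s,f,\phi)=x(t+s,f,\phi)$ for $s\in[-1,0]$, $0\le t\in I_{f,\phi}$. For a countable dense set $P\subset\mathbb R^{2N}$, $\mathcal T_P$ (resp. $\sigma_P$) is the topology on $\mathfrak{LC}$ generated by the seminorms $f\mapsto\int_I|f(t,z)|\,dt$ (resp. $f\mapsto\left|\int_I f(t,z)\,dt\right|$), $z\in P$, $I=[q_1,q_2]$ with $q_1,q_2\in\mathbb Q$. Conditions: * $(K_x)$ on $f$: for all $a,b,c\in\mathbb R^N$ with $a\le b$ and $a_k=b_k$ for some $k$, $f_k(t,a,c)\le f_k(t,b,c)$ for a.e. $t$. * $(K_y)$ on $f$: for all $a,b,c\in\mathbb R^N$ with $b\le c$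 and all $k$, $f_k(t,a,b)\le f_k(t,a,c)$ for a.e. $t$. * $(L_x)$ on $E$: for all $f\in E$, $j\in\mathbb N$, $k\in\{1,\dots,N\}$ there is $u^j_{f_k}\in L^1_{loc}$ such that for all $(x,y),(\bar x,y)\in B_j$ with $x_i=\bar x_i$ for $i\ne k$ one has $|f_k(t,x,y)-f_k(t,\bar x,y)|\le u^j_{f_k}(t)|x_k-\bar x_k|$ for a.e. $t$; and $\sup_{f\in E}\int_{-r}^r u^j_{f_k}(t)\,dt<\infty$ for all $j$, $k$ and $r>0$. * $E$ has $L^1_{loc}$-equicontinuous $m$-bounds: for each $j\in\mathbb N$ one can choose $m$-bounds $m_f$ of $f$ on $B_j$, $f\in E$, such that for all $r,\varepsilon>0$ there is $\delta>0$ with $\int_s^t m_f(u)\,du<\varepsilon$ for all $f\in E$ whenever $-r\le s\le t\le r$ and $t-s<\delta$. **Theorem.** For all $f\in\mathfrak{LC}$ and $\phi\in\mathcal C$, the problem above has a unique maximal solution $x(\cdot,f,\phi)$, and $I_{f,\phi}=[-1,b_{f,\phi})$ with $0<b_{f,\phi}\le\infty$. Let $E\subset\mathfrak{LC}$ satisfy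 $(L_x)$, let every $f\in E$ satisfy $(K_x)$ and $(K_y)$, and let $P$ be a countable dense subset of $\mathbb R^{2N}$. (i) If $\phi_n\to\phi$ uniformly in $\mathcal C$, and $f_n\in E$ converge to $f\in\mathfrak{LC}$ in $\mathcal T_P$, then for every $[-1,T]\subset I_{f,\phi}$ one has $[-1,T]\subset I_{f_n,\phi_n}$ for all large $n$, and $x(\cdot,f_n,\phi_n)\to x(\cdot,f,\phi)$ uniformly on $[-1,T]$. (ii) If $E$ is invariant and $\overline E$ is its closure in $(\mathfrak{LC},\mathcal T_P)$, then, with $\mathcal U=\{(t,f,\phi): f\in\overline E,\ \phi\in\mathcal C,\ 0\le t\in I_{f,\phi}\}$, the map $$\Phi:\mathcal U\subset[0,\infty)\times\overline E\times\mathcal C\to\overline E\times\mathcal C,\qquad (t,f,\phi)\mapsto(f_t,x_t(\cdot,f,\phi)),$$ is a local, monotone, continuous skew-product semiflow. That is: $\Phi$ takes its values in $\overline E\times\mathcal C$; $\mathcal U$ is open in $[0,\infty)\times\overline E\times\mathcal C$ and contains $(0,p)$ for all $p\in\overline E\times\mathcal C$, and with $(t,p)$ it contains $(s,p)$ for $0\le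 s\le t$; $\Phi(0,p)=p$; if $(s,p)\in\mathcal U$, then $(t,\Phi(s,p))\in\mathcal U$ if and only if $(s+t,p)\in\mathcal U$, and in that case $\Phi(s+t,p)=\Phi(t,\Phi(s,p))$; $\Phi$ is continuous on $\mathcal U$; and $x(t,f,\phi)\le x(t,f,\psi)$ whenever $f\in\overline E$, $\phi\le\psi$ and $t\in I_{f,\phi}\cap I_{f,\psi}$. (iii) If in addition $E$ has $L^1_{loc}$-equicontinuous $m$-bounds, then (i) and (ii) also hold with $\sigma_P$ in place of $\mathcal T_P$, both for the convergence in (i) and for the closure and the topology of $\overline E$ in (ii). -/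

import Mathlib

open Set Filter Topology MeasureTheory
open scoped NNReal

noncomputable section

namespace CaratheodoryDelay

/-- The Euclidean space `ℝ^N`. -/
abbrev Vec (N : ℕ) : Type := EuclideanSpace ℝ (Fin N)

/-- The phase space `C([-1,0], ℝ^N)` with the topology of uniform convergence. -/
abbrev Hist (N : ℕ) : Type := C(Icc (-1 : ℝ) 0, Vec N)

/-- The Euclidean norm of `(x, y) ∈ ℝ^N × ℝ^N = ℝ^{2N}`. -/
def norm2 {N : ℕ} (x y : Vec N) : ℝ := ‖WithLp.toLp 2 (x, y)‖

/-- `m` is an `m`-bound of `f` on `K ⊆ ℝ^{2N}`. -/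
def IsMBound {N : ℕ} (f : ℝ → Vec N → Vec N → Vec N) (K : Set (Vec N × Vec N)) (m : ℝ → ℝ) :
    Prop :=
  LocallyIntegrable m volume ∧ ∀ᵐ t : ℝ, ∀ z ∈ K, ‖f t z.1 z.2‖ ≤ m t

/-- `l` is a Lipschitz bound of `f` on `K ⊆ ℝ^{2N}`. -/
def IsLBound {N : ℕ} (f : ℝ → Vec N → Vec N → Vec N) (K : Set (Vec N × Vec N)) (l : ℝ → ℝ) :
    Prop :=
  LocallyIntegrable l volume ∧ ∀ᵐ t : ℝ, ∀ z ∈ K, ∀ w ∈ K,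
    ‖f t z.1 z.2 - f t w.1 w.2‖ ≤ l t * norm2 (z.1 - w.1) (z.2 - w.2)

/-- Lipschitz Carathéodory functions `f : ℝ × ℝ^{2N} → ℝ^N`, `(t, x, y) ↦ f t x y`.
The elements of this type are functions; those that agree for almost every `t` are not
identified but are inseparable in the topologies below and have the same solutions. -/
@[ext]
structure LC (N : ℕ) where
  toFun : ℝ → Vec N → Vec N → Vec N
  measurable' : Measurable (fun p : ℝ × Vec N × Vec N => toFun p.1 p.2.1 p.2.2)
  exists_mBound' : ∀ K : Set (Vec N × Vec N), IsCompact K → ∃ m, IsMBound toFun K m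
  exists_lBound' : ∀ K : Set (Vec N × Vec N), IsCompact K → ∃ l, IsLBound toFun K l

instance {N : ℕ} : CoeFun (LC N) (fun _ => ℝ → Vec N → Vec N → Vec N) := ⟨LC.toFun⟩

theorem locallyIntegrable_translate {m : ℝ → ℝ} (hm : LocallyIntegrable m volume) (s : ℝ) :
    LocallyIntegrable (fun t => m (s + t)) volume := by
  have h := (locallyIntegrable_map_homeomorph (Homeomorph.addLeft s) (f := m)
    (μ := (volume : Measure ℝ))).1
  have e : Measure.map (Homeomorph.addLeft s) (volume : Measure ℝ) = volume :=
    map_add_left_eq_self volume s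
  rw [e] at h
  exact h hm

theorem ae_translate {p : ℝ → Prop} (h : ∀ᵐ t : ℝ, p t) (s : ℝ) : ∀ᵐ t : ℝ, p (s + t) :=
  (measurePreserving_add_left volume s).quasiMeasurePreserving.ae h

/-- The time translation `f_s(t, x, y) = f(s + t, x, y)`, that is, the base flow `(s, f) ↦ f_s`. -/
def LC.translate {N : ℕ} (s : ℝ) (f : LC N) : LC N where
  toFun t x y := f (s + t) x y
  measurable' := f.measurable'.comp
    (((measurable_const.add measurable_fst).prodMk measurable_snd) :
      Measurable (fun p : ℝ × Vec N × Vec N => (s + p.1, p.2)))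
  exists_mBound' K hK := by
    obtain ⟨m, hm, h⟩ := f.exists_mBound' K hK
    exact ⟨fun t => m (s + t), locallyIntegrable_translate hm s, ae_translate h s⟩
  exists_lBound' K hK := by
    obtain ⟨l, hl, h⟩ := f.exists_lBound' K hK
    exact ⟨fun t => l (s + t), locallyIntegrable_translate hl s, ae_translate h s⟩

/-! ### Topologies -/

/-- The seminorm distance `∫_[q₁,q₂] |f(t,x,y) - g(t,x,y)| dt`. -/
def strongDist {N : ℕ} (q₁ q₂ : ℚ) (z : Vec N × Vec N) (f g : LC N) : ℝ :=
  ∫ t in Icc (q₁ : ℝ) (q₂ : ℝ), ‖f t z.1 z.2 - g t z.1 z.2‖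

/-- The seminorm distance `|∫_[q₁,q₂] (f(t,x,y) - g(t,x,y)) dt|`. -/
def weakDist {N : ℕ} (q₁ q₂ : ℚ) (z : Vec N × Vec N) (f g : LC N) : ℝ :=
  ‖∫ t in Icc (q₁ : ℝ) (q₂ : ℝ), (f t z.1 z.2 - g t z.1 z.2)‖

/-- The topology `T_P` on the Lipschitz Carathéodory functions: it is generated by the open balls,
with arbitrary centers and radii, of the seminorms `∫_I |f(t,z)| dt`, `z ∈ P`,
`I = [q₁,q₂]` with rational endpoints. -/
@[reducible] def strongTopology {N : ℕ} (P : Set (Vec N × Vec N)) : TopologicalSpace (LC N) :=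
  TopologicalSpace.generateFrom
    {B | ∃ z ∈ P, ∃ q₁ q₂ : ℚ, ∃ f : LC N, ∃ r : ℝ, 0 < r ∧ B = {g | strongDist q₁ q₂ z g f < r}}

/-- The topology `σ_P`: as `T_P`, with the seminorms `|∫_I f(t,z) dt|`. -/
@[reducible] def weakTopology {N : ℕ} (P : Set (Vec N × Vec N)) : TopologicalSpace (LC N) :=
  TopologicalSpace.generateFrom
    {B | ∃ z ∈ P, ∃ q₁ q₂ : ℚ, ∃ f : LC N, ∃ r : ℝ, 0 < r ∧ B = {g | weakDist q₁ q₂ z g f < r}}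

/-! ### Hypotheses on vector fields -/

/-- Kamke's condition in the variable `x`. -/
def LC.Kx {N : ℕ} (f : LC N) : Prop :=
  ∀ (a b c : Vec N) (k : Fin N), (∀ i, a i ≤ b i) → a k = b k →
    ∀ᵐ t : ℝ, f t a c k ≤ f t b c k

/-- Kamke's condition in the variable `y`. -/
def LC.Ky {N : ℕ} (f : LC N) : Prop :=
  ∀ a b c : Vec N, (∀ i, b i ≤ c i) → ∀ k : Fin N, ∀ᵐ t : ℝ, f t a b k ≤ f t a c k

/-- `L¹_loc`-boundedness of a set of functions. -/
def L1locBounded (S : Set (ℝ → ℝ)) : Prop :=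
  ∀ r : ℝ, 0 < r → ∃ C : ℝ, ∀ u ∈ S, ∫ t in (-r)..r, u t ≤ C

/-- `L¹_loc`-equicontinuity of a set of functions. -/
def L1locEquicontinuous (S : Set (ℝ → ℝ)) : Prop :=
  ∀ r : ℝ, 0 < r → ∀ ε : ℝ, 0 < ε → ∃ δ : ℝ, 0 < δ ∧ ∀ s t : ℝ, -r ≤ s → s ≤ t → t ≤ r →
    t - s < δ → ∀ m ∈ S, ∫ u in s..t, m u < ε

/-- The condition `(L_x)`: in the closed ball of radius `j` of `ℝ^{2N}`, the component `f_k` is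
Lipschitz in the single variable `x_k`, with coefficients that are `L¹_loc`-bounded over `E`. -/
def SatisfiesLx {N : ℕ} (E : Set (LC N)) : Prop :=
  ∀ (j : ℕ) (k : Fin N), ∃ u : LC N → ℝ → ℝ,
    (∀ f ∈ E, LocallyIntegrable (u f) volume) ∧
    L1locBounded (u '' E) ∧
    ∀ f ∈ E, ∀ x x' y : Vec N, (∀ i, i ≠ k → x i = x' i) → norm2 x y ≤ j → norm2 x' y ≤ j →
      ∀ᵐ t : ℝ, |f t x y k - f t x' y k| ≤ u f t * |x k - x' k|

/-- `E` has `L¹_loc`-equicontinuous `m`-bounds. -/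
def HasEquicontinuousMBounds {N : ℕ} (E : Set (LC N)) : Prop :=
  ∀ j : ℕ, ∃ m : LC N → ℝ → ℝ,
    (∀ f ∈ E, IsMBound f {z | norm2 z.1 z.2 ≤ j} (m f)) ∧ L1locEquicontinuous (m '' E)

/-- Invariance under the base flow. -/
def BaseInvariant {N : ℕ} (E : Set (LC N)) : Prop :=
  ∀ f ∈ E, ∀ s : ℝ, f.translate s ∈ E

/-! ### Solutions -/

/-- `x` is a (Carathéodory) solution on `[-1,T]` of `x'(t) = f(t, x(t), x(t-1))` for `t > 0`,
`x = φ` on `[-1,0]`. -/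
structure IsSolutionOn {N : ℕ} (f : LC N) (φ : Hist N) (T : ℝ) (x : ℝ → Vec N) : Prop where
  continuousOn : ContinuousOn x (Icc (-1) T)
  initial : ∀ s : Icc (-1 : ℝ) 0, x s = φ s
  integrable : ∀ t ∈ Icc 0 T, IntervalIntegrable (fun s => f s (x s) (x (s - 1))) volume 0 t
  integral_eq : ∀ t ∈ Icc 0 T, x t = x 0 + ∫ s in (0 : ℝ)..t, f s (x s) (x (s - 1))

/-- The interval `I_{f,φ}`: the union of the intervals `[-1,T]`, `T ≥ 0`, that carry a solution. -/
def existenceInterval {N : ℕ} (f : LC N) (φ : Hist N) : Set ℝ :=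
  {t | ∃ T : ℝ, 0 ≤ T ∧ t ∈ Icc (-1) T ∧ ∃ x, IsSolutionOn f φ T x}

open Classical in
/-- The value `x(t,f,φ)` of the solution at `t ∈ I_{f,φ}` (and `0` outside `I_{f,φ}`). -/
def sol {N : ℕ} (f : LC N) (φ : Hist N) (t : ℝ) : Vec N :=
  if h : ∃ x : ℝ → Vec N, ∃ T : ℝ, 0 ≤ T ∧ t ∈ Icc (-1) T ∧ IsSolutionOn f φ T x
  then h.choose t else 0

open Classical in
/-- The history `x_t(·,f,φ) : s ↦ x(t + s,f,φ)`, `s ∈ [-1,0]`, for `0 ≤ t ∈ I_{f,φ}`. -/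
def hist {N : ℕ} (f : LC N) (φ : Hist N) (t : ℝ) : Hist N :=
  if h : Continuous (fun s : Icc (-1 : ℝ) 0 => sol f φ (t + s)) then ⟨_, h⟩ else 0

/-- `x(·,f,φ)` is the unique maximal solution, and its interval is `I_{f,φ} = [-1,b)`
with `0 < b ≤ ∞`. -/
def HasUniqueMaximalSolution {N : ℕ} (f : LC N) (φ : Hist N) : Prop :=
  (∃ b : EReal, 0 < b ∧ existenceInterval f φ = {t : ℝ | -1 ≤ t ∧ (t : EReal) < b}) ∧
  ∀ T : ℝ, 0 ≤ T → T ∈ existenceInterval f φ →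
    IsSolutionOn f φ T (sol f φ) ∧
    ∀ y : ℝ → Vec N, IsSolutionOn f φ T y → EqOn y (sol f φ) (Icc (-1) T)

/-! ### Continuous dependence and skew-product semiflows -/

/-- If `φ_n → φ` uniformly and `f_n ∈ E` converges to `f` in the topology `τ`, then
`x(·,f_n,φ_n) → x(·,f,φ)` uniformly on every `[-1,T] ⊆ I_{f,φ}`; in particular
`[-1,T] ⊆ I_{f_n,φ_n}` for all large `n`. -/
def ContinuousDependence {N : ℕ} (τ : TopologicalSpace (LC N)) (E : Set (LC N)) : Prop :=
  ∀ (φs : ℕ → Hist N) (φ : Hist N) (fs : ℕ → LC N) (f : LC N),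
    Tendsto φs atTop (𝓝 φ) → (∀ n, fs n ∈ E) → Tendsto fs atTop (@nhds (LC N) τ f) →
    ∀ T : ℝ, Icc (-1) T ⊆ existenceInterval f φ →
      (∀ᶠ n in atTop, Icc (-1) T ⊆ existenceInterval (fs n) (φs n)) ∧
      TendstoUniformlyOn (fun n => sol (fs n) (φs n)) (sol f φ) atTop (Icc (-1) T)

/-- `Φ` is a continuous local semiflow on the subset `S` of `X`, with domain `U ⊆ ℝ≥0 × S`. -/
structure IsContinuousLocalSemiflow {X : Type*} [TopologicalSpace X] (S : Set X)
    (U : Set (ℝ≥0 × X)) (Φ : ℝ≥0 × X → X) : Prop where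
  domain_subset : U ⊆ univ ×ˢ S
  domain_open : ∃ O : Set (ℝ≥0 × X), IsOpen O ∧ U = O ∩ (univ ×ˢ S)
  domain_interval : ∀ (s t : ℝ≥0) (p : X), s ≤ t → (t, p) ∈ U → (s, p) ∈ U
  zero_mem : ∀ p ∈ S, (0, p) ∈ U
  mapsTo : MapsTo Φ U S
  map_zero : ∀ p ∈ S, Φ (0, p) = p
  add_mem_iff : ∀ (s t : ℝ≥0) (p : X), (s, p) ∈ U → ((t, Φ (s, p)) ∈ U ↔ (s + t, p) ∈ U)
  map_add : ∀ (s t : ℝ≥0) (p : X), (s + t, p) ∈ U → Φ (s + t, p) = Φ (t, Φ (s, p))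
  continuousOn : ContinuousOn Φ U

/-- The map `(t, f, φ) ↦ (f_t, x_t(·,f,φ))`. -/
def skewMap {N : ℕ} (p : ℝ≥0 × LC N × Hist N) : LC N × Hist N :=
  (p.2.1.translate (p.1 : ℝ), hist p.2.1 p.2.2 (p.1 : ℝ))

/-- The domain `{(t, f, φ) : f ∈ F, t ∈ I_{f,φ}}`. -/
def skewDomain {N : ℕ} (F : Set (LC N)) : Set (ℝ≥0 × LC N × Hist N) :=
  {p | p.2.1 ∈ F ∧ (p.1 : ℝ) ∈ existenceInterval p.2.1 p.2.2}

/-- Monotonicity of the skew-product semiflow over `F`. -/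
def IsMonotoneOver {N : ℕ} (F : Set (LC N)) : Prop :=
  ∀ f ∈ F, ∀ φ ψ : Hist N, (∀ s i, φ s i ≤ ψ s i) →
    ∀ t ∈ existenceInterval f φ ∩ existenceInterval f ψ, ∀ i, sol f φ t i ≤ sol f ψ t i

/-- `(t, f, φ) ↦ (f_t, x_t(·,f,φ))` is a local, monotone, continuous skew-product semiflow on
`F × C([-1,0], ℝ^N)`, where `F` carries the topology induced by `τ`. -/
def IsMonotoneContinuousSemiflow {N : ℕ} (τ : TopologicalSpace (LC N)) (F : Set (LC N)) : Prop :=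
  @IsContinuousLocalSemiflow (LC N × Hist N) (@instTopologicalSpaceProd _ _ τ inferInstance)
    (F ×ˢ univ) (skewDomain F) skewMap ∧
  IsMonotoneOver F

end CaratheodoryDelay

end

/-!
# Continuous dependence and monotone semiflows for quasimonotone delay equations

A vector field whose values and Lipschitz constants are bounded globally in space by locally
integrable functions of time has global solutions, by the contraction principle applied step by
step (`HasGlobalBounds.exists_solution`), and they are unique by a Gronwall inequality with a
coefficient that is merely locally integrable (`exists_gronwall_const`). A general vector field is
compared with its truncation `LC.trunc`, which freezes it outside a cube. A solution of the
truncated equation solves the original one as long as it stays in the cube, which gives the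
maximal intervals and the fact that a bounded solution can be continued
(`mem_existenceInterval_of_bounded`).

The heart of the matter is continuous dependence: the Lipschitz constants of `f_n` in the full
space variable are not controlled along a sequence in `E`, and convergence is only known at points
of a countable dense set `P`, so that `∫ f_n(t, x(t), x(t-1)) dt` need not converge a priori.
Monotonicity comes to the rescue. Kamke's conditions and the Lipschitz condition in `x_k` alone
yield the one-sided estimate `f_k(t,a,c) ≤ f_k(t,b,d) + U(t) (b_k - a_k)` for `a ≤ b`, `c ≤ d`,
where `U` is bounded in `L¹_loc` over `E` (`SatisfiesLx.exists_sandwich`). A curve with a given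
modulus of continuity can be squeezed, on each interval of a fine rational partition, between
points of a finite subset of `P`, and the integral of `f_n - f` along it is thereby controlled by
finitely many integrals at points of `P`, which tend to zero (`eventually_abs_integral_sub_le`).
The curves to which this is applied are the solutions for `f_n` themselves. Their equicontinuity
follows from the `m`-bounds in the case of `σ_P`, and from the `L¹` convergence on finite grids
together with the one-sided estimate in the case of `T_P`
(`hasEquicontinuousPrimitives_of_tendsto`). Gronwall's inequality with the Lipschitz bound of the
limit `f` concludes (`tendstoUniformlyOn_sol`).

Both topologies are first countable, so continuous dependence along sequences has a neighbourhood
form, and this form passes to the closure of `E` by density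
(`ContinuousDependence.eventually_closure`): no estimate on elements of the closure is needed.
Together with the continuity of the base flow this gives the semiflow. Its monotonicity is the
comparison theorem `IsSolutionOn.le_of_kamke`, passed to the limit.
-/

noncomputable section

namespace CaratheodoryDelay

variable {N : ℕ}

/-! ### Coordinates, boxes and truncation -/

theorem norm_le_sum_abs (x : Vec N) : ‖x‖ ≤ ∑ i, |x i| := by
  rw [EuclideanSpace.norm_eq]
  refine Real.sqrt_le_iff.2 ⟨Finset.sum_nonneg fun i _ => abs_nonneg _, ?_⟩
  simp only [Real.norm_eq_abs]
  exact Finset.sum_sq_le_sq_sum_of_nonneg fun i _ => abs_nonneg _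

theorem abs_apply_le_norm (x : Vec N) (i : Fin N) : |x i| ≤ ‖x‖ := by
  simpa using PiLp.norm_apply_le x i

theorem norm_le_of_abs_le {x : Vec N} {c : ℝ} (h : ∀ i, |x i| ≤ c) : ‖x‖ ≤ N * c :=
  (norm_le_sum_abs x).trans ((Finset.sum_le_sum fun i _ => h i).trans_eq (by simp))

theorem norm_mono {x y : Vec N} (h : ∀ i, |x i| ≤ |y i|) : ‖x‖ ≤ ‖y‖ := by
  rw [EuclideanSpace.norm_eq, EuclideanSpace.norm_eq]
  refine Real.sqrt_le_sqrt (Finset.sum_le_sum fun i _ => ?_)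
  simp only [Real.norm_eq_abs]
  exact pow_le_pow_left₀ (abs_nonneg _) (h i) 2

theorem norm2_eq (x y : Vec N) : norm2 x y = √(‖x‖ ^ 2 + ‖y‖ ^ 2) := by
  simp [norm2, WithLp.prod_norm_eq_of_L2]

theorem norm2_le_add (x y : Vec N) : norm2 x y ≤ ‖x‖ + ‖y‖ := by
  rw [norm2_eq]
  refine Real.sqrt_le_iff.2 ⟨by positivity, ?_⟩
  nlinarith [norm_nonneg x, norm_nonneg y]

/-- The cube `[-ρ, ρ]^N`. -/
def box (N : ℕ) (ρ : ℝ) : Set (Vec N) := {x | ∀ i, |x i| ≤ ρ}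

/-- The nearest-point retraction of `ℝ^N` onto the cube `[-ρ, ρ]^N`, taken coordinatewise. It is
monotone and nonexpansive. -/
def clamp (ρ : ℝ) (x : Vec N) : Vec N := WithLp.toLp 2 fun i => max (-ρ) (min ρ (x i))

@[simp] theorem clamp_apply (ρ : ℝ) (x : Vec N) (i : Fin N) :
    clamp ρ x i = max (-ρ) (min ρ (x i)) := rfl

theorem continuous_clamp (ρ : ℝ) : Continuous (clamp ρ : Vec N → Vec N) := by
  unfold clamp
  fun_prop

theorem clamp_mem_box {ρ : ℝ} (hρ : 0 ≤ ρ) (x : Vec N) : clamp ρ x ∈ box N ρ := by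
  intro i
  rw [clamp_apply, abs_le]
  exact ⟨le_max_left _ _, max_le (by linarith) (min_le_left _ _)⟩

theorem clamp_eq_self {ρ : ℝ} {x : Vec N} (hx : x ∈ box N ρ) : clamp ρ x = x := by
  ext i
  have := abs_le.1 (hx i)
  rw [clamp_apply, min_eq_right this.2, max_eq_right this.1]

theorem mem_box_of_norm_le {ρ : ℝ} {x : Vec N} (hx : ‖x‖ ≤ ρ) : x ∈ box N ρ :=
  fun i => (abs_apply_le_norm x i).trans hx

theorem box_mono {ρ ρ' : ℝ} (h : ρ ≤ ρ') : box N ρ ⊆ box N ρ' := fun _ hx i => (hx i).trans h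

theorem abs_clamp_sub_le (ρ : ℝ) (x y : Vec N) (i : Fin N) :
    |(clamp ρ x - clamp ρ y) i| ≤ |(x - y) i| := by
  simp only [PiLp.sub_apply, clamp_apply]
  exact (abs_max_sub_max_le_max _ _ _ _).trans (max_le (by simp)
    ((abs_min_sub_min_le_max _ _ _ _).trans (max_le (by simp) le_rfl)))

theorem norm_clamp_sub_le (ρ : ℝ) (x y : Vec N) : ‖clamp ρ x - clamp ρ y‖ ≤ ‖x - y‖ :=
  norm_mono (abs_clamp_sub_le ρ x y)

theorem clamp_mono (ρ : ℝ) {x y : Vec N} {i : Fin N} (h : x i ≤ y i) :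
    clamp ρ x i ≤ clamp ρ y i := by
  simp only [clamp_apply]
  exact max_le_max le_rfl (min_le_min le_rfl h)

theorem isCompact_box (ρ : ℝ) : IsCompact (box N ρ) := by
  refine Metric.isCompact_of_isClosed_isBounded ?_ ?_
  · have : box N ρ = ⋂ i, {x : Vec N | |x i| ≤ ρ} := by ext; simp [box]
    rw [this]
    exact isClosed_iInter fun i => isClosed_le (by fun_prop) continuous_const
  · refine (Metric.isBounded_closedBall (x := (0 : Vec N)) (r := N * ρ)).subset fun x hx => ?_
    simpa using norm_le_of_abs_le hx

theorem norm2_le_of_mem_box {ρ : ℝ} {x y : Vec N} (hx : x ∈ box N ρ) (hy : y ∈ box N ρ) :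
    norm2 x y ≤ N * ρ + N * ρ :=
  (norm2_le_add x y).trans (add_le_add (norm_le_of_abs_le hx) (norm_le_of_abs_le hy))

/-- `m` and `l` bound, for almost every `t`, the values and the Lipschitz constants of `f t` on
the whole space. -/
structure HasGlobalBounds (f : LC N) (m l : ℝ → ℝ) : Prop where
  m_int : LocallyIntegrable m volume
  l_int : LocallyIntegrable l volume
  m_nonneg : ∀ t, 0 ≤ m t
  l_nonneg : ∀ t, 0 ≤ l t
  bound : ∀ᵐ t : ℝ, ∀ x y, ‖f t x y‖ ≤ m t
  lip : ∀ᵐ t : ℝ, ∀ x y x' y', ‖f t x y - f t x' y'‖ ≤ l t * (‖x - x'‖ + ‖y - y'‖)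

theorem locallyIntegrable_abs {m : ℝ → ℝ} (hm : LocallyIntegrable m volume) :
    LocallyIntegrable (fun t => |m t|) volume :=
  hm.mono hm.aestronglyMeasurable.norm (ae_of_all _ fun t => by simp)

theorem norm2_clamp_le (ρ : ℝ) (x y x' y' : Vec N) :
    norm2 (clamp ρ x - clamp ρ x') (clamp ρ y - clamp ρ y') ≤ norm2 (x - x') (y - y') := by
  rw [norm2_eq, norm2_eq]
  have h1 := norm_clamp_sub_le ρ x x'
  have h2 := norm_clamp_sub_le ρ y y'
  gcongr

/-- The vector field `f` frozen outside the cube of radius `ρ`. Its bounds are global in space, so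
that its solutions do not blow up, and as long as a solution stays in the cube it also solves the
equation of `f`. -/
def LC.trunc (ρ : ℝ) (f : LC N) : LC N where
  toFun t x y := f t (clamp ρ x) (clamp ρ y)
  measurable' := f.measurable'.comp
    (measurable_fst.prodMk (((continuous_clamp ρ).measurable.comp
      (measurable_fst.comp measurable_snd)).prodMk
      ((continuous_clamp ρ).measurable.comp (measurable_snd.comp measurable_snd))) :
      Measurable (fun p : ℝ × Vec N × Vec N => (p.1, clamp ρ p.2.1, clamp ρ p.2.2)))
  exists_mBound' K hK := by
    obtain ⟨m, hm, h⟩ := f.exists_mBound' _ (hK.image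
      ((continuous_clamp ρ).prodMap (continuous_clamp ρ)))
    refine ⟨m, hm, ?_⟩
    filter_upwards [h] with t ht z hz
    exact ht (clamp ρ z.1, clamp ρ z.2) ⟨z, hz, rfl⟩
  exists_lBound' K hK := by
    obtain ⟨l, hl, h⟩ := f.exists_lBound' _ (hK.image
      ((continuous_clamp ρ).prodMap (continuous_clamp ρ)))
    refine ⟨fun t => |l t|, locallyIntegrable_abs hl, ?_⟩
    filter_upwards [h] with t ht z hz w hw
    refine (ht (clamp ρ z.1, clamp ρ z.2) ⟨z, hz, rfl⟩
      (clamp ρ w.1, clamp ρ w.2) ⟨w, hw, rfl⟩).trans ?_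
    calc _ ≤ |l t| * norm2 (clamp ρ z.1 - clamp ρ w.1) (clamp ρ z.2 - clamp ρ w.2) :=
          mul_le_mul_of_nonneg_right (le_abs_self _) (by unfold norm2; positivity)
      _ ≤ _ := mul_le_mul_of_nonneg_left (norm2_clamp_le ρ _ _ _ _) (abs_nonneg _)

theorem LC.trunc_apply (ρ : ℝ) (f : LC N) (t : ℝ) (x y : Vec N) :
    f.trunc ρ t x y = f t (clamp ρ x) (clamp ρ y) := rfl

theorem LC.trunc_apply_of_mem {ρ : ℝ} (f : LC N) (t : ℝ) {x y : Vec N} (hx : x ∈ box N ρ)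
    (hy : y ∈ box N ρ) : f.trunc ρ t x y = f t x y := by
  rw [f.trunc_apply, clamp_eq_self hx, clamp_eq_self hy]

theorem LC.exists_hasGlobalBounds_trunc {ρ : ℝ} (hρ : 0 ≤ ρ) (f : LC N) :
    ∃ m l, HasGlobalBounds (f.trunc ρ) m l := by
  have hK := (isCompact_box (N := N) ρ).prod (isCompact_box (N := N) ρ)
  obtain ⟨m, hm, h⟩ := f.exists_mBound' _ hK
  obtain ⟨l, hl, h'⟩ := f.exists_lBound' _ hK
  have hc : ∀ x y : Vec N, (clamp ρ x, clamp ρ y) ∈ box N ρ ×ˢ box N ρ := fun x y =>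
    ⟨clamp_mem_box hρ x, clamp_mem_box hρ y⟩
  refine ⟨fun t => |m t|, fun t => |l t|, locallyIntegrable_abs hm, locallyIntegrable_abs hl,
    fun t => abs_nonneg _, fun t => abs_nonneg _, ?_, ?_⟩
  · filter_upwards [h] with t ht x y
    exact (ht _ (hc x y)).trans (le_abs_self _)
  · filter_upwards [h'] with t ht x y x' y'
    refine (ht _ (hc x y) _ (hc x' y')).trans ?_
    refine mul_le_mul (le_abs_self _) ?_ (by unfold norm2; positivity) (abs_nonneg _)
    exact (norm2_clamp_le ρ _ _ _ _).trans (norm2_le_add _ _)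

/-- For almost every `t`, the function `f t` is continuous. -/
theorem LC.ae_continuous (f : LC N) :
    ∀ᵐ t : ℝ, Continuous fun z : Vec N × Vec N => f t z.1 z.2 := by
  have h : ∀ n : ℕ, ∀ᵐ t : ℝ, Continuous fun z : Vec N × Vec N => f.trunc n t z.1 z.2 := by
    intro n
    obtain ⟨m, l, hb⟩ := f.exists_hasGlobalBounds_trunc (Nat.cast_nonneg n)
    filter_upwards [hb.lip] with t ht
    refine continuous_iff_continuousAt.2 fun z => ?_
    rw [ContinuousAt, tendsto_iff_norm_sub_tendsto_zero]
    refine squeeze_zero (fun w => norm_nonneg _) (fun w => ht w.1 w.2 z.1 z.2) ?_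
    have : Continuous fun w : Vec N × Vec N => l t * (‖w.1 - z.1‖ + ‖w.2 - z.2‖) := by fun_prop
    simpa using this.tendsto z
  filter_upwards [ae_all_iff.2 h] with t ht
  refine continuous_iff_continuousAt.2 fun z => ?_
  obtain ⟨n, hn⟩ := exists_nat_gt ‖z‖
  refine (ht n).continuousAt.congr ?_
  filter_upwards [(isOpen_lt continuous_norm continuous_const).mem_nhds hn] with w hw
  have hw' : ‖w‖ < n := hw
  exact f.trunc_apply_of_mem t (mem_box_of_norm_le ((norm_fst_le w).trans hw'.le))
    (mem_box_of_norm_le ((norm_snd_le w).trans hw'.le))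

/-- An inequality that depends continuously on a parameter of a separable space, and that holds
for almost every `t` for each parameter, holds for all parameters simultaneously, for almost
every `t`. -/
theorem ae_forall_le_of_forall_ae_le {Θ : Type*} [TopologicalSpace Θ]
    [TopologicalSpace.SeparableSpace Θ] {F G : ℝ → Θ → ℝ} (hF : ∀ᵐ t : ℝ, Continuous (F t))
    (hG : ∀ᵐ t : ℝ, Continuous (G t)) (h : ∀ θ, ∀ᵐ t : ℝ, F t θ ≤ G t θ) :
    ∀ᵐ t : ℝ, ∀ θ, F t θ ≤ G t θ := by
  obtain ⟨D, hDc, hDd⟩ := TopologicalSpace.exists_countable_dense Θ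
  have h' : ∀ᵐ t : ℝ, ∀ θ ∈ D, F t θ ≤ G t θ := (ae_ball_iff hDc).2 fun θ _ => h θ
  filter_upwards [hF, hG, h'] with t h1 h2 h3 θ
  have hcl : IsClosed {θ | F t θ ≤ G t θ} := isClosed_le h1 h2
  have : closure D ⊆ {θ | F t θ ≤ G t θ} := hcl.closure_subset_iff.2 fun θ hθ => h3 θ hθ
  exact this (hDd θ)

/-! ### Integrability along continuous curves -/

theorem intervalIntegrable_of_locallyIntegrable {E : Type*} [NormedAddCommGroup E] {f : ℝ → E}
    (hf : LocallyIntegrable f volume) (a b : ℝ) : IntervalIntegrable f volume a b :=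
  (hf.integrableOn_isCompact isCompact_uIcc).intervalIntegrable

theorem LC.measurable_comp (f : LC N) {x y : ℝ → Vec N} (hx : Measurable x) (hy : Measurable y) :
    Measurable fun t => f t (x t) (y t) :=
  f.measurable'.comp (measurable_id.prodMk (hx.prodMk hy))

theorem HasGlobalBounds.locallyIntegrable {f : LC N} {m l : ℝ → ℝ} (hb : HasGlobalBounds f m l)
    {x y : ℝ → Vec N} (hx : Measurable x) (hy : Measurable y) :
    LocallyIntegrable (fun t => f t (x t) (y t)) volume := by
  refine hb.m_int.mono (f.measurable_comp hx hy).aestronglyMeasurable ?_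
  filter_upwards [hb.bound] with t ht
  exact (ht _ _).trans (le_abs_self _)

theorem LC.locallyIntegrable_comp (f : LC N) {ρ : ℝ} {x y : ℝ → Vec N}
    (hx : Measurable x) (hy : Measurable y) (hxb : ∀ t, x t ∈ box N ρ)
    (hyb : ∀ t, y t ∈ box N ρ) : LocallyIntegrable (fun t => f t (x t) (y t)) volume := by
  obtain ⟨m, l, hb⟩ := f.exists_hasGlobalBounds_trunc (le_max_left 0 ρ)
  have h := hb.locallyIntegrable hx hy
  convert h using 2 with t
  exact (f.trunc_apply_of_mem t (box_mono (le_max_right 0 ρ) (hxb t))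
    (box_mono (le_max_right 0 ρ) (hyb t))).symm

theorem LC.locallyIntegrable_apply (f : LC N) (x y : Vec N) :
    LocallyIntegrable (fun t => f t x y) volume :=
  f.locallyIntegrable_comp (ρ := max ‖x‖ ‖y‖) measurable_const measurable_const
    (fun _ => mem_box_of_norm_le (le_max_left _ _))
    (fun _ => mem_box_of_norm_le (le_max_right _ _))

/-! ### A Gronwall inequality with delay -/

theorem continuous_primitive_of_locallyIntegrable {E : Type*} [NormedAddCommGroup E]
    [NormedSpace ℝ E] {f : ℝ → E} (hf : LocallyIntegrable f volume) (a : ℝ) :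
    Continuous fun t => ∫ s in a..t, f s :=
  intervalIntegral.continuous_primitive (fun _ _ => intervalIntegrable_of_locallyIntegrable hf _ _) a

/-- A time `r ∈ [0,t]` at which the primitive of `l` attains a given value between `0` and its
value at `t`. -/
theorem exists_integral_eq {l : ℝ → ℝ} (hl : LocallyIntegrable l volume) {t c : ℝ} (ht : 0 ≤ t)
    (hc : 0 ≤ c) (hct : c ≤ ∫ s in (0 : ℝ)..t, l s) :
    ∃ r ∈ Icc 0 t, ∫ s in (0 : ℝ)..r, l s = c := by
  have := intermediate_value_Icc ht
    (continuous_primitive_of_locallyIntegrable hl 0).continuousOn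
  exact this ⟨by simpa using hc, hct⟩

/-- Gronwall's inequality for `w(t) ≤ A + ∫₀ᵗ l(s) (w(s) + w(s-1)) ds`, where `l` is merely locally
integrable. The constant only depends on `l` and `T`. -/
theorem exists_gronwall_const {l : ℝ → ℝ} (hl : LocallyIntegrable l volume) (hl0 : ∀ t, 0 ≤ l t)
    (T : ℝ) : ∃ K : ℝ, 0 ≤ K ∧ ∀ (A : ℝ) (w : ℝ → ℝ), 0 ≤ A → ContinuousOn w (Icc (-1) T) →
      (∀ t ∈ Icc (-1) T, 0 ≤ w t) → (∀ t ∈ Icc (-1 : ℝ) 0, w t ≤ A) →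
      (∀ t ∈ Icc 0 T, w t ≤ A + ∫ s in (0 : ℝ)..t, l s * (w s + w (s - 1))) →
      ∀ t ∈ Icc (-1) T, w t ≤ K * A := by
  have hli := intervalIntegrable_of_locallyIntegrable hl
  -- Induction on level sets of the primitive of `l`: between the levels `n/4` and `(n+1)/4` the
  -- supremum of `w` can be absorbed into the left-hand side.
  have key : ∀ n : ℕ, ∃ K : ℝ, 1 ≤ K ∧ ∀ (A : ℝ) (w : ℝ → ℝ), 0 ≤ A →
      ContinuousOn w (Icc (-1) T) → (∀ t ∈ Icc (-1) T, 0 ≤ w t) →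
      (∀ t ∈ Icc (-1 : ℝ) 0, w t ≤ A) →
      (∀ t ∈ Icc 0 T, w t ≤ A + ∫ s in (0 : ℝ)..t, l s * (w s + w (s - 1))) →
      ∀ t ∈ Icc 0 T, ∫ s in (0 : ℝ)..t, l s ≤ n / 4 → w t ≤ K * A := by
    have hint : ∀ w : ℝ → ℝ, ContinuousOn w (Icc (-1) T) → ∀ a ∈ Icc 0 T, ∀ b ∈ Icc 0 T,
        IntervalIntegrable (fun s => l s * (w s + w (s - 1))) volume a b := by
      intro w hw a ha b hb
      refine (hli a b).mul_continuousOn ?_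
      have hsub : uIcc a b ⊆ Icc 0 T := uIcc_subset_Icc ha hb
      refine ContinuousOn.add (hw.mono fun s hs => ?_) (hw.comp (by fun_prop) fun s hs => ?_)
      · have := hsub hs; exact ⟨by linarith [this.1], this.2⟩
      · have := hsub hs; exact ⟨by linarith [this.1], by linarith [this.2]⟩
    -- the integral over `[a,b]` is controlled by an upper bound of `w` on `[-1,b]`
    have hest : ∀ w : ℝ → ℝ, ContinuousOn w (Icc (-1) T) → ∀ a b B : ℝ, 0 ≤ a → a ≤ b → b ≤ T →
        (∀ s ∈ Icc (-1) b, w s ≤ B) →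
        ∫ s in a..b, l s * (w s + w (s - 1)) ≤ (∫ s in a..b, l s) * (2 * B) := by
      intro w hw a b B ha hab hb hB
      rw [← intervalIntegral.integral_mul_const]
      refine intervalIntegral.integral_mono_on hab (hint w hw a ⟨ha, hab.trans hb⟩ b
        ⟨ha.trans hab, hb⟩) ((hli a b).mul_const _) fun s hs => ?_
      refine mul_le_mul_of_nonneg_left ?_ (hl0 s)
      linarith [hB s ⟨by linarith [hs.1], hs.2⟩, hB (s - 1) ⟨by linarith [hs.1], by linarith [hs.2]⟩]
    intro n
    induction n with
    | zero =>
      refine ⟨1, le_rfl, fun A w hA hw hw0 hwA hwi t ht hlt => ?_⟩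
      obtain ⟨B, hB⟩ := isCompact_Icc.exists_bound_of_continuousOn hw
      have h1 := hest w hw 0 t B le_rfl ht.1 ht.2 fun s hs =>
        (le_abs_self _).trans (hB s ⟨hs.1, hs.2.trans ht.2⟩)
      have h2 : ∫ s in (0 : ℝ)..t, l s = 0 :=
        le_antisymm (by simpa using hlt) (intervalIntegral.integral_nonneg ht.1 fun s _ => hl0 s)
      rw [h2] at h1
      linarith [hwi t ht]
    | succ n ih =>
      obtain ⟨K, hK1, hK⟩ := ih
      refine ⟨2 + n * K + K, by nlinarith [(Nat.cast_nonneg n : (0 : ℝ) ≤ n)], ?_⟩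
      intro A w hA hw hw0 hwA hwi t ht hlt
      have hn : (0 : ℝ) ≤ n := Nat.cast_nonneg n
      have hnK : 0 ≤ (n * K) * A := by positivity
      have hKA : 0 ≤ K * A := by positivity
      obtain ⟨s, hs, hmax⟩ := isCompact_Icc.exists_isMaxOn (s := Icc (-1 : ℝ) t)
        ⟨t, by linarith [ht.1], le_rfl⟩ (hw.mono (Icc_subset_Icc_right ht.2))
      have hmax' : ∀ r ∈ Icc (-1) t, w r ≤ w s := fun r hr => hmax hr
      refine (hmax' t ⟨by linarith [ht.1], le_rfl⟩).trans ?_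
      have hgoal : w s ≤ A ∨ w s ≤ K * A ∨ w s ≤ (2 + n * K) * A := by
        rcases le_or_gt s 0 with hs0 | hs0
        · exact Or.inl (hwA s ⟨hs.1, hs0⟩)
        have hsT : s ∈ Icc 0 T := ⟨hs0.le, hs.2.trans ht.2⟩
        rcases le_or_gt (∫ u in (0 : ℝ)..s, l u) (n / 4) with hls | hls
        · exact Or.inr (Or.inl (hK A w hA hw hw0 hwA hwi s hsT hls))
        refine Or.inr (Or.inr ?_)
        obtain ⟨r, hr, hlr⟩ := exists_integral_eq hl hs0.le (by positivity) hls.le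
        have hrT : r ∈ Icc 0 T := ⟨hr.1, hr.2.trans hsT.2⟩
        have h1 := hest w hw 0 r (K * A) le_rfl hr.1 hrT.2 fun u hu => by
          rcases le_or_gt u 0 with hu0 | hu0
          · nlinarith [hwA u ⟨hu.1, hu0⟩]
          · refine hK A w hA hw hw0 hwA hwi u ⟨hu0.le, hu.2.trans hrT.2⟩ ?_
            rw [← hlr]
            exact intervalIntegral.integral_mono_interval le_rfl hu0.le hu.2
              (ae_of_all _ hl0) (hli _ _)
        have h2 := hest w hw r s (w s) hr.1 hr.2 hsT.2 fun u hu =>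
          hmax' u ⟨hu.1, hu.2.trans hs.2⟩
        have h3 : ∫ u in r..s, l u ≤ 1 / 4 := by
          have e := intervalIntegral.integral_add_adjacent_intervals (hli 0 r) (hli r s)
          have e2 : ∫ u in (0 : ℝ)..s, l u ≤ ∫ u in (0 : ℝ)..t, l u :=
            intervalIntegral.integral_mono_interval le_rfl hs0.le hs.2 (ae_of_all _ hl0) (hli _ _)
          push_cast at hlt
          linarith
        have h4 := hwi s hsT
        rw [← intervalIntegral.integral_add_adjacent_intervals
          (hint w hw 0 ⟨le_rfl, ht.1.trans ht.2⟩ r hrT) (hint w hw r hrT s hsT)] at h4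
        rw [hlr] at h1
        have h5 := hw0 s ⟨hs.1, hsT.2⟩
        nlinarith
      rcases hgoal with h | h | h <;> nlinarith
  obtain ⟨n, hn⟩ := exists_nat_ge (4 * ∫ s in (0 : ℝ)..T, l s)
  obtain ⟨K, hK1, hK⟩ := key n
  refine ⟨K, by linarith, fun A w hA hw hw0 hwA hwi t ht => ?_⟩
  rcases le_or_gt t 0 with ht0 | ht0
  · nlinarith [hwA t ⟨ht.1, ht0⟩]
  · refine hK A w hA hw hw0 hwA hwi t ⟨ht0.le, ht.2⟩ ?_
    have := intervalIntegral.integral_mono_interval le_rfl ht0.le ht.2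
      (ae_of_all _ hl0) (hli 0 T)
    linarith

/-! ### The global Lipschitz case -/

open scoped BoundedContinuousFunction in
/-- The bounded continuous extension by constants of an initial function to the real line. -/
def Hist.extend (φ : Hist N) : ℝ →ᵇ Vec N :=
  BoundedContinuousFunction.ofNormedAddCommGroup (fun t => φ (projIcc (-1) 0 (by norm_num) t))
    (φ.continuous.comp (continuous_projIcc (h := by norm_num))) ‖φ‖ fun _ => φ.norm_coe_le_norm _

theorem Hist.extend_of_mem (φ : Hist N) (s : Icc (-1 : ℝ) 0) : φ.extend s = φ s := by
  simp [Hist.extend]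

theorem Hist.extend_of_nonneg (φ : Hist N) {t : ℝ} (ht : 0 ≤ t) : φ.extend t = φ.extend 0 := by
  simp [Hist.extend, projIcc_of_right_le _ ht]

open scoped BoundedContinuousFunction in
/-- The Picard operator on `[0,T]`, extended by constants to the right of `T`. -/
def HasGlobalBounds.picard {f : LC N} {m l : ℝ → ℝ} (hb : HasGlobalBounds f m l) (φ : Hist N)
    (T : ℝ) (y : ℝ →ᵇ Vec N) : ℝ →ᵇ Vec N :=
  BoundedContinuousFunction.ofNormedAddCommGroup
    (fun t => φ.extend t + ∫ s in (0 : ℝ)..max 0 (min T t), f s (y s) (y (s - 1)))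
    (φ.extend.continuous.add ((continuous_primitive_of_locallyIntegrable
      (hb.locallyIntegrable y.continuous.measurable
        (y.continuous.comp (continuous_id.sub continuous_const)).measurable) 0).comp
      (by fun_prop)))
    (‖φ.extend‖ + ∫ s in (0 : ℝ)..max 0 T, m s) fun t => by
      refine (norm_add_le _ _).trans (add_le_add (φ.extend.norm_coe_le_norm _) ?_)
      refine (intervalIntegral.norm_integral_le_of_norm_le (g := m) (le_max_left _ _) ?_
        (intervalIntegrable_of_locallyIntegrable hb.m_int _ _)).trans ?_
      · filter_upwards [hb.bound] with s hs _ using hs _ _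
      · exact intervalIntegral.integral_mono_interval le_rfl (le_max_left _ _)
          (max_le_max le_rfl (min_le_left _ _)) (ae_of_all _ hb.m_nonneg)
          (intervalIntegrable_of_locallyIntegrable hb.m_int _ _)

open scoped BoundedContinuousFunction in
theorem HasGlobalBounds.picard_apply {f : LC N} {m l : ℝ → ℝ} (hb : HasGlobalBounds f m l)
    (φ : Hist N) (T : ℝ) (y : ℝ →ᵇ Vec N) (t : ℝ) : hb.picard φ T y t =
      φ.extend t + ∫ s in (0 : ℝ)..max 0 (min T t), f s (y s) (y (s - 1)) := rfl

open scoped BoundedContinuousFunction in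
/-- A fixed point of the Picard operator on `[0,T₁]` extends to one on `[0,T₂]` when the Lipschitz
bound has small integral over `[T₁,T₂]`: the Picard operator is a contraction on the functions
that agree with the given one up to `T₁`. -/
theorem HasGlobalBounds.exists_picard_extension {f : LC N} {m l : ℝ → ℝ}
    (hb : HasGlobalBounds f m l) (φ : Hist N) {T₁ T₂ : ℝ} (h1 : 0 ≤ T₁) (h12 : T₁ ≤ T₂)
    (hl : ∫ s in T₁..T₂, l s ≤ 1 / 4) {y₁ : ℝ →ᵇ Vec N} (hy₁ : hb.picard φ T₁ y₁ = y₁) :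
    ∃ y : ℝ →ᵇ Vec N, hb.picard φ T₂ y = y := by
  have hloc : ∀ y : ℝ →ᵇ Vec N, LocallyIntegrable (fun s => f s (y s) (y (s - 1))) volume :=
    fun y => hb.locallyIntegrable y.continuous.measurable
        (y.continuous.comp (continuous_id.sub continuous_const)).measurable
  have hli := intervalIntegrable_of_locallyIntegrable hb.l_int
  set S : Set (ℝ →ᵇ Vec N) := {y | ∀ t ≤ T₁, y t = y₁ t} with hS
  have hSc : IsClosed S := by
    have : S = ⋂ t : Iic T₁, {y : ℝ →ᵇ Vec N | y t = y₁ t} := by ext; simp [hS]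
    rw [this]
    exact isClosed_iInter fun t => isClosed_eq
      (by fun_prop) continuous_const
  have hmaps : MapsTo (hb.picard φ T₂) S S := by
    intro y hy t ht
    rw [← hy₁, hb.picard_apply, hb.picard_apply, min_eq_right ht, min_eq_right (ht.trans h12)]
    congr 1
    refine intervalIntegral.integral_congr fun s hs => ?_
    rw [uIcc_of_le (le_max_left _ _)] at hs
    have hs1 : s ≤ T₁ := hs.2.trans (max_le h1 ht)
    rw [hy s hs1, hy (s - 1) (by linarith)]
  have hcontr : ContractingWith (1 / 2) (MapsTo.restrict (hb.picard φ T₂) S S hmaps) := by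
    refine ⟨by rw [← NNReal.coe_lt_coe]; norm_num, LipschitzWith.of_dist_le_mul ?_⟩
    rintro ⟨y, hy⟩ ⟨z, hz⟩
    rw [Subtype.dist_eq, Subtype.dist_eq]
    simp only [MapsTo.val_restrict_apply]
    refine (BoundedContinuousFunction.dist_le (by positivity)).2 fun t => ?_
    rw [hb.picard_apply, hb.picard_apply, dist_add_left, dist_eq_norm,
      ← intervalIntegral.integral_sub (intervalIntegrable_of_locallyIntegrable (hloc y) _ _)
        (intervalIntegrable_of_locallyIntegrable (hloc z) _ _)]
    -- the two integrands agree up to `T₁`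
    have hbd : ∀ᵐ s : ℝ, ‖f s (y s) (y (s - 1)) - f s (z s) (z (s - 1))‖ ≤
        (Ioi T₁).indicator (fun s => l s * (2 * dist y z)) s := by
      filter_upwards [hb.lip] with s hs
      rcases le_or_gt s T₁ with hs1 | hs1
      · rw [hy s hs1, hz s hs1, hy (s - 1) (by linarith), hz (s - 1) (by linarith)]
        simp [not_lt.2 hs1]
      · rw [indicator_of_mem (show s ∈ Ioi T₁ from hs1)]
        refine (hs _ _ _ _).trans (mul_le_mul_of_nonneg_left ?_ (hb.l_nonneg s))
        rw [← dist_eq_norm, ← dist_eq_norm]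
        linarith [y.dist_coe_le_dist (g := z) s, y.dist_coe_le_dist (g := z) (s - 1)]
    have hind : LocallyIntegrable ((Ioi T₁).indicator (fun s => l s * (2 * dist y z))) volume := by
      refine LocallyIntegrable.indicator ?_ measurableSet_Ioi
      have h := hb.l_int.smul (2 * dist y z)
      have e : (2 * dist y z) • l = fun s => l s * (2 * dist y z) := by
        ext s
        simp [mul_comm]
      rwa [e] at h
    have hindi := intervalIntegrable_of_locallyIntegrable hind
    have hind0 : ∀ s, 0 ≤ (Ioi T₁).indicator (fun s => l s * (2 * dist y z)) s :=
      fun s => indicator_nonneg (fun s _ => mul_nonneg (hb.l_nonneg s) (by positivity)) s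
    calc _ ≤ ∫ s in (0 : ℝ)..max 0 (min T₂ t),
            (Ioi T₁).indicator (fun s => l s * (2 * dist y z)) s :=
          intervalIntegral.norm_integral_le_of_norm_le (le_max_left _ _)
            (hbd.mono fun s hs _ => hs) (hindi _ _)
      _ ≤ ∫ s in (0 : ℝ)..T₂, (Ioi T₁).indicator (fun s => l s * (2 * dist y z)) s :=
          intervalIntegral.integral_mono_interval le_rfl (le_max_left _ _)
            (max_le (h1.trans h12) (min_le_left _ _)) (ae_of_all _ hind0) (hindi _ _)
      _ = ∫ s in T₁..T₂, l s * (2 * dist y z) := by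
          rw [← intervalIntegral.integral_add_adjacent_intervals (hindi 0 T₁) (hindi T₁ T₂)]
          have e1 : ∫ s in (0 : ℝ)..T₁, (Ioi T₁).indicator (fun s => l s * (2 * dist y z)) s
              = 0 := by
            rw [intervalIntegral.integral_congr (g := fun _ => (0 : ℝ)), intervalIntegral.integral_zero]
            intro s hs
            rw [uIcc_of_le h1] at hs
            simp [not_lt.2 hs.2]
          rw [e1, zero_add]
          refine intervalIntegral.integral_congr_ae (ae_of_all _ fun s hs => ?_)
          rw [uIoc_of_le h12] at hs
          exact indicator_of_mem (show s ∈ Ioi T₁ from hs.1) _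
      _ ≤ _ := by
          rw [intervalIntegral.integral_mul_const]
          have := mul_le_mul_of_nonneg_right hl (show 0 ≤ 2 * dist y z by positivity)
          have e : ((1 / 2 : ℝ≥0) : ℝ) = 1 / 2 := by simp
          rw [e]
          linarith
  obtain ⟨y, -, hy, -⟩ := hcontr.exists_fixedPoint' hSc.isComplete hmaps
    (x := y₁) (fun t _ => rfl) (edist_ne_top _ _)
  exact ⟨y, hy⟩

/-- Solutions of vector fields with global bounds exist on every interval. -/
theorem HasGlobalBounds.exists_solution {f : LC N} {m l : ℝ → ℝ}
    (hb : HasGlobalBounds f m l) (φ : Hist N) {T : ℝ} (hT : 0 ≤ T) :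
    ∃ x : ℝ → Vec N, Continuous x ∧ IsSolutionOn f φ T x := by
  have hli := intervalIntegrable_of_locallyIntegrable hb.l_int
  have key : ∀ n : ℕ, ∀ T : ℝ, 0 ≤ T → ∫ s in (0 : ℝ)..T, l s ≤ n / 4 →
      ∃ y, hb.picard φ T y = y := by
    intro n
    induction n with
    | zero =>
      intro T hT hlT
      refine hb.exists_picard_extension φ le_rfl hT (by simp at hlT; linarith)
        (y₁ := φ.extend) ?_
      ext1 t
      have : max 0 (min 0 t) = 0 := max_eq_left (min_le_left _ _)
      rw [hb.picard_apply, this, intervalIntegral.integral_same, add_zero]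
    | succ n ih =>
      intro T hT hlT
      rcases le_or_gt (∫ s in (0 : ℝ)..T, l s) (n / 4) with h | h
      · exact ih T hT h
      · obtain ⟨r, hr, hlr⟩ := exists_integral_eq hb.l_int hT (by positivity) h.le
        obtain ⟨y, hy⟩ := ih r hr.1 hlr.le
        refine hb.exists_picard_extension φ hr.1 hr.2 ?_ hy
        have e := intervalIntegral.integral_add_adjacent_intervals (hli 0 r) (hli r T)
        push_cast at hlT
        linarith
  obtain ⟨n, hn⟩ := exists_nat_ge (4 * ∫ s in (0 : ℝ)..T, l s)
  obtain ⟨y, hy⟩ := key n T hT (by linarith)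
  have hy' : ∀ t, y t = φ.extend t + ∫ s in (0 : ℝ)..max 0 (min T t), f s (y s) (y (s - 1)) := by
    intro t
    rw [← hb.picard_apply, hy]
  have hy0 : y 0 = φ.extend 0 := by
    rw [hy' 0]
    simp [hT]
  refine ⟨y, y.continuous, y.continuous.continuousOn, ?_, ?_, ?_⟩
  · intro s
    have : max 0 (min T (s : ℝ)) = 0 := max_eq_left ((min_le_right _ _).trans s.2.2)
    rw [hy' s, this, intervalIntegral.integral_same, add_zero, Hist.extend_of_mem]
  · intro t _
    exact intervalIntegrable_of_locallyIntegrable (hb.locallyIntegrable y.continuous.measurable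
        (y.continuous.comp (continuous_id.sub continuous_const)).measurable) _ _
  · intro t ht
    rw [hy0, hy' t, min_eq_right ht.2, max_eq_right ht.1, φ.extend_of_nonneg ht.1]

theorem IsSolutionOn.apply_zero {f : LC N} {φ : Hist N} {T : ℝ} {x : ℝ → Vec N}
    (hx : IsSolutionOn f φ T x) : x 0 = φ ⟨0, by norm_num⟩ :=
  hx.initial ⟨0, by norm_num⟩

theorem continuousOn_shift {E : Type*} [TopologicalSpace E] {x : ℝ → E} {T : ℝ}
    (hx : ContinuousOn x (Icc (-1) T)) : ContinuousOn (fun s => x (s - 1)) (Icc 0 T) :=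
  hx.comp (by fun_prop) fun s hs => ⟨by linarith [hs.1], by linarith [hs.2]⟩

theorem intervalIntegrable_mul_delay {l w : ℝ → ℝ} (hl : LocallyIntegrable l volume) {T t : ℝ}
    (hw : ContinuousOn w (Icc (-1) T)) (ht : t ∈ Icc 0 T) :
    IntervalIntegrable (fun s => l s * (w s + w (s - 1))) volume 0 t := by
  refine (intervalIntegrable_of_locallyIntegrable hl _ _).mul_continuousOn ?_
  rw [uIcc_of_le ht.1]
  exact (hw.mono fun s hs => ⟨by linarith [hs.1], hs.2.trans ht.2⟩).add
    ((continuousOn_shift hw).mono (Icc_subset_Icc_right ht.2))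

theorem IsSolutionOn.eqOn_of_hasGlobalBounds {f : LC N} {m l : ℝ → ℝ}
    (hb : HasGlobalBounds f m l) {φ : Hist N} {T : ℝ} {x y : ℝ → Vec N}
    (hx : IsSolutionOn f φ T x) (hy : IsSolutionOn f φ T y) : EqOn x y (Icc (-1) T) := by
  obtain ⟨K, hK0, hK⟩ := exists_gronwall_const hb.l_int hb.l_nonneg T
  have hw : ContinuousOn (fun t => ‖x t - y t‖) (Icc (-1) T) :=
    (hx.continuousOn.sub hy.continuousOn).norm
  intro t ht
  have := hK 0 _ le_rfl hw (fun t _ => norm_nonneg _) ?_ ?_ t ht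
  · rw [mul_zero] at this
    exact sub_eq_zero.1 (norm_le_zero_iff.1 this)
  · intro s hs
    have h1 := hx.initial ⟨s, hs⟩
    have h2 := hy.initial ⟨s, hs⟩
    simp only at h1 h2
    simp [h1, h2]
  · intro s hs
    rw [hx.integral_eq s hs, hy.integral_eq s hs, hx.apply_zero, hy.apply_zero, add_sub_add_left_eq_sub,
      ← intervalIntegral.integral_sub (hx.integrable s hs) (hy.integrable s hs), zero_add]
    refine intervalIntegral.norm_integral_le_of_norm_le hs.1 ?_
      (intervalIntegrable_mul_delay hb.l_int hw hs)
    filter_upwards [hb.lip] with u hu _ using hu _ _ _ _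

/-! ### Solutions and maximal intervals -/

theorem IsSolutionOn.mono {f : LC N} {φ : Hist N} {T T' : ℝ} {x : ℝ → Vec N}
    (hx : IsSolutionOn f φ T x) (h : T' ≤ T) : IsSolutionOn f φ T' x :=
  ⟨hx.continuousOn.mono (Icc_subset_Icc_right h), hx.initial,
    fun t ht => hx.integrable t ⟨ht.1, ht.2.trans h⟩,
    fun t ht => hx.integral_eq t ⟨ht.1, ht.2.trans h⟩⟩

/-- Solutions only depend on the values of the vector field along them. -/
theorem IsSolutionOn.congr_field {f g : LC N} {φ : Hist N} {T : ℝ} {x : ℝ → Vec N}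
    (hx : IsSolutionOn f φ T x)
    (h : ∀ t ∈ Icc 0 T, f t (x t) (x (t - 1)) = g t (x t) (x (t - 1))) :
    IsSolutionOn g φ T x := by
  have h' : ∀ t ∈ Icc 0 T, EqOn (fun s => f s (x s) (x (s - 1)))
      (fun s => g s (x s) (x (s - 1))) (uIcc 0 t) := by
    intro t ht s hs
    rw [uIcc_of_le ht.1] at hs
    exact h s ⟨hs.1, hs.2.trans ht.2⟩
  refine ⟨hx.continuousOn, hx.initial,
    fun t ht => (hx.integrable t ht).congr ((h' t ht).mono uIoc_subset_uIcc), fun t ht => ?_⟩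
  rw [hx.integral_eq t ht, intervalIntegral.integral_congr (h' t ht)]

theorem IsSolutionOn.congr {f : LC N} {φ : Hist N} {T : ℝ} {x y : ℝ → Vec N} (hT : 0 ≤ T)
    (hx : IsSolutionOn f φ T x) (h : EqOn y x (Icc (-1) T)) : IsSolutionOn f φ T y := by
  have h' : ∀ t ∈ Icc 0 T, EqOn (fun s => f s (x s) (x (s - 1)))
      (fun s => f s (y s) (y (s - 1))) (uIcc 0 t) := by
    intro t ht s hs
    rw [uIcc_of_le ht.1] at hs
    simp only
    rw [h ⟨by linarith [hs.1], hs.2.trans ht.2⟩, h ⟨by linarith [hs.1], by linarith [hs.2, ht.2]⟩]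
  refine ⟨hx.continuousOn.congr h, fun s => ?_,
    fun t ht => (hx.integrable t ht).congr ((h' t ht).mono uIoc_subset_uIcc), fun t ht => ?_⟩
  · rw [h ⟨s.2.1, s.2.2.trans hT⟩, hx.initial]
  · rw [h ⟨by linarith [ht.1], ht.2⟩, h ⟨by norm_num, hT⟩, hx.integral_eq t ht,
      intervalIntegral.integral_congr (h' t ht)]

theorem IsSolutionOn.trunc {f : LC N} {φ : Hist N} {T ρ : ℝ} {x : ℝ → Vec N}
    (hx : IsSolutionOn f φ T x) (h : ∀ t ∈ Icc (-1) T, ‖x t‖ ≤ ρ) :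
    IsSolutionOn (f.trunc ρ) φ T x :=
  hx.congr_field fun t ht => (f.trunc_apply_of_mem t
    (mem_box_of_norm_le (h t ⟨by linarith [ht.1], ht.2⟩))
    (mem_box_of_norm_le (h (t - 1) ⟨by linarith [ht.1], by linarith [ht.2]⟩))).symm

theorem IsSolutionOn.of_trunc {f : LC N} {φ : Hist N} {T ρ : ℝ} {x : ℝ → Vec N}
    (hx : IsSolutionOn (f.trunc ρ) φ T x) (h : ∀ t ∈ Icc (-1) T, ‖x t‖ ≤ ρ) :
    IsSolutionOn f φ T x :=
  hx.congr_field fun t ht => f.trunc_apply_of_mem t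
    (mem_box_of_norm_le (h t ⟨by linarith [ht.1], ht.2⟩))
    (mem_box_of_norm_le (h (t - 1) ⟨by linarith [ht.1], by linarith [ht.2]⟩))

theorem IsSolutionOn.exists_bound {f : LC N} {φ : Hist N} {T : ℝ} {x : ℝ → Vec N}
    (hx : IsSolutionOn f φ T x) : ∃ M, 0 ≤ M ∧ ∀ t ∈ Icc (-1) T, ‖x t‖ ≤ M := by
  obtain ⟨M, hM⟩ := isCompact_Icc.exists_bound_of_continuousOn hx.continuousOn
  exact ⟨max 0 M, le_max_left _ _, fun t ht => (hM t ht).trans (le_max_right _ _)⟩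

theorem IsSolutionOn.eqOn {f : LC N} {φ : Hist N} {T : ℝ} {x y : ℝ → Vec N}
    (hx : IsSolutionOn f φ T x) (hy : IsSolutionOn f φ T y) : EqOn x y (Icc (-1) T) := by
  obtain ⟨M, hM0, hM⟩ := hx.exists_bound
  obtain ⟨M', -, hM'⟩ := hy.exists_bound
  obtain ⟨m, l, hb⟩ := f.exists_hasGlobalBounds_trunc (hM0.trans (le_max_left M M'))
  exact (hx.trunc fun t ht => (hM t ht).trans (le_max_left _ _)).eqOn_of_hasGlobalBounds hb
    (hy.trunc fun t ht => (hM' t ht).trans (le_max_right _ _))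

theorem IsSolutionOn.sol_eqOn {f : LC N} {φ : Hist N} {T : ℝ} {x : ℝ → Vec N} (hT : 0 ≤ T)
    (hx : IsSolutionOn f φ T x) : EqOn (sol f φ) x (Icc (-1) T) := by
  intro t ht
  have h : ∃ x : ℝ → Vec N, ∃ T : ℝ, 0 ≤ T ∧ t ∈ Icc (-1) T ∧ IsSolutionOn f φ T x :=
    ⟨x, T, hT, ht, hx⟩
  rw [sol, dif_pos h]
  obtain ⟨T', hT', ht', hx'⟩ := h.choose_spec
  exact (hx'.mono (min_le_right T T')).eqOn (hx.mono (min_le_left T T')) ⟨ht.1, le_min ht.2 ht'.2⟩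

theorem IsSolutionOn.mem_existenceInterval {f : LC N} {φ : Hist N} {T t : ℝ} {x : ℝ → Vec N}
    (hT : 0 ≤ T) (hx : IsSolutionOn f φ T x) (ht : t ∈ Icc (-1) T) :
    t ∈ existenceInterval f φ := ⟨T, hT, ht, x, hx⟩

theorem isSolutionOn_sol {f : LC N} {φ : Hist N} {T : ℝ} (hT : 0 ≤ T)
    (h : T ∈ existenceInterval f φ) : IsSolutionOn f φ T (sol f φ) := by
  obtain ⟨T', hT', hTT', x, hx⟩ := h
  have := hx.mono hTT'.2
  exact this.congr hT (this.sol_eqOn hT)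

theorem mem_existenceInterval_of_le {f : LC N} {φ : Hist N} {s t : ℝ}
    (ht : t ∈ existenceInterval f φ) (hs : -1 ≤ s) (hst : s ≤ t) : s ∈ existenceInterval f φ := by
  obtain ⟨T, hT, htT, x, hx⟩ := ht
  exact ⟨T, hT, ⟨hs, hst.trans htT.2⟩, x, hx⟩

theorem Icc_subset_existenceInterval {f : LC N} {φ : Hist N} {T : ℝ}
    (hT : T ∈ existenceInterval f φ) : Icc (-1) T ⊆ existenceInterval f φ :=
  fun _ ht => mem_existenceInterval_of_le hT ht.1 ht.2

theorem zero_mem_existenceInterval (f : LC N) (φ : Hist N) : (0 : ℝ) ∈ existenceInterval f φ := by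
  refine ⟨0, le_rfl, by norm_num, φ.extend, φ.extend.continuous.continuousOn,
    φ.extend_of_mem, ?_, ?_⟩
  · rintro t ht
    obtain rfl : t = 0 := le_antisymm ht.2 ht.1
    exact IntervalIntegrable.refl
  · rintro t ht
    obtain rfl : t = 0 := le_antisymm ht.2 ht.1
    simp

theorem sol_of_mem_initial (f : LC N) (φ : Hist N) (s : Icc (-1 : ℝ) 0) : sol f φ s = φ s :=
  (isSolutionOn_sol le_rfl (zero_mem_existenceInterval f φ)).initial s

/-- The maximal interval is open to the right. -/
theorem exists_gt_mem_existenceInterval {f : LC N} {φ : Hist N} {T : ℝ} (hT : 0 ≤ T)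
    (h : T ∈ existenceInterval f φ) : ∃ T' > T, T' ∈ existenceInterval f φ := by
  have hs := isSolutionOn_sol hT h
  obtain ⟨M, hM0, hM⟩ := hs.exists_bound
  obtain ⟨m, l, hb⟩ := f.exists_hasGlobalBounds_trunc (show 0 ≤ M + 1 by linarith)
  obtain ⟨y, hyc, hy⟩ := hb.exists_solution φ (show 0 ≤ T + 1 by linarith)
  have heq : EqOn y (sol f φ) (Icc (-1) T) :=
    (hy.mono (by linarith)).eqOn_of_hasGlobalBounds hb
      (hs.trunc fun t ht => (hM t ht).trans (by linarith))
  have hyT : ‖y T‖ < M + 1 := by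
    rw [heq ⟨by linarith, le_rfl⟩]
    linarith [hM T ⟨by linarith, le_rfl⟩]
  obtain ⟨δ, hδ, hball⟩ := Metric.eventually_nhds_iff.1
    ((hyc.norm.tendsto T).eventually (gt_mem_nhds hyT))
  have hT' : T < T + min (δ / 2) 1 := by linarith [lt_min (half_pos hδ) one_pos]
  refine ⟨T + min (δ / 2) 1, hT', ?_⟩
  refine IsSolutionOn.mem_existenceInterval (by linarith)
    ((hy.mono (show T + min (δ / 2) 1 ≤ T + 1 by linarith [min_le_right (δ / 2) 1])).of_trunc ?_)
    ⟨by linarith, le_rfl⟩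
  intro t ht
  rcases le_or_gt t T with htT | htT
  · rw [heq ⟨ht.1, htT⟩]
    linarith [hM t ⟨ht.1, htT⟩]
  · refine (hball ?_).le
    rw [Real.dist_eq, abs_of_pos (by linarith)]
    linarith [ht.2, min_le_left (δ / 2) 1]

/-- A solution that stays bounded on `[0,T]`, as long as it exists, does exist up to `T`. -/
theorem mem_existenceInterval_of_bounded {f : LC N} {φ : Hist N} {T M : ℝ} (hT : 0 ≤ T)
    (hM : ∀ t ∈ Icc 0 T, t ∈ existenceInterval f φ → ‖sol f φ t‖ ≤ M) :
    T ∈ existenceInterval f φ := by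
  set ρ := max M ‖φ‖ + 1 with hρ
  have hρ0 : 0 ≤ ρ := by
    have := (norm_nonneg φ).trans (le_max_right M ‖φ‖)
    linarith
  obtain ⟨m, l, hb⟩ := f.exists_hasGlobalBounds_trunc hρ0
  obtain ⟨y, hyc, hy⟩ := hb.exists_solution φ hT
  have hy0 : ∀ t ∈ Icc (-1 : ℝ) 0, ‖y t‖ < ρ := by
    intro t ht
    have := hy.initial ⟨t, ht⟩
    simp only at this
    rw [this]
    linarith [φ.norm_coe_le_norm ⟨t, ht⟩, le_max_right M ‖φ‖]
  by_cases hex : ∃ t ∈ Icc 0 T, ρ ≤ ‖y t‖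
  · exfalso
    -- the first time at which the truncated solution reaches norm `ρ`
    set C := {t | t ∈ Icc 0 T ∧ ρ ≤ ‖y t‖} with hC
    have hCc : IsCompact C := isCompact_Icc.inter_right (isClosed_le continuous_const hyc.norm)
    obtain ⟨t, htC, htmin⟩ := hCc.exists_isLeast hex
    have hlt : ∀ s ∈ Icc (-1) t, s < t → ‖y s‖ < ρ := by
      intro s hs hst
      rcases le_or_gt s 0 with h0 | h0
      · exact hy0 s ⟨hs.1, h0⟩
      · by_contra! hcon
        exact absurd (htmin ⟨⟨h0.le, hst.le.trans htC.1.2⟩, hcon⟩) (not_le.2 hst)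
    have hle : ‖y t‖ ≤ ρ := by
      have ht0 : 0 < t := by
        refine lt_of_le_of_ne htC.1.1 fun h => ?_
        have := hy0 0 (by norm_num)
        rw [h] at this
        exact absurd htC.2 (not_le.2 this)
      refine le_of_tendsto (hyc.norm.continuousWithinAt (s := Iio t) (x := t)) ?_
      filter_upwards [Ioo_mem_nhdsLT ht0] with s hs
      exact (hlt s ⟨by linarith [hs.1], hs.2.le⟩ hs.2).le
    have hsol : IsSolutionOn f φ t y := (hy.mono htC.1.2).of_trunc fun s hs => by
      rcases hs.2.lt_or_eq with h | h
      · exact (hlt s hs h).le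
      · rwa [h]
    have hmem : t ∈ Icc (-1) t := ⟨by linarith [htC.1.1], le_rfl⟩
    have := hM t htC.1 (hsol.mem_existenceInterval htC.1.1 hmem)
    rw [hsol.sol_eqOn htC.1.1 hmem] at this
    linarith [htC.2, le_max_left M ‖φ‖]
  · push Not at hex
    refine IsSolutionOn.mem_existenceInterval hT (hy.of_trunc fun t ht => ?_)
      ⟨by linarith, le_rfl⟩
    rcases le_or_gt t 0 with h0 | h0
    · exact (hy0 t ⟨ht.1, h0⟩).le
    · exact (hex t ⟨h0.le, ht.2⟩).le

theorem hasUniqueMaximalSolution (f : LC N) (φ : Hist N) : HasUniqueMaximalSolution f φ := by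
  have hopen : ∀ t ∈ existenceInterval f φ, ∃ t' ∈ existenceInterval f φ, t < t' ∧ 0 < t' := by
    intro t ht
    have hmax : max 0 t ∈ existenceInterval f φ := by
      rcases le_total 0 t with h | h
      · rwa [max_eq_right h]
      · rw [max_eq_left h]
        exact zero_mem_existenceInterval f φ
    obtain ⟨t', ht', h⟩ := exists_gt_mem_existenceInterval (le_max_left 0 t) hmax
    exact ⟨t', h, (le_max_right _ _).trans_lt ht', (le_max_left _ _).trans_lt ht'⟩
  refine ⟨⟨sSup ((fun t : ℝ => (t : EReal)) '' existenceInterval f φ), ?_, ?_⟩, ?_⟩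
  · obtain ⟨t, ht, -, ht0⟩ := hopen 0 (zero_mem_existenceInterval f φ)
    exact lt_sSup_iff.2 ⟨_, mem_image_of_mem _ ht, by exact_mod_cast ht0⟩
  · ext t
    constructor
    · intro ht
      obtain ⟨t', ht', h, -⟩ := hopen t ht
      obtain ⟨T, -, htT, -⟩ := ht
      exact ⟨htT.1, lt_sSup_iff.2 ⟨_, mem_image_of_mem _ ht', by exact_mod_cast h⟩⟩
    · rintro ⟨h1, h2⟩
      obtain ⟨_, ⟨t', ht', rfl⟩, h⟩ := lt_sSup_iff.1 h2
      exact mem_existenceInterval_of_le ht' h1 (EReal.coe_le_coe_iff.1 h.le)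
  · intro T hT hTm
    exact ⟨isSolutionOn_sol hT hTm, fun y hy => (hy.sol_eqOn hT).symm⟩

/-! ### Kamke's conditions and comparison of solutions -/

/-- Kamke's conditions in both variables, for almost every `t` and all arguments simultaneously. -/
theorem LC.ae_kamke {f : LC N} (hx : f.Kx) (hy : f.Ky) : ∀ᵐ t : ℝ, ∀ (a b c d : Vec N) (k : Fin N),
    (∀ i, a i ≤ b i) → a k = b k → (∀ i, c i ≤ d i) → f t a c k ≤ f t b d k := by
  -- The admissible quadruples are parametrized continuously by a linear space.
  let B : Fin N → Vec N × Vec N × Vec N × Vec N → Vec N := fun k θ =>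
    WithLp.toLp 2 fun i => if i = k then θ.1 i else θ.1 i + |θ.2.1 i|
  let D : Vec N × Vec N × Vec N × Vec N → Vec N := fun θ =>
    WithLp.toLp 2 fun i => θ.2.2.1 i + |θ.2.2.2 i|
  have hB : ∀ k, Continuous (B k) := by
    intro k
    refine (PiLp.continuous_toLp 2 _).comp (continuous_pi fun i => ?_)
    split_ifs <;> fun_prop
  have hD : Continuous D := by fun_prop
  have key : ∀ k : Fin N, ∀ᵐ t : ℝ, ∀ θ : Vec N × Vec N × Vec N × Vec N,
      f t θ.1 θ.2.2.1 k ≤ f t (B k θ) (D θ) k := by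
    intro k
    refine ae_forall_le_of_forall_ae_le (F := fun t θ => f t θ.1 θ.2.2.1 k)
      (G := fun t θ => f t (B k θ) (D θ) k) ?_ ?_ fun θ => ?_
    · filter_upwards [f.ae_continuous] with t ht
      exact (EuclideanSpace.proj k : Vec N →L[ℝ] ℝ).continuous.comp
        (ht.comp (continuous_fst.prodMk (by fun_prop :
          Continuous fun θ : Vec N × Vec N × Vec N × Vec N => θ.2.2.1)))
    · filter_upwards [f.ae_continuous] with t ht
      exact (EuclideanSpace.proj k : Vec N →L[ℝ] ℝ).continuous.comp (ht.comp ((hB k).prodMk hD))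
    · have h1 := hx θ.1 (B k θ) θ.2.2.1 k (fun i => by
        simp only [B]; split_ifs
        · exact le_rfl
        · linarith [abs_nonneg (θ.2.1 i)]) (by simp [B])
      have h2 := hy (B k θ) θ.2.2.1 (D θ) (fun i => by
        simp only [D]; linarith [abs_nonneg (θ.2.2.2 i)]) k
      filter_upwards [h1, h2] with t h1 h2 using h1.trans h2
  filter_upwards [ae_all_iff.2 key] with t ht a b c d k hab hk hcd
  have e1 : B k (a, b - a, c, d - c) = b := by
    ext i
    simp only [B, PiLp.sub_apply]
    split_ifs with h
    · rw [h, hk]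
    · rw [abs_of_nonneg (sub_nonneg.2 (hab i))]; ring
  have e2 : D (a, b - a, c, d - c) = d := by
    ext i
    simp only [D, PiLp.sub_apply]
    rw [abs_of_nonneg (sub_nonneg.2 (hcd i))]; ring
  have := ht k (a, b - a, c, d - c)
  rwa [e1, e2] at this

theorem integral_apply {F : ℝ → Vec N} {a b : ℝ} (hF : IntervalIntegrable F volume a b)
    (k : Fin N) : (∫ s in a..b, F s) k = ∫ s in a..b, F s k :=
  ((EuclideanSpace.proj k : Vec N →L[ℝ] ℝ).intervalIntegral_comp_comm hF).symm

theorem integral_le_integral_of_ae {F G : ℝ → ℝ} {a b : ℝ} (hab : a ≤ b)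
    (hF : IntervalIntegrable F volume a b) (hG : IntervalIntegrable G volume a b)
    (h : ∀ᵐ s : ℝ, s ∈ Ioc a b → F s ≤ G s) : ∫ s in a..b, F s ≤ ∫ s in a..b, G s := by
  rw [intervalIntegral.integral_of_le hab, intervalIntegral.integral_of_le hab]
  exact setIntegral_mono_on_ae hF.1 hG.1 measurableSet_Ioc h

theorem intervalIntegrable_apply {F : ℝ → Vec N} {a b : ℝ} (hF : IntervalIntegrable F volume a b)
    (k : Fin N) : IntervalIntegrable (fun s => F s k) volume a b :=
  ⟨(EuclideanSpace.proj k : Vec N →L[ℝ] ℝ).integrable_comp hF.1,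
    (EuclideanSpace.proj k : Vec N →L[ℝ] ℝ).integrable_comp hF.2⟩

theorem IsSolutionOn.intervalIntegrable {f : LC N} {φ : Hist N} {T s t : ℝ} {x : ℝ → Vec N}
    (hx : IsSolutionOn f φ T x) (hs : s ∈ Icc 0 T) (ht : t ∈ Icc 0 T) :
    IntervalIntegrable (fun s => f s (x s) (x (s - 1))) volume s t :=
  (hx.integrable s hs).symm.trans (hx.integrable t ht)

theorem IsSolutionOn.sub_eq {f : LC N} {φ : Hist N} {T s t : ℝ} {x : ℝ → Vec N}
    (hx : IsSolutionOn f φ T x) (hs : s ∈ Icc 0 T) (ht : t ∈ Icc 0 T) :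
    x t - x s = ∫ u in s..t, f u (x u) (x (u - 1)) := by
  rw [hx.integral_eq t ht, hx.integral_eq s hs, add_sub_add_left_eq_sub,
    intervalIntegral.integral_interval_sub_left (hx.integrable t ht) (hx.integrable s hs)]

/-- Solutions of vector fields that satisfy Kamke's conditions preserve the order of the initial
functions: Gronwall's inequality applies to the sum of the positive parts of `x_k - y_k`. -/
theorem IsSolutionOn.le_of_kamke {f : LC N} (hfx : f.Kx) (hfy : f.Ky) {φ ψ : Hist N}
    (hφψ : ∀ s i, φ s i ≤ ψ s i) {T : ℝ} {x y : ℝ → Vec N} (hx : IsSolutionOn f φ T x)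
    (hy : IsSolutionOn f ψ T y) : ∀ t ∈ Icc (-1) T, ∀ i, x t i ≤ y t i := by
  obtain ⟨M, hM0, hM⟩ := hx.exists_bound
  obtain ⟨M', -, hM'⟩ := hy.exists_bound
  set ρ := max M M' with hρ
  obtain ⟨m, l, hb⟩ := f.exists_hasGlobalBounds_trunc (hM0.trans (le_max_left M M'))
  have hx' := hx.trunc (ρ := ρ) fun t ht => (hM t ht).trans (le_max_left _ _)
  have hy' := hy.trunc (ρ := ρ) fun t ht => (hM' t ht).trans (le_max_right _ _)
  set w : ℝ → ℝ := fun t => ∑ k, max (x t k - y t k) 0 with hw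
  have hxk : ∀ k, ContinuousOn (fun t => x t k) (Icc (-1) T) := fun k =>
    (EuclideanSpace.proj k : Vec N →L[ℝ] ℝ).continuous.comp_continuousOn hx.continuousOn
  have hyk : ∀ k, ContinuousOn (fun t => y t k) (Icc (-1) T) := fun k =>
    (EuclideanSpace.proj k : Vec N →L[ℝ] ℝ).continuous.comp_continuousOn hy.continuousOn
  have hwc : ContinuousOn w (Icc (-1) T) := continuousOn_finsetSum _ fun k _ =>
    ((hxk k).sub (hyk k)).sup continuousOn_const
  have hw0 : ∀ t, 0 ≤ w t := fun t => Finset.sum_nonneg fun k _ => le_max_right _ _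
  have hinit : ∀ t ∈ Icc (-1 : ℝ) 0, ∀ k, x t k ≤ y t k := by
    intro t ht k
    have h1 := hx.initial ⟨t, ht⟩
    have h2 := hy.initial ⟨t, ht⟩
    simp only at h1 h2
    rw [h1, h2]
    exact hφψ _ _
  have hpt : ∀ᵐ s : ℝ, ∀ k, y s k ≤ x s k →
      f.trunc ρ s (x s) (x (s - 1)) k - f.trunc ρ s (y s) (y (s - 1)) k ≤
        l s * (w s + w (s - 1)) := by
    filter_upwards [LC.ae_kamke hfx hfy, hb.lip] with s h1 h2 k hk
    -- compare `x` with the componentwise maximum of `x` and `y`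
    let z : ℝ → Vec N := fun s => WithLp.toLp 2 fun i => max (x s i) (y s i)
    have hz : ∀ s, ‖z s - y s‖ ≤ w s := fun s => by
      refine (norm_le_sum_abs _).trans_eq (Finset.sum_congr rfl fun i _ => ?_)
      have : (z s - y s) i = max (x s i - y s i) 0 := by
        rw [← sub_self (y s i), max_sub_sub_right]; simp [z]
      rw [this, abs_of_nonneg (le_max_right _ _)]
    have h3 : f.trunc ρ s (x s) (x (s - 1)) k ≤ f.trunc ρ s (z s) (z (s - 1)) k := by
      refine h1 _ _ _ _ k (fun i => clamp_mono ρ (le_max_left _ _)) ?_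
        (fun i => clamp_mono ρ (le_max_left _ _))
      simp [z, hk]
    have h4 := h2 (z s) (z (s - 1)) (y s) (y (s - 1))
    have h5 := (le_abs_self _).trans
      (abs_apply_le_norm (f.trunc ρ s (z s) (z (s - 1)) - f.trunc ρ s (y s) (y (s - 1))) k)
    rw [PiLp.sub_apply] at h5
    have h6 : l s * (‖z s - y s‖ + ‖z (s - 1) - y (s - 1)‖) ≤ l s * (w s + w (s - 1)) :=
      mul_le_mul_of_nonneg_left (add_le_add (hz s) (hz (s - 1))) (hb.l_nonneg s)
    linarith
  have hv : ∀ t ∈ Icc 0 T, ∀ k, max (x t k - y t k) 0 ≤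
      ∫ s in (0 : ℝ)..t, l s * (w s + w (s - 1)) := by
    intro t ht k
    have hh0 : ∀ s, 0 ≤ l s * (w s + w (s - 1)) := fun s =>
      mul_nonneg (hb.l_nonneg s) (add_nonneg (hw0 _) (hw0 _))
    have hhi := intervalIntegrable_mul_delay hb.l_int hwc ht
    refine max_le ?_ (intervalIntegral.integral_nonneg ht.1 fun s _ => hh0 s)
    -- the last time before `t` at which `x_k ≤ y_k`
    have hC : IsCompact {s | s ∈ Icc 0 t ∧ x s k - y s k ≤ 0} := by
      have hcont : ContinuousOn (fun s => x s k - y s k) (Icc 0 t) :=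
        ((hxk k).sub (hyk k)).mono fun s hs => ⟨by linarith [hs.1], hs.2.trans ht.2⟩
      have := hcont.preimage_isClosed_of_isClosed isClosed_Icc (isClosed_Iic (a := (0 : ℝ)))
      exact isCompact_Icc.of_isClosed_subset this fun s hs => hs.1
    obtain ⟨r, ⟨hr, hr0⟩, hrmax⟩ := hC.exists_isGreatest
      ⟨0, ⟨le_rfl, ht.1⟩, sub_nonpos.2 (hinit 0 (by norm_num) k)⟩
    have hrT : r ∈ Icc 0 T := ⟨hr.1, hr.2.trans ht.2⟩
    have e := congrArg (fun v : Vec N => v k) (hx'.sub_eq hrT ht)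
    have e' := congrArg (fun v : Vec N => v k) (hy'.sub_eq hrT ht)
    have i1 := hx'.intervalIntegrable hrT ht
    have i2 := hy'.intervalIntegrable hrT ht
    simp only [PiLp.sub_apply] at e e'
    rw [integral_apply i1] at e
    rw [integral_apply i2] at e'
    have h1 : (∫ s in r..t, f.trunc ρ s (x s) (x (s - 1)) k) -
        ∫ s in r..t, f.trunc ρ s (y s) (y (s - 1)) k ≤
        ∫ s in r..t, l s * (w s + w (s - 1)) := by
      rw [← intervalIntegral.integral_sub (intervalIntegrable_apply i1 k)
        (intervalIntegrable_apply i2 k)]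
      have hsub : IntervalIntegrable (fun s => l s * (w s + w (s - 1))) volume r t :=
        hhi.mono_set (by rw [uIcc_of_le ht.1, uIcc_of_le hr.2]; exact Icc_subset_Icc_left hr.1)
      refine integral_le_integral_of_ae hr.2 ((intervalIntegrable_apply i1 k).sub
        (intervalIntegrable_apply i2 k)) hsub ?_
      filter_upwards [hpt] with s hs hsr
      refine hs k (le_of_lt ?_)
      by_contra! hcon
      exact absurd (hrmax ⟨⟨hr.1.trans hsr.1.le, hsr.2⟩, sub_nonpos.2 hcon⟩) (not_le.2 hsr.1)
    have h2 : ∫ s in r..t, l s * (w s + w (s - 1)) ≤ ∫ s in (0 : ℝ)..t, l s * (w s + w (s - 1)) :=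
      intervalIntegral.integral_mono_interval hr.1 hr.2 le_rfl (ae_of_all _ hh0) hhi
    linarith
  obtain ⟨K, hK0, hK⟩ := exists_gronwall_const (l := fun s => (N : ℝ) * l s)
    (hb.l_int.smul (N : ℝ)) (fun t => mul_nonneg (Nat.cast_nonneg _) (hb.l_nonneg t)) T
  intro t ht i
  have := hK 0 w le_rfl hwc (fun t _ => hw0 t) ?_ ?_ t ht
  · rw [mul_zero] at this
    have h1 := (Finset.single_le_sum (f := fun k => max (x t k - y t k) 0)
      (fun k _ => le_max_right _ _) (Finset.mem_univ i)).trans this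
    linarith [le_max_left (x t i - y t i) 0]
  · intro s hs
    refine (Finset.sum_eq_zero fun k _ => ?_).le
    exact max_eq_right (sub_nonpos.2 (hinit s hs k))
  · intro s hs
    refine (Finset.sum_le_sum fun k _ => hv s hs k).trans_eq ?_
    simp only [mul_assoc, intervalIntegral.integral_const_mul]
    simp

/-! ### One-sided Lipschitz estimates for quasimonotone vector fields -/

/-- The one-sided Lipschitz estimate on the cube of radius `ρ`, with coefficient `U`, that follows
from Kamke's conditions and a Lipschitz condition of each `f_k` in the single variable `x_k`. It
passes from values at the corners of small cubes to values inside. -/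
def HasSandwichBound (f : LC N) (ρ : ℝ) (U : ℝ → ℝ) : Prop :=
  ∀ᵐ t : ℝ, ∀ a ∈ box N ρ, ∀ b ∈ box N ρ, ∀ c ∈ box N ρ, ∀ d ∈ box N ρ,
    (∀ i, a i ≤ b i) → (∀ i, c i ≤ d i) → ∀ k, f t a c k ≤ f t b d k + U t * (b k - a k)

/-- Replacement of the `k`-th coordinate. -/
def updateCoord (x : Vec N) (k : Fin N) (r : ℝ) : Vec N :=
  WithLp.toLp 2 fun i => if i = k then r else x i

@[simp] theorem updateCoord_apply (x : Vec N) (k : Fin N) (r : ℝ) (i : Fin N) :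
    updateCoord x k r i = if i = k then r else x i := rfl

/-- A Lipschitz condition in the single variable `x_k` holds, for almost every `t`, for all
arguments simultaneously. -/
theorem LC.ae_lipschitz_coord {f : LC N} {k : Fin N} {ρ j : ℝ} (hρ : 0 ≤ ρ)
    (hj : N * ρ + N * ρ ≤ j) {u : ℝ → ℝ}
    (h : ∀ x x' y : Vec N, (∀ i, i ≠ k → x i = x' i) → norm2 x y ≤ j → norm2 x' y ≤ j →
      ∀ᵐ t : ℝ, |f t x y k - f t x' y k| ≤ u t * |x k - x' k|) :
    ∀ᵐ t : ℝ, ∀ x ∈ box N ρ, ∀ x' ∈ box N ρ, ∀ y ∈ box N ρ, (∀ i, i ≠ k → x i = x' i) →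
      |f t x y k - f t x' y k| ≤ u t * |x k - x' k| := by
  let X : Vec N × Vec N × ℝ → Vec N := fun θ => clamp ρ θ.1
  let X' : Vec N × Vec N × ℝ → Vec N := fun θ => clamp ρ (updateCoord θ.1 k θ.2.2)
  let Y : Vec N × Vec N × ℝ → Vec N := fun θ => clamp ρ θ.2.1
  have hX : Continuous X := (continuous_clamp ρ).comp continuous_fst
  have hY : Continuous Y := (continuous_clamp ρ).comp (continuous_fst.comp continuous_snd)
  have hX' : Continuous X' := by
    refine (continuous_clamp ρ).comp ((PiLp.continuous_toLp 2 _).comp (continuous_pi fun i => ?_))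
    split_ifs <;> fun_prop
  have hk : Continuous fun x : Vec N => x k := (EuclideanSpace.proj k : Vec N →L[ℝ] ℝ).continuous
  have key : ∀ᵐ t : ℝ, ∀ θ, |f t (X θ) (Y θ) k - f t (X' θ) (Y θ) k| ≤
      u t * |X θ k - X' θ k| := by
    refine ae_forall_le_of_forall_ae_le
      (F := fun t θ => |f t (X θ) (Y θ) k - f t (X' θ) (Y θ) k|)
      (G := fun t θ => u t * |X θ k - X' θ k|) ?_ ?_ fun θ => ?_
    · filter_upwards [f.ae_continuous] with t ht
      exact ((hk.comp (ht.comp (hX.prodMk hY))).sub (hk.comp (ht.comp (hX'.prodMk hY)))).abs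
    · exact ae_of_all _ fun t => continuous_const.mul ((hk.comp hX).sub (hk.comp hX')).abs
    · refine h _ _ _ (fun i hi => by simp [X, X', hi]) ?_ ?_
      · exact (norm2_le_of_mem_box (clamp_mem_box hρ _) (clamp_mem_box hρ _)).trans hj
      · exact (norm2_le_of_mem_box (clamp_mem_box hρ _) (clamp_mem_box hρ _)).trans hj
  filter_upwards [key] with t ht x hx x' hx' y hy hxx'
  have := ht (x, y, x' k)
  have e : updateCoord x k (x' k) = x' := by
    ext i
    rw [updateCoord_apply]
    split_ifs with hi
    · rw [hi]
    · exact hxx' i hi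
  simpa only [X, X', Y, e, clamp_eq_self hx, clamp_eq_self hx', clamp_eq_self hy] using this

/-- Over `E`, the one-sided Lipschitz estimates hold with coefficients that are bounded in `L¹_loc`:
Kamke's conditions raise all variables but `x_k`, and `(L_x)` accounts for the change of `x_k`. -/
theorem SatisfiesLx.exists_sandwich {E : Set (LC N)} (hL : SatisfiesLx E)
    (hKx : ∀ f ∈ E, f.Kx) (hKy : ∀ f ∈ E, f.Ky) {ρ : ℝ} (hρ : 0 ≤ ρ) :
    ∃ U : LC N → ℝ → ℝ, (∀ f ∈ E, LocallyIntegrable (U f) volume ∧ (∀ t, 0 ≤ U f t) ∧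
        HasSandwichBound f ρ (U f)) ∧
      ∀ r : ℝ, 0 < r → ∃ C, ∀ f ∈ E, ∫ t in (-r)..r, U f t ≤ C := by
  obtain ⟨j, hj⟩ := exists_nat_ge (max 1 (N * ρ + N * ρ))
  choose u hui hub hu using fun k => hL j k
  have hj1 : (1 : ℝ) ≤ j := (le_max_left _ _).trans hj
  -- a Lipschitz coefficient is nonnegative because the ball contains `0` and the unit vectors
  have hu0 : ∀ k, ∀ f ∈ E, ∀ᵐ t : ℝ, 0 ≤ u k f t := by
    intro k f hf
    have h0 : norm2 (0 : Vec N) 0 ≤ j := (norm2_le_add _ _).trans (by simp)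
    have h1 : norm2 (updateCoord 0 k 1 : Vec N) 0 ≤ j := by
      refine (norm2_le_add _ _).trans ?_
      have : updateCoord 0 k 1 = EuclideanSpace.single k (1 : ℝ) := by
        ext i; simp [updateCoord_apply]
      simpa [this] using hj1
    filter_upwards [hu k f hf 0 (updateCoord 0 k 1) 0 (fun i hi => by simp [hi]) h0 h1] with t ht
    have := (abs_nonneg _).trans ht
    simpa using this
  refine ⟨fun f t => ∑ k, |u k f t|, fun f hf => ⟨?_, fun t => Finset.sum_nonneg fun k _ =>
    abs_nonneg _, ?_⟩, fun r hr => ?_⟩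
  · refine locallyIntegrable_finsetSum _ fun k _ => locallyIntegrable_abs (hui k f hf)
  · have h1 : ∀ᵐ t : ℝ, ∀ k, ∀ x ∈ box N ρ, ∀ x' ∈ box N ρ, ∀ y ∈ box N ρ,
        (∀ i, i ≠ k → x i = x' i) → |f t x y k - f t x' y k| ≤ u k f t * |x k - x' k| :=
      ae_all_iff.2 fun k => LC.ae_lipschitz_coord hρ ((le_max_right _ _).trans hj) (hu k f hf)
    filter_upwards [h1, LC.ae_kamke (hKx f hf) (hKy f hf)] with t h1 h2 a ha b hb c hc d hd hab hcd k
    -- change the `k`-th coordinate of `b` to that of `a`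
    have hb' : updateCoord b k (a k) ∈ box N ρ := by
      intro i
      rw [updateCoord_apply]
      split_ifs
      · exact ha k
      · exact hb i
    have h3 := h2 a (updateCoord b k (a k)) c d k (fun i => by
      rw [updateCoord_apply]
      split_ifs with hi
      · rw [hi]
      · exact hab i) (by simp) hcd
    have h4 := (le_abs_self _).trans (h1 k _ hb' b hb d hd fun i hi => by simp [hi])
    have h5 : |updateCoord b k (a k) k - b k| = b k - a k := by
      rw [updateCoord_apply, if_pos rfl, abs_sub_comm, abs_of_nonneg (sub_nonneg.2 (hab k))]
    rw [h5] at h4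
    have h6 : u k f t ≤ ∑ k, |u k f t| := (le_abs_self _).trans
      (Finset.single_le_sum (f := fun k => |u k f t|) (fun k _ => abs_nonneg _) (Finset.mem_univ k))
    nlinarith [sub_nonneg.2 (hab k)]
  · choose C hC using fun k => hub k r hr
    refine ⟨∑ k, C k, fun f hf => ?_⟩
    rw [intervalIntegral.integral_finsetSum fun k _ =>
      intervalIntegrable_of_locallyIntegrable (locallyIntegrable_abs (hui k f hf)) _ _]
    refine Finset.sum_le_sum fun k _ => ?_
    rw [intervalIntegral.integral_congr_ae (g := u k f)]
    · exact hC k _ (mem_image_of_mem _ hf)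
    · filter_upwards [hu0 k f hf] with t ht _ using abs_of_nonneg ht

/-! ### Convergence of integrals along equicontinuous curves -/

theorem exists_delta_integral_lt {m : ℝ → ℝ} (hm : LocallyIntegrable m volume) (r : ℝ) {ε : ℝ}
    (hε : 0 < ε) : ∃ δ : ℝ, 0 < δ ∧ ∀ s t : ℝ, -r ≤ s → s ≤ t → t ≤ r → t - s < δ →
      ∫ u in s..t, m u < ε := by
  have huc := isCompact_Icc.uniformContinuousOn_of_continuous
    (continuous_primitive_of_locallyIntegrable hm 0).continuousOn (s := Icc (-r) r)
  obtain ⟨δ, hδ, h⟩ := Metric.uniformContinuousOn_iff.1 huc ε hε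
  refine ⟨δ, hδ, fun s t hs hst ht hd => ?_⟩
  have := h t ⟨hs.trans hst, ht⟩ s ⟨hs, hst.trans ht⟩
    (by rwa [Real.dist_eq, abs_of_nonneg (sub_nonneg.2 hst)])
  have hi := intervalIntegrable_of_locallyIntegrable hm
  rw [Real.dist_eq, intervalIntegral.integral_interval_sub_left (hi _ _) (hi _ _)] at this
  exact (le_abs_self _).trans_lt this

/-- Convergence of the integrals of `f_n(·,z)` over rational intervals, for `z ∈ P`. -/
def ConvergesWeakly (P : Set (Vec N × Vec N)) (fs : ℕ → LC N) (f : LC N) : Prop :=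
  ∀ z ∈ P, ∀ q₁ q₂ : ℚ, q₁ ≤ q₂ → Tendsto
    (fun n => ∫ t in (q₁ : ℝ)..q₂, (fs n t z.1 z.2 - f t z.1 z.2)) atTop (𝓝 0)

/-- The primitives of `f_n`, for large `n`, along all curves in a given cube are uniformly
equicontinuous. -/
def HasEquicontinuousPrimitives (fs : ℕ → LC N) : Prop :=
  ∀ ρ r ε : ℝ, 0 ≤ ρ → 0 < r → 0 < ε → ∃ δ : ℝ, 0 < δ ∧ ∀ᶠ n in atTop, ∀ x y : ℝ → Vec N,
    Measurable x → Measurable y → (∀ t, x t ∈ box N ρ) → (∀ t, y t ∈ box N ρ) →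
    ∀ s t : ℝ, -r ≤ s → s ≤ t → t ≤ r → t - s < δ → ‖∫ u in s..t, fs n u (x u) (y u)‖ ≤ ε

/-- The one-sided Lipschitz estimates hold along the sequence, with coefficients that are bounded
in `L¹_loc`. -/
def HasUniformSandwichBounds (fs : ℕ → LC N) : Prop :=
  ∀ ρ : ℝ, 0 ≤ ρ → ∃ U : ℕ → ℝ → ℝ, (∀ n, LocallyIntegrable (U n) volume ∧ (∀ t, 0 ≤ U n t) ∧
    HasSandwichBound (fs n) ρ (U n)) ∧ ∀ r : ℝ, 0 < r → ∃ C, ∀ n, ∫ t in (-r)..r, U n t ≤ C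

/-- Finitely many points of a dense set approximate all points of a cube closely from above. -/
theorem exists_finite_grid {P : Set (Vec N × Vec N)} (hP : Dense P) (ρ : ℝ) {η : ℝ}
    (hη : 0 < η) : ∃ G : Finset (Vec N × Vec N), (∀ z ∈ G, z ∈ P) ∧
      ∀ x ∈ box N ρ, ∀ y ∈ box N ρ, ∃ z ∈ G, ∀ i, (x i ≤ z.1 i ∧ z.1 i ≤ x i + η) ∧
        (y i ≤ z.2 i ∧ z.2 i ≤ y i + η) := by
  have hc1 : ∀ i, Continuous fun z : Vec N × Vec N => z.1 i := fun i => by fun_prop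
  have hc2 : ∀ i, Continuous fun z : Vec N × Vec N => z.2 i := fun i => by fun_prop
  have hex : ∀ p : Vec N × Vec N, ∃ z ∈ P, ∀ i, (p.1 i + η / 3 < z.1 i ∧ z.1 i < p.1 i + 2 * η / 3) ∧
      (p.2 i + η / 3 < z.2 i ∧ z.2 i < p.2 i + 2 * η / 3) := by
    intro p
    let O : Set (Vec N × Vec N) := ⋂ i, (({z | p.1 i + η / 3 < z.1 i} ∩ {z | z.1 i < p.1 i + 2 * η / 3}) ∩
      ({z | p.2 i + η / 3 < z.2 i} ∩ {z | z.2 i < p.2 i + 2 * η / 3}))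
    have hO : IsOpen O := isOpen_iInter_of_finite fun i =>
      ((isOpen_lt continuous_const (hc1 i)).inter (isOpen_lt (hc1 i) continuous_const)).inter
        ((isOpen_lt continuous_const (hc2 i)).inter (isOpen_lt (hc2 i) continuous_const))
    obtain ⟨z, hz, hzP⟩ := hP.inter_open_nonempty O hO
      ⟨(WithLp.toLp 2 fun i => p.1 i + η / 2, WithLp.toLp 2 fun i => p.2 i + η / 2), by
        simp only [O, mem_iInter, mem_inter_iff, mem_ofPred_eq]
        intro i
        refine ⟨⟨?_, ?_⟩, ?_, ?_⟩ <;> linarith⟩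
    simp only [O, mem_iInter, mem_inter_iff, mem_ofPred_eq] at hz
    exact ⟨z, hzP, hz⟩
  choose z hzP hz using hex
  obtain ⟨t, -, ht⟩ := ((isCompact_box (N := N) ρ).prod (isCompact_box (N := N) ρ)).elim_nhds_subcover
    (fun p => Metric.ball p (η / 3)) fun p _ => Metric.ball_mem_nhds p (by positivity)
  classical
  refine ⟨t.image z, fun w hw => ?_, fun x hx y hy => ?_⟩
  · obtain ⟨p, -, rfl⟩ := Finset.mem_image.1 hw
    exact hzP p
  · obtain ⟨p, hp, hxy⟩ := mem_iUnion₂.1 (ht (mk_mem_prod hx hy))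
    rw [Metric.mem_ball, dist_eq_norm] at hxy
    refine ⟨z p, Finset.mem_image_of_mem _ hp, fun i => ?_⟩
    have h1 := abs_lt.1 ((abs_apply_le_norm _ i).trans_lt ((norm_fst_le _).trans_lt hxy))
    have h2 := abs_lt.1 ((abs_apply_le_norm _ i).trans_lt ((norm_snd_le _).trans_lt hxy))
    simp only [Prod.fst_sub, Prod.snd_sub, PiLp.sub_apply] at h1 h2
    have h3 := hz p i
    refine ⟨⟨?_, ?_⟩, ?_, ?_⟩ <;> linarith [h3.1.1, h3.1.2, h3.2.1, h3.2.2, h1.1, h1.2, h2.1, h2.2]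

theorem norm_sub_le_of_le_of_le {x z : Vec N} {c : ℝ} (h : ∀ i, |x i - z i| ≤ c) :
    ‖x - z‖ ≤ N * c := norm_le_of_abs_le fun i => by simpa using h i

/-- The integral of `g - f` along a curve over a short interval, compared with the integrals of
`g - f` at two points that bound the curve from above and from below. -/
theorem abs_integral_sub_apply_le {f g : LC N} {ρ c e : ℝ} {m l U : ℝ → ℝ}
    (hb : HasGlobalBounds (f.trunc ρ) m l) (hUi : LocallyIntegrable U volume)
    (hU0 : ∀ t, 0 ≤ U t) (hU : HasSandwichBound g ρ U) {x y : ℝ → Vec N} (hx : Measurable x)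
    (hy : Measurable y) (hxb : ∀ t, x t ∈ box N ρ) (hyb : ∀ t, y t ∈ box N ρ) {p q : ℝ}
    (hpq : p ≤ q) {z z' : Vec N × Vec N} (hz1 : z.1 ∈ box N ρ) (hz2 : z.2 ∈ box N ρ)
    (hz1' : z'.1 ∈ box N ρ) (hz2' : z'.2 ∈ box N ρ)
    (hz : ∀ u ∈ Icc p q, ∀ i, (x u i ≤ z.1 i ∧ z.1 i ≤ x u i + c) ∧
      (y u i ≤ z.2 i ∧ z.2 i ≤ y u i + c))
    (hz' : ∀ u ∈ Icc p q, ∀ i, (x u i - c ≤ z'.1 i ∧ z'.1 i ≤ x u i) ∧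
      (y u i - c ≤ z'.2 i ∧ z'.2 i ≤ y u i))
    (he : ‖∫ u in p..q, (g u z.1 z.2 - f u z.1 z.2)‖ ≤ e)
    (he' : ‖∫ u in p..q, (g u z'.1 z'.2 - f u z'.1 z'.2)‖ ≤ e) (k : Fin N) :
    |(∫ u in p..q, (g u (x u) (y u) - f u (x u) (y u))) k| ≤
      e + ∫ u in p..q, (c * U u + 2 * (N * c) * l u) := by
  have iz : IntervalIntegrable (fun u => g u z.1 z.2 - f u z.1 z.2) volume p q :=
    intervalIntegrable_of_locallyIntegrable
      ((g.locallyIntegrable_apply z.1 z.2).sub (f.locallyIntegrable_apply z.1 z.2)) p q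
  have iz' : IntervalIntegrable (fun u => g u z'.1 z'.2 - f u z'.1 z'.2) volume p q :=
    intervalIntegrable_of_locallyIntegrable
      ((g.locallyIntegrable_apply z'.1 z'.2).sub (f.locallyIntegrable_apply z'.1 z'.2)) p q
  have ix : IntervalIntegrable (fun u => g u (x u) (y u) - f u (x u) (y u)) volume p q :=
    intervalIntegrable_of_locallyIntegrable
      ((g.locallyIntegrable_comp hx hy hxb hyb).sub (f.locallyIntegrable_comp hx hy hxb hyb)) p q
  have iV : IntervalIntegrable (fun u => c * U u + 2 * (N * c) * l u) volume p q :=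
    ((intervalIntegrable_of_locallyIntegrable hUi _ _).const_mul c).add
      ((intervalIntegrable_of_locallyIntegrable hb.l_int _ _).const_mul _)
  have hlip : ∀ᵐ u : ℝ, u ∈ Ioc p q → ∀ w : Vec N × Vec N, w.1 ∈ box N ρ → w.2 ∈ box N ρ →
      (∀ i, |x u i - w.1 i| ≤ c ∧ |y u i - w.2 i| ≤ c) →
      |f u (x u) (y u) k - f u w.1 w.2 k| ≤ 2 * (N * c) * l u := by
    filter_upwards [hb.lip] with u hu _ w hw1 hw2 hw
    have h1 := hu (x u) (y u) w.1 w.2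
    rw [f.trunc_apply_of_mem u (hxb u) (hyb u), f.trunc_apply_of_mem u hw1 hw2] at h1
    have h2 := (abs_apply_le_norm _ k).trans h1
    rw [PiLp.sub_apply] at h2
    refine h2.trans ?_
    have := mul_le_mul_of_nonneg_left (add_le_add (norm_sub_le_of_le_of_le fun i => (hw i).1)
      (norm_sub_le_of_le_of_le fun i => (hw i).2)) (hb.l_nonneg u)
    linarith
  have hup : ∫ u in p..q, (g u (x u) (y u) - f u (x u) (y u)) k ≤
      ∫ u in p..q, ((g u z.1 z.2 - f u z.1 z.2) k + (c * U u + 2 * (N * c) * l u)) := by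
    refine integral_le_integral_of_ae hpq (intervalIntegrable_apply ix k)
      ((intervalIntegrable_apply iz k).add iV) ?_
    filter_upwards [hlip, hU] with u h1 h2 hu
    have hzu := hz u (Ioc_subset_Icc_self hu)
    have h3 := abs_le.1 (h1 hu z hz1 hz2 fun i => ⟨abs_le.2 ⟨by linarith [(hzu i).1.2],
      by linarith [(hzu i).1.1, (hzu i).1.2]⟩, abs_le.2 ⟨by linarith [(hzu i).2.2],
      by linarith [(hzu i).2.1, (hzu i).2.2]⟩⟩)
    have h4 := h2 _ (hxb u) _ hz1 _ (hyb u) _ hz2 (fun i => (hzu i).1.1) (fun i => (hzu i).2.1) k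
    have h5 := mul_le_mul_of_nonneg_left (show z.1 k - x u k ≤ c by linarith [(hzu k).1.2]) (hU0 u)
    simp only [PiLp.sub_apply]
    linarith [h3.1]
  have hlo : ∫ u in p..q, ((g u z'.1 z'.2 - f u z'.1 z'.2) k - (c * U u + 2 * (N * c) * l u)) ≤
      ∫ u in p..q, (g u (x u) (y u) - f u (x u) (y u)) k := by
    refine integral_le_integral_of_ae hpq ((intervalIntegrable_apply iz' k).sub iV)
      (intervalIntegrable_apply ix k) ?_
    filter_upwards [hlip, hU] with u h1 h2 hu
    have hzu := hz' u (Ioc_subset_Icc_self hu)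
    have h3 := abs_le.1 (h1 hu z' hz1' hz2' fun i => ⟨abs_le.2
      ⟨by linarith [(hzu i).1.1, (hzu i).1.2], by linarith [(hzu i).1.1]⟩, abs_le.2
      ⟨by linarith [(hzu i).2.1, (hzu i).2.2], by linarith [(hzu i).2.1]⟩⟩)
    have h4 := h2 _ hz1' _ (hxb u) _ hz2' _ (hyb u) (fun i => (hzu i).1.2) (fun i => (hzu i).2.2) k
    have h5 := mul_le_mul_of_nonneg_left (show x u k - z'.1 k ≤ c by linarith [(hzu k).1.1]) (hU0 u)
    simp only [PiLp.sub_apply]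
    linarith [h3.2]
  rw [intervalIntegral.integral_add (intervalIntegrable_apply iz k) iV, ← integral_apply iz] at hup
  rw [intervalIntegral.integral_sub (intervalIntegrable_apply iz' k) iV, ← integral_apply iz'] at hlo
  rw [integral_apply ix]
  have h1 := abs_le.1 ((abs_apply_le_norm _ k).trans he)
  have h2 := abs_le.1 ((abs_apply_le_norm _ k).trans he')
  exact abs_le.2 ⟨by linarith [h2.1], by linarith [h1.2]⟩

/-- The integrals of `f_n - f` along curves in a cube converge to zero, uniformly over curves with
a common modulus of continuity: on the pieces of a fine partition with rational endpoints, the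
curve is squeezed between points of a finite subset of `P`. -/
theorem eventually_abs_integral_sub_le {P : Set (Vec N × Vec N)} (hP : Dense P) {fs : ℕ → LC N}
    {f : LC N} (hW : ConvergesWeakly P fs f) (hS : HasUniformSandwichBounds fs)
    (hM : HasEquicontinuousPrimitives fs) {ρ : ℝ} (hρ : 0 ≤ ρ) (T : ℕ) {ε : ℝ} (hε : 0 < ε) :
    ∃ η : ℝ, 0 < η ∧ ∀ δ : ℝ, 0 < δ → ∀ᶠ n in atTop, ∀ x y : ℝ → Vec N, Measurable x →
      Measurable y → (∀ t, x t ∈ box N ρ) → (∀ t, y t ∈ box N ρ) →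
      (∀ s ∈ Icc (0 : ℝ) T, ∀ t ∈ Icc (0 : ℝ) T, |s - t| ≤ δ →
        ∀ i, |x s i - x t i| ≤ η ∧ |y s i - y t i| ≤ η) →
      ∀ t ∈ Icc (0 : ℝ) T, ∀ k,
        |(∫ u in (0 : ℝ)..t, (fs n u (x u) (y u) - f u (x u) (y u))) k| ≤ ε := by
  have hT0 : (0 : ℝ) ≤ T := Nat.cast_nonneg T
  obtain ⟨U, hU, hUb⟩ := hS (ρ + 1) (by linarith)
  obtain ⟨C, hC⟩ := hUb (T + 1) (by linarith)
  obtain ⟨m, l, hb⟩ := f.exists_hasGlobalBounds_trunc (show 0 ≤ ρ + 1 by linarith)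
  have hli := intervalIntegrable_of_locallyIntegrable hb.l_int
  set L := ∫ u in (0 : ℝ)..T, l u with hL
  have hL0 : 0 ≤ L := intervalIntegral.integral_nonneg hT0 fun u _ => hb.l_nonneg u
  have hUT : ∀ n, ∫ u in (0 : ℝ)..T, U n u ≤ max C 0 := fun n =>
    ((intervalIntegral.integral_mono_interval (by linarith) hT0 (by linarith)
      (ae_of_all _ (hU n).2.1) (intervalIntegrable_of_locallyIntegrable (hU n).1 _ _)).trans
      (hC n)).trans (le_max_left _ _)
  -- `3 * η` times `W` bounds the error of replacing the curve by grid points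
  set W := max C 0 + 2 * N * L with hWdef
  have hW0 : 0 ≤ W := by positivity
  set η := min (1 / 2) (ε / (12 * (W + 1))) with hη
  have hη0 : 0 < η := lt_min (by norm_num) (by positivity)
  have hη1 : η ≤ 1 / 2 := min_le_left _ _
  have hηW : 3 * η * W ≤ ε / 4 := by
    have h1 : η * (12 * (W + 1)) ≤ ε := by
      have := min_le_right (1 / 2) (ε / (12 * (W + 1)))
      rwa [← hη, le_div_iff₀ (by positivity)] at this
    nlinarith
  refine ⟨η, hη0, fun δ hδ => ?_⟩
  obtain ⟨G, hGP, hG⟩ := exists_finite_grid hP (ρ + 1) hη0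
  obtain ⟨δ₁, hδ₁, hM₁⟩ := hM ρ (T + 1) (ε / 4) hρ (by linarith) (by positivity)
  obtain ⟨δ₂, hδ₂, hM₂⟩ := exists_delta_integral_lt hb.m_int (T + 1) (show 0 < ε / 4 by positivity)
  obtain ⟨j, hj⟩ := exists_nat_one_div_lt (show 0 < min δ (min δ₁ δ₂) by positivity)
  have hj0 : (0 : ℝ) < (j : ℝ) + 1 := by positivity
  have hjδ := hj.trans_le (min_le_left _ _)
  have hjδ₁ := hj.trans_le ((min_le_right _ _).trans (min_le_left _ _))
  have hjδ₂ := hj.trans_le ((min_le_right _ _).trans (min_le_right _ _))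
  -- the partition points and the number of intervals
  set τ : ℕ → ℝ := fun i => i / ((j : ℝ) + 1) with hτ
  set K : ℕ := T * (j + 1) with hK
  set e := ε / (4 * ((K : ℝ) + 1)) with he
  have he0 : 0 < e := by positivity
  have hτ0 : τ 0 = 0 := by simp [hτ]
  have hτs : ∀ i, τ (i + 1) = τ i + 1 / ((j : ℝ) + 1) := by
    intro i
    simp only [hτ]; push_cast; ring
  have hτp : ∀ i, 0 ≤ τ i := fun i => by positivity
  have hτK : ∀ i ≤ K, τ i ≤ T := by
    intro i hi
    simp only [hτ]
    rw [div_le_iff₀ hj0]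
    exact_mod_cast hi
  have hgrid : ∀ᶠ n in atTop, ∀ i < K, ∀ z ∈ G,
      ‖∫ u in τ i..τ (i + 1), (fs n u z.1 z.2 - f u z.1 z.2)‖ ≤ e := by
    have h1 : ∀ i : ℕ, ∀ z ∈ G, ∀ᶠ n in atTop,
        ‖∫ u in τ i..τ (i + 1), (fs n u z.1 z.2 - f u z.1 z.2)‖ ≤ e := by
      intro i z hz
      have h := hW z (hGP z hz) ((i : ℚ) / ((j : ℚ) + 1)) (((i + 1 : ℕ) : ℚ) / ((j : ℚ) + 1))
        (by gcongr; simp)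
      have h' := h.norm.eventually_le_const (u := e) (by simpa using he0)
      simpa [hτ] using h'
    have h2 := (finite_lt_nat K).eventually_all (l := atTop)
      (p := fun i n => ∀ z ∈ G, ‖∫ u in τ i..τ (i + 1), (fs n u z.1 z.2 - f u z.1 z.2)‖ ≤ e)
    refine h2.2 fun i _ => ?_
    exact (G.eventually_all).2 (h1 i)
  filter_upwards [hgrid, hM₁] with n hgn hMn x y hx hy hxb hyb hosc t ht k
  have hbig := box_mono (N := N) (show ρ ≤ ρ + 1 by linarith)
  have hbox : ∀ v ∈ box N ρ, ∀ w : Vec N, (∀ i, |w i - v i| ≤ 1) → w ∈ box N (ρ + 1) := by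
    intro v hv w hw i
    have h1 := abs_le.1 (hv i)
    have h2 := abs_le.1 (hw i)
    exact abs_le.2 ⟨by linarith [h1.1, h2.1], by linarith [h1.2, h2.2]⟩
  have hgi := (fs n).locallyIntegrable_comp hx hy hxb hyb
  have hfi := f.locallyIntegrable_comp hx hy hxb hyb
  have hdi : ∀ a b, IntervalIntegrable (fun u => fs n u (x u) (y u) - f u (x u) (y u))
      volume a b := intervalIntegrable_of_locallyIntegrable (hgi.sub hfi)
  set V : ℝ → ℝ := fun u => (3 * η) * U n u + 2 * (N * (3 * η)) * l u with hV
  have hVi : ∀ a b, IntervalIntegrable V volume a b := fun a b =>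
    ((intervalIntegrable_of_locallyIntegrable (hU n).1 _ _).const_mul _).add
      ((hli _ _).const_mul _)
  have hV0 : ∀ u, 0 ≤ V u := fun u => by
    have := (hU n).2.1 u
    have := hb.l_nonneg u
    positivity
  have hVT : ∫ u in (0 : ℝ)..T, V u ≤ ε / 4 := by
    rw [hV, intervalIntegral.integral_add
      ((intervalIntegrable_of_locallyIntegrable (hU n).1 _ _).const_mul _) ((hli _ _).const_mul _),
      intervalIntegral.integral_const_mul, intervalIntegral.integral_const_mul]
    have := mul_le_mul_of_nonneg_left (hUT n) (show 0 ≤ 3 * η by positivity)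
    calc _ ≤ 3 * η * max C 0 + 2 * (N * (3 * η)) * L := by linarith
      _ = 3 * η * W := by rw [hWdef]; ring
      _ ≤ _ := hηW
  -- one interval of the partition
  have hstep : ∀ i < K, |(∫ u in τ i..τ (i + 1), (fs n u (x u) (y u) - f u (x u) (y u))) k| ≤
      e + ∫ u in τ i..τ (i + 1), V u := by
    intro i hi
    have hii : τ i ≤ τ (i + 1) := by rw [hτs]; linarith [one_div_pos.2 hj0]
    have hx0 := hxb (τ i)
    have hy0 := hyb (τ i)
    have hosc' : ∀ u ∈ Icc (τ i) (τ (i + 1)), ∀ i', |x u i' - x (τ i) i'| ≤ η ∧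
        |y u i' - y (τ i) i'| ≤ η := by
      intro u hu
      refine hosc u ⟨(hτp i).trans hu.1, hu.2.trans (hτK _ hi)⟩ (τ i)
        ⟨hτp i, hii.trans (hτK _ hi)⟩ ?_
      rw [abs_of_nonneg (sub_nonneg.2 hu.1)]
      have := hu.2
      rw [hτs] at this
      linarith
    obtain ⟨z, hz, hzb⟩ := hG (WithLp.toLp 2 fun i' => x (τ i) i' + η)
      (hbox _ hx0 _ fun i' => by simp [abs_of_pos hη0]; linarith)
      (WithLp.toLp 2 fun i' => y (τ i) i' + η)
      (hbox _ hy0 _ fun i' => by simp [abs_of_pos hη0]; linarith)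
    obtain ⟨z', hz', hzb'⟩ := hG (WithLp.toLp 2 fun i' => x (τ i) i' - 2 * η)
      (hbox _ hx0 _ fun i' => by
        have e : x (τ i) i' - 2 * η - x (τ i) i' = -(2 * η) := by ring
        simp only [e, abs_neg, abs_of_pos (show 0 < 2 * η by positivity)]
        linarith)
      (WithLp.toLp 2 fun i' => y (τ i) i' - 2 * η)
      (hbox _ hy0 _ fun i' => by
        have e : y (τ i) i' - 2 * η - y (τ i) i' = -(2 * η) := by ring
        simp only [e, abs_neg, abs_of_pos (show 0 < 2 * η by positivity)]
        linarith)
    simp only at hzb hzb'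
    refine abs_integral_sub_apply_le hb (hU n).1 (hU n).2.1 (hU n).2.2 hx hy
      (fun t => hbig (hxb t)) (fun t => hbig (hyb t)) hii
      (hbox _ hx0 _ fun i' => abs_le.2 ⟨by linarith [(hzb i').1.1], by linarith [(hzb i').1.2]⟩)
      (hbox _ hy0 _ fun i' => abs_le.2 ⟨by linarith [(hzb i').2.1], by linarith [(hzb i').2.2]⟩)
      (hbox _ hx0 _ fun i' => abs_le.2 ⟨by linarith [(hzb' i').1.1], by linarith [(hzb' i').1.2]⟩)
      (hbox _ hy0 _ fun i' => abs_le.2 ⟨by linarith [(hzb' i').2.1], by linarith [(hzb' i').2.2]⟩)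
      ?_ ?_ (hgn i hi z hz) (hgn i hi z' hz') k
    · intro u hu i'
      have h1 := abs_le.1 (hosc' u hu i').1
      have h2 := abs_le.1 (hosc' u hu i').2
      refine ⟨⟨?_, ?_⟩, ?_, ?_⟩ <;> linarith [(hzb i').1.1, (hzb i').1.2, (hzb i').2.1,
        (hzb i').2.2, h1.1, h1.2, h2.1, h2.2]
    · intro u hu i'
      have h1 := abs_le.1 (hosc' u hu i').1
      have h2 := abs_le.1 (hosc' u hu i').2
      refine ⟨⟨?_, ?_⟩, ?_, ?_⟩ <;> linarith [(hzb' i').1.1, (hzb' i').1.2, (hzb' i').2.1,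
        (hzb' i').2.2, h1.1, h1.2, h2.1, h2.2]
  have hsum : ∀ i ≤ K, |(∫ u in (0 : ℝ)..τ i, (fs n u (x u) (y u) - f u (x u) (y u))) k| ≤
      i * e + ∫ u in (0 : ℝ)..τ i, V u := by
    intro i
    induction i with
    | zero => intro _; simp [hτ0]
    | succ i ih =>
      intro hi
      have h1 := ih (by omega)
      have h2 := hstep i (by omega)
      rw [← intervalIntegral.integral_add_adjacent_intervals (hdi 0 (τ i)) (hdi (τ i) _),
        ← intervalIntegral.integral_add_adjacent_intervals (hVi 0 (τ i)) (hVi (τ i) _),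
        PiLp.add_apply]
      push_cast
      linarith [abs_add_le ((∫ u in (0 : ℝ)..τ i, (fs n u (x u) (y u) - f u (x u) (y u))) k)
        ((∫ u in τ i..τ (i + 1), (fs n u (x u) (y u) - f u (x u) (y u))) k)]
  -- the last, incomplete interval
  set i := ⌊t * ((j : ℝ) + 1)⌋₊ with hi
  have hi1 : τ i ≤ t := by
    simp only [hτ]
    rw [div_le_iff₀ hj0]
    exact Nat.floor_le (mul_nonneg ht.1 hj0.le)
  have hi2 : t - τ i < 1 / ((j : ℝ) + 1) := by
    have h : t < τ (i + 1) := by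
      simp only [hτ]
      rw [lt_div_iff₀ hj0]
      rw [hi]
      push_cast
      exact Nat.lt_floor_add_one (t * ((j : ℝ) + 1))
    rw [hτs] at h
    linarith
  have hiK : i ≤ K := by
    have h : t * ((j : ℝ) + 1) ≤ (K : ℝ) := by
      rw [hK]; push_cast
      exact mul_le_mul_of_nonneg_right ht.2 hj0.le
    simpa using Nat.floor_le_floor h
  have h1 := hsum i hiK
  have h2 := hMn x y hx hy hxb hyb (τ i) t (by linarith [hτp i]) hi1 (by linarith [ht.2])
    (hi2.trans hjδ₁)
  have h3 : ‖∫ u in τ i..t, f u (x u) (y u)‖ ≤ ε / 4 := by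
    refine (intervalIntegral.norm_integral_le_of_norm_le hi1 ?_
      (intervalIntegrable_of_locallyIntegrable hb.m_int _ _)).trans
      (hM₂ (τ i) t (by linarith [hτp i]) hi1 (by linarith [ht.2]) (hi2.trans hjδ₂)).le
    filter_upwards [hb.bound] with u hu _
    have := hu (x u) (y u)
    rwa [f.trunc_apply_of_mem u (hbig (hxb u)) (hbig (hyb u))] at this
  have h4 : (i : ℝ) * e ≤ ε / 4 := by
    have : (i : ℝ) ≤ (K : ℝ) + 1 := by
      have : (i : ℝ) ≤ K := by exact_mod_cast hiK
      linarith
    calc (i : ℝ) * e ≤ ((K : ℝ) + 1) * e := mul_le_mul_of_nonneg_right this he0.le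
      _ = ε / 4 := by rw [he]; field_simp
  have h5 : ∫ u in (0 : ℝ)..τ i, V u ≤ ∫ u in (0 : ℝ)..T, V u :=
    intervalIntegral.integral_mono_interval le_rfl (hτp i) (hi1.trans ht.2) (ae_of_all _ hV0)
      (hVi _ _)
  have h6 : |(∫ u in τ i..t, (fs n u (x u) (y u) - f u (x u) (y u))) k| ≤ ε / 2 := by
    rw [intervalIntegral.integral_sub (intervalIntegrable_of_locallyIntegrable hgi _ _)
      (intervalIntegrable_of_locallyIntegrable hfi _ _)]
    refine (abs_apply_le_norm _ k).trans ((norm_sub_le _ _).trans ?_)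
    linarith
  rw [← intervalIntegral.integral_add_adjacent_intervals (hdi 0 (τ i)) (hdi (τ i) _),
    PiLp.add_apply]
  have h7 := abs_add_le ((∫ u in (0 : ℝ)..τ i, (fs n u (x u) (y u) - f u (x u) (y u))) k)
    ((∫ u in τ i..t, (fs n u (x u) (y u) - f u (x u) (y u))) k)
  linarith

/-! ### Convergence of solutions -/

/-- Solutions of the truncated equations are uniformly equicontinuous, for large `n`. -/
theorem HasEquicontinuousPrimitives.equicontinuous_solutions {fs : ℕ → LC N}
    (hM : HasEquicontinuousPrimitives fs) {φs : ℕ → Hist N} {φ : Hist N}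
    (hφ : Tendsto φs atTop (𝓝 φ)) {ρ T : ℝ} (hρ : 0 ≤ ρ) (hT : 0 ≤ T) {X : ℕ → ℝ → Vec N}
    (hXc : ∀ n, Continuous (X n)) (hX : ∀ n, IsSolutionOn ((fs n).trunc ρ) (φs n) T (X n))
    {η : ℝ} (hη : 0 < η) : ∃ δ : ℝ, 0 < δ ∧ ∀ᶠ n in atTop, ∀ s ∈ Icc (-1) T, ∀ t ∈ Icc (-1) T,
      |s - t| ≤ δ → ‖X n s - X n t‖ ≤ η := by
  obtain ⟨δ₁, hδ₁, h1⟩ := hM ρ (T + 1) (η / 2) hρ (by linarith) (by positivity)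
  obtain ⟨δ₂, hδ₂, h2⟩ := Metric.uniformContinuous_iff.1
    (CompactSpace.uniformContinuous_of_continuous φ.continuous) (η / 6) (by positivity)
  refine ⟨min δ₁ δ₂ / 2, by positivity, ?_⟩
  have h3 : ∀ᶠ n in atTop, dist (φs n) φ < η / 6 :=
    (tendsto_iff_dist_tendsto_zero.1 hφ).eventually_lt_const
    (by positivity)
  filter_upwards [h1, h3] with n h1 h3
  have hneg : ∀ s ∈ Icc (-1 : ℝ) 0, ∀ t ∈ Icc (-1 : ℝ) 0, |s - t| < δ₂ →
      ‖X n s - X n t‖ ≤ η / 2 := by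
    intro s hs t ht hst
    have e1 := (hX n).initial ⟨s, hs⟩
    have e2 := (hX n).initial ⟨t, ht⟩
    simp only at e1 e2
    rw [e1, e2, ← dist_eq_norm]
    have d1 := (ContinuousMap.dist_apply_le_dist (f := φs n) (g := φ) ⟨s, hs⟩).trans h3.le
    have d2 := (ContinuousMap.dist_apply_le_dist (f := φs n) (g := φ) ⟨t, ht⟩).trans h3.le
    have d3 := h2 (a := ⟨s, hs⟩) (b := ⟨t, ht⟩) (by rwa [Subtype.dist_eq, Real.dist_eq])
    have d4 := dist_triangle4 (φs n ⟨s, hs⟩) (φ ⟨s, hs⟩) (φ ⟨t, ht⟩) (φs n ⟨t, ht⟩)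
    rw [dist_comm (φ ⟨t, ht⟩)] at d4
    linarith
  have hpos : ∀ s t, 0 ≤ s → s ≤ t → t ≤ T → t - s < δ₁ → ‖X n s - X n t‖ ≤ η / 2 := by
    intro s t hs hst ht hd
    rw [norm_sub_rev, (hX n).sub_eq ⟨hs, hst.trans ht⟩ ⟨hs.trans hst, ht⟩]
    exact h1 (fun u => clamp ρ (X n u)) (fun u => clamp ρ (X n (u - 1)))
      ((continuous_clamp ρ).comp (hXc n)).measurable
      ((continuous_clamp ρ).comp ((hXc n).comp (continuous_id.sub continuous_const))).measurable
      (fun _ => clamp_mem_box hρ _) (fun _ => clamp_mem_box hρ _) s t (by linarith) hst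
      (by linarith) hd
  have hord : ∀ s ∈ Icc (-1) T, ∀ t ∈ Icc (-1) T, s ≤ t → t - s ≤ min δ₁ δ₂ / 2 →
      ‖X n s - X n t‖ ≤ η := by
    intro s hs t ht hst hd
    have hm : 0 < min δ₁ δ₂ := lt_min hδ₁ hδ₂
    have hd1 : t - s < δ₁ := by linarith [min_le_left δ₁ δ₂]
    have hd2 : t - s < δ₂ := by linarith [min_le_right δ₁ δ₂]
    rcases le_total t 0 with ht0 | ht0
    · have := hneg s ⟨hs.1, hst.trans ht0⟩ t ⟨ht.1, ht0⟩
        (by rw [abs_sub_comm, abs_of_nonneg (by linarith)]; exact hd2)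
      linarith
    rcases le_total 0 s with hs0 | hs0
    · linarith [hpos s t hs0 hst ht.2 hd1]
    · have e1 := hneg s ⟨hs.1, hs0⟩ 0 (by norm_num)
        (by rw [sub_zero, abs_of_nonpos hs0]; linarith)
      have e2 := hpos 0 t le_rfl ht0 ht.2 (by linarith)
      have := norm_sub_le_norm_sub_add_norm_sub (X n s) (X n 0) (X n t)
      linarith
  intro s hs t ht hd
  rcases le_total s t with h | h
  · exact hord s hs t ht h (by rwa [abs_sub_comm, abs_of_nonneg (by linarith)] at hd)
  · rw [norm_sub_rev]
    exact hord t ht s hs h (by rwa [abs_of_nonneg (by linarith)] at hd)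

/-- Convergence of the solutions of the truncated equations: the difference of the solutions
satisfies Gronwall's inequality for the Lipschitz bound of the limit, with a perturbation that is
small by the convergence of integrals along equicontinuous curves. -/
theorem eventually_norm_solution_sub_lt {P : Set (Vec N × Vec N)} (hP : Dense P) {fs : ℕ → LC N}
    {f : LC N} (hW : ConvergesWeakly P fs f) (hS : HasUniformSandwichBounds fs)
    (hM : HasEquicontinuousPrimitives fs) {φs : ℕ → Hist N} {φ : Hist N}
    (hφ : Tendsto φs atTop (𝓝 φ)) {ρ : ℝ} (hρ : 0 ≤ ρ) (T : ℕ) {X : ℕ → ℝ → Vec N}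
    {x : ℝ → Vec N} (hXc : ∀ n, Continuous (X n)) (hxc : Continuous x)
    (hX : ∀ n, IsSolutionOn ((fs n).trunc ρ) (φs n) T (X n))
    (hx : IsSolutionOn (f.trunc ρ) φ T x) {ε : ℝ} (hε : 0 < ε) :
    ∀ᶠ n in atTop, ∀ t ∈ Icc (-1 : ℝ) T, ‖X n t - x t‖ < ε := by
  have hT0 : (0 : ℝ) ≤ T := Nat.cast_nonneg T
  obtain ⟨m, l, hb⟩ := f.exists_hasGlobalBounds_trunc hρ
  obtain ⟨K, hK0, hK⟩ := exists_gronwall_const hb.l_int hb.l_nonneg T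
  set A := ε / (2 * (K + 1)) with hA
  have hA0 : 0 < A := by positivity
  have hKA : K * A < ε := by
    rw [hA, ← mul_div_assoc, div_lt_iff₀ (by positivity)]
    nlinarith
  obtain ⟨η, hη, h1⟩ := eventually_abs_integral_sub_le hP hW hS hM hρ T
    (ε := A / (2 * (N + 1))) (by positivity)
  obtain ⟨δ, hδ, h2⟩ := hM.equicontinuous_solutions hφ hρ hT0 hXc hX hη
  have h3 : ∀ᶠ n in atTop, dist (φs n) φ < A / 2 :=
    (tendsto_iff_dist_tendsto_zero.1 hφ).eventually_lt_const (by positivity)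
  filter_upwards [h1 δ hδ, h2, h3] with n h1 h2 h3 t ht
  refine (hK A (fun t => ‖X n t - x t‖) hA0.le ((hXc n).sub hxc).norm.continuousOn
    (fun _ _ => norm_nonneg _) ?_ ?_ t ht).trans_lt hKA
  · intro s hs
    have e1 := (hX n).initial ⟨s, hs⟩
    have e2 := hx.initial ⟨s, hs⟩
    simp only at e1 e2
    rw [e1, e2, ← dist_eq_norm]
    linarith [ContinuousMap.dist_apply_le_dist (f := φs n) (g := φ) ⟨s, hs⟩]
  · intro s hs
    set p : ℝ → Vec N := fun u => clamp ρ (X n u) with hp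
    set q : ℝ → Vec N := fun u => clamp ρ (X n (u - 1)) with hq
    have hpm : Measurable p := ((continuous_clamp ρ).comp (hXc n)).measurable
    have hqm : Measurable q := ((continuous_clamp ρ).comp
      ((hXc n).comp (continuous_id.sub continuous_const))).measurable
    have hpb : ∀ u, p u ∈ box N ρ := fun _ => clamp_mem_box hρ _
    have hqb : ∀ u, q u ∈ box N ρ := fun _ => clamp_mem_box hρ _
    have hosc : ∀ s ∈ Icc (0 : ℝ) T, ∀ t ∈ Icc (0 : ℝ) T, |s - t| ≤ δ →
        ∀ i, |p s i - p t i| ≤ η ∧ |q s i - q t i| ≤ η := by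
      intro s hs t ht hst i
      have g1 := h2 s ⟨by linarith [hs.1], hs.2⟩ t ⟨by linarith [ht.1], ht.2⟩ hst
      have g2 := h2 (s - 1) ⟨by linarith [hs.1], by linarith [hs.2]⟩ (t - 1)
        ⟨by linarith [ht.1], by linarith [ht.2]⟩ (by rwa [sub_sub_sub_cancel_right])
      exact ⟨(abs_apply_le_norm (p s - p t) i).trans ((norm_clamp_sub_le ρ _ _).trans g1),
        (abs_apply_le_norm (q s - q t) i).trans ((norm_clamp_sub_le ρ _ _).trans g2)⟩
    have g1 : ‖∫ u in (0 : ℝ)..s, (fs n u (p u) (q u) - f u (p u) (q u))‖ ≤ A / 2 := by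
      refine (norm_le_of_abs_le (h1 p q hpm hqm hpb hqb hosc s hs)).trans ?_
      rw [← mul_div_assoc, div_le_div_iff₀ (by positivity) (by positivity)]
      nlinarith
    have ipf := intervalIntegrable_of_locallyIntegrable
      (f.locallyIntegrable_comp hpm hqm hpb hqb) 0 s
    have g2 : ‖∫ u in (0 : ℝ)..s, (f u (p u) (q u) - f.trunc ρ u (x u) (x (u - 1)))‖ ≤
        ∫ u in (0 : ℝ)..s, l u * (‖X n u - x u‖ + ‖X n (u - 1) - x (u - 1)‖) := by
      refine intervalIntegral.norm_integral_le_of_norm_le hs.1 ?_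
        (intervalIntegrable_mul_delay (w := fun u => ‖X n u - x u‖) hb.l_int
          ((hXc n).sub hxc).norm.continuousOn hs)
      filter_upwards [hb.lip] with u hu _ using hu (X n u) (X n (u - 1)) (x u) (x (u - 1))
    have g3 : ‖φs n ⟨0, by norm_num⟩ - φ ⟨0, by norm_num⟩‖ ≤ A / 2 := by
      rw [← dist_eq_norm]
      exact (ContinuousMap.dist_apply_le_dist _).trans h3.le
    have e : X n s - x s = (φs n ⟨0, by norm_num⟩ - φ ⟨0, by norm_num⟩) +
        (∫ u in (0 : ℝ)..s, (fs n u (p u) (q u) - f u (p u) (q u))) +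
        ∫ u in (0 : ℝ)..s, (f u (p u) (q u) - f.trunc ρ u (x u) (x (u - 1))) := by
      have ipX : IntervalIntegrable (fun u => fs n u (p u) (q u)) volume 0 s :=
        (hX n).integrable s hs
      rw [intervalIntegral.integral_sub ipX ipf,
        intervalIntegral.integral_sub ipf (hx.integrable s hs), (hX n).integral_eq s hs,
        hx.integral_eq s hs, (hX n).apply_zero, hx.apply_zero]
      simp only [hp, hq, LC.trunc_apply]
      abel
    rw [e]
    refine (norm_add₃_le ..).trans ?_
    linarith

/-- Convergence of the solutions on every compact interval on which the limit exists. -/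
theorem tendstoUniformlyOn_sol {P : Set (Vec N × Vec N)} (hP : Dense P) {fs : ℕ → LC N}
    {f : LC N} (hW : ConvergesWeakly P fs f) (hS : HasUniformSandwichBounds fs)
    (hM : HasEquicontinuousPrimitives fs) {φs : ℕ → Hist N} {φ : Hist N}
    (hφ : Tendsto φs atTop (𝓝 φ)) {T : ℝ} (hT : 0 ≤ T) (hTI : T ∈ existenceInterval f φ) :
    (∀ᶠ n in atTop, T ∈ existenceInterval (fs n) (φs n)) ∧
      TendstoUniformlyOn (fun n => sol (fs n) (φs n)) (sol f φ) atTop (Icc (-1) T) := by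
  have hs := isSolutionOn_sol hT hTI
  obtain ⟨M, hM0, hMb⟩ := hs.exists_bound
  have hρ : 0 ≤ M + 1 := by linarith
  obtain ⟨T', hT'⟩ := exists_nat_ge T
  obtain ⟨m, l, hb⟩ := f.exists_hasGlobalBounds_trunc hρ
  obtain ⟨x, hxc, hx⟩ := hb.exists_solution φ (Nat.cast_nonneg T')
  have hex : ∀ n, ∃ X, Continuous X ∧ IsSolutionOn ((fs n).trunc (M + 1)) (φs n) T' X := by
    intro n
    obtain ⟨m, l, hb⟩ := (fs n).exists_hasGlobalBounds_trunc hρ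
    exact hb.exists_solution (φs n) (Nat.cast_nonneg T')
  choose X hXc hX using hex
  have hxs : EqOn x (sol f φ) (Icc (-1) T) := (hx.mono hT').eqOn_of_hasGlobalBounds hb
    (hs.trunc fun t ht => (hMb t ht).trans (by linarith))
  have hconv : ∀ ε : ℝ, 0 < ε → ∀ᶠ n in atTop, ∀ t ∈ Icc (-1) T, ‖X n t - sol f φ t‖ < ε := by
    intro ε hε
    filter_upwards [eventually_norm_solution_sub_lt hP hW hS hM hφ hρ T' hXc hxc hX hx hε]
      with n hn t ht
    rw [← hxs ht]
    exact hn t ⟨ht.1, ht.2.trans hT'⟩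
  -- eventually the truncation is not active on `[-1,T]`
  have hsol : ∀ᶠ n in atTop, IsSolutionOn (fs n) (φs n) T (X n) := by
    filter_upwards [hconv 1 one_pos] with n hn
    refine ((hX n).mono hT').of_trunc fun t ht => ?_
    have h1 := norm_le_norm_add_norm_sub (sol f φ t) (X n t)
    rw [norm_sub_rev] at h1
    linarith [hn t ht, hMb t ht]
  refine ⟨hsol.mono fun n hn => hn.mem_existenceInterval hT ⟨by linarith, le_rfl⟩, ?_⟩
  rw [Metric.tendstoUniformlyOn_iff]
  intro ε hε
  filter_upwards [hsol, hconv ε hε] with n h1 h2 t ht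
  rw [h1.sol_eqOn hT ht, dist_comm, dist_eq_norm]
  exact h2 t ht

/-! ### The topologies `T_P` and `σ_P` -/

/-- The neighbourhoods in a topology generated by the balls of a family of pseudometrics. -/
theorem nhds_generateFrom_balls {X ι : Type*} (d : ι → X → X → ℝ) (h0 : ∀ i f, d i f f = 0)
    (hn : ∀ i f g, 0 ≤ d i f g) (tri : ∀ i f g h, d i f h ≤ d i f g + d i g h) (f : X) :
    @nhds X (TopologicalSpace.generateFrom
      {B | ∃ i, ∃ c, ∃ r : ℝ, 0 < r ∧ B = {g | d i g c < r}}) f =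
    ⨅ i, comap (fun g => d i g f) (𝓝 0) := by
  rw [TopologicalSpace.nhds_generateFrom]
  refine le_antisymm (le_iInf fun i => ?_) (le_iInf₂ ?_)
  · rw [← tendsto_iff_comap, Metric.tendsto_nhds]
    intro ε hε
    have : {g | d i g f < ε} ∈ ⨅ s ∈ {s | f ∈ s ∧ s ∈
        {B | ∃ i, ∃ c, ∃ r : ℝ, 0 < r ∧ B = {g | d i g c < r}}}, 𝓟 s :=
      mem_iInf_of_mem _ (mem_iInf_of_mem ⟨by simpa [h0] using hε, i, f, ε, hε, rfl⟩
        (mem_principal_self _))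
    filter_upwards [this] with g hg
    rw [Real.dist_eq, sub_zero, abs_of_nonneg (hn i g f)]
    exact hg
  · rintro s ⟨hf, i, c, r, hr, rfl⟩
    have hf' : d i f c < r := hf
    refine (iInf_le _ i).trans (le_principal_iff.2 ?_)
    refine mem_comap.2 ⟨Iio (r - d i f c), Iio_mem_nhds (by linarith), fun g hg => ?_⟩
    have hg' : d i g f < r - d i f c := hg
    have := tri i g f c
    change d i g c < r
    linarith

theorem LC.integrableOn_sub (f g : LC N) (z : Vec N × Vec N) (a b : ℝ) :
    IntegrableOn (fun t => f t z.1 z.2 - g t z.1 z.2) (Icc a b) volume :=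
  ((f.locallyIntegrable_apply z.1 z.2).sub (g.locallyIntegrable_apply z.1 z.2)).integrableOn_isCompact
    isCompact_Icc

theorem nhds_strongTopology (P : Set (Vec N × Vec N)) (f : LC N) :
    @nhds (LC N) (strongTopology P) f =
      ⨅ i : P × ℚ × ℚ, comap (fun g => strongDist i.2.1 i.2.2 i.1 g f) (𝓝 0) := by
  have hτ : strongTopology P = TopologicalSpace.generateFrom {B | ∃ i : P × ℚ × ℚ, ∃ c, ∃ r : ℝ,
      0 < r ∧ B = {g | strongDist i.2.1 i.2.2 i.1 g c < r}} := by
    refine congrArg TopologicalSpace.generateFrom (Set.ext fun B => ⟨?_, ?_⟩)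
    · rintro ⟨z, hz, q₁, q₂, c, r, hr, rfl⟩
      exact ⟨⟨⟨z, hz⟩, q₁, q₂⟩, c, r, hr, rfl⟩
    · rintro ⟨⟨⟨z, hz⟩, q₁, q₂⟩, c, r, hr, rfl⟩
      exact ⟨z, hz, q₁, q₂, c, r, hr, rfl⟩
  rw [hτ, nhds_generateFrom_balls (fun (i : P × ℚ × ℚ) => strongDist i.2.1 i.2.2 (i.1 : Vec N × Vec N))
    (fun i f => by simp [strongDist]) (fun i f g => by unfold strongDist; positivity)]
  · intro i f g h
    unfold strongDist
    rw [← integral_add (f.integrableOn_sub g _ _ _).norm (g.integrableOn_sub h _ _ _).norm]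
    refine integral_mono (f.integrableOn_sub h _ _ _).norm
      ((f.integrableOn_sub g _ _ _).norm.add (g.integrableOn_sub h _ _ _).norm) fun t => ?_
    exact norm_sub_le_norm_sub_add_norm_sub _ _ _

theorem nhds_weakTopology (P : Set (Vec N × Vec N)) (f : LC N) :
    @nhds (LC N) (weakTopology P) f =
      ⨅ i : P × ℚ × ℚ, comap (fun g => weakDist i.2.1 i.2.2 i.1 g f) (𝓝 0) := by
  have hτ : weakTopology P = TopologicalSpace.generateFrom {B | ∃ i : P × ℚ × ℚ, ∃ c, ∃ r : ℝ,
      0 < r ∧ B = {g | weakDist i.2.1 i.2.2 i.1 g c < r}} := by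
    refine congrArg TopologicalSpace.generateFrom (Set.ext fun B => ⟨?_, ?_⟩)
    · rintro ⟨z, hz, q₁, q₂, c, r, hr, rfl⟩
      exact ⟨⟨⟨z, hz⟩, q₁, q₂⟩, c, r, hr, rfl⟩
    · rintro ⟨⟨⟨z, hz⟩, q₁, q₂⟩, c, r, hr, rfl⟩
      exact ⟨z, hz, q₁, q₂, c, r, hr, rfl⟩
  rw [hτ, nhds_generateFrom_balls (fun (i : P × ℚ × ℚ) => weakDist i.2.1 i.2.2 (i.1 : Vec N × Vec N))
    (fun i f => by simp [weakDist]) (fun i f g => by unfold weakDist; positivity)]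
  · intro i f g h
    unfold weakDist
    refine le_trans (le_of_eq ?_) (norm_add_le _ _)
    rw [← integral_add (f.integrableOn_sub g _ _ _) (g.integrableOn_sub h _ _ _)]
    simp

theorem firstCountable_strongTopology {P : Set (Vec N × Vec N)} (hP : P.Countable) :
    @FirstCountableTopology (LC N) (strongTopology P) := by
  have := hP.to_subtype
  refine @FirstCountableTopology.mk _ (strongTopology P) fun f => ?_
  rw [nhds_strongTopology]
  infer_instance

theorem firstCountable_weakTopology {P : Set (Vec N × Vec N)} (hP : P.Countable) :
    @FirstCountableTopology (LC N) (weakTopology P) := by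
  have := hP.to_subtype
  refine @FirstCountableTopology.mk _ (weakTopology P) fun f => ?_
  rw [nhds_weakTopology]
  infer_instance

theorem tendsto_strongTopology_iff {α : Type*} {P : Set (Vec N × Vec N)} {F : Filter α}
    {fs : α → LC N} {f : LC N} : Tendsto fs F (@nhds (LC N) (strongTopology P) f) ↔
      ∀ z ∈ P, ∀ q₁ q₂ : ℚ, Tendsto (fun n => strongDist q₁ q₂ z (fs n) f) F (𝓝 0) := by
  rw [nhds_strongTopology, tendsto_iInf]
  simp only [tendsto_comap_iff, Function.comp_def, Prod.forall, Subtype.forall]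

theorem tendsto_weakTopology_iff {α : Type*} {P : Set (Vec N × Vec N)} {F : Filter α}
    {fs : α → LC N} {f : LC N} : Tendsto fs F (@nhds (LC N) (weakTopology P) f) ↔
      ∀ z ∈ P, ∀ q₁ q₂ : ℚ, Tendsto (fun n => weakDist q₁ q₂ z (fs n) f) F (𝓝 0) := by
  rw [nhds_weakTopology, tendsto_iInf]
  simp only [tendsto_comap_iff, Function.comp_def, Prod.forall, Subtype.forall]

theorem strongDist_eq {q₁ q₂ : ℚ} (h : q₁ ≤ q₂) (z : Vec N × Vec N) (f g : LC N) :
    strongDist q₁ q₂ z f g = ∫ t in (q₁ : ℝ)..q₂, ‖f t z.1 z.2 - g t z.1 z.2‖ := by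
  rw [strongDist, integral_Icc_eq_integral_Ioc, intervalIntegral.integral_of_le (by exact_mod_cast h)]

theorem weakDist_eq {q₁ q₂ : ℚ} (h : q₁ ≤ q₂) (z : Vec N × Vec N) (f g : LC N) :
    weakDist q₁ q₂ z f g = ‖∫ t in (q₁ : ℝ)..q₂, (f t z.1 z.2 - g t z.1 z.2)‖ := by
  rw [weakDist, integral_Icc_eq_integral_Ioc, intervalIntegral.integral_of_le (by exact_mod_cast h)]

theorem convergesWeakly_of_tendsto_weakTopology {P : Set (Vec N × Vec N)} {fs : ℕ → LC N}
    {f : LC N} (h : Tendsto fs atTop (@nhds (LC N) (weakTopology P) f)) :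
    ConvergesWeakly P fs f := by
  intro z hz q₁ q₂ hq
  have := tendsto_weakTopology_iff.1 h z hz q₁ q₂
  simp only [weakDist_eq hq] at this
  exact tendsto_zero_iff_norm_tendsto_zero.2 this

theorem tendsto_weakTopology_of_strongTopology {P : Set (Vec N × Vec N)} {α : Type*}
    {F : Filter α} {fs : α → LC N} {f : LC N} (h : Tendsto fs F (@nhds (LC N) (strongTopology P) f)) :
    Tendsto fs F (@nhds (LC N) (weakTopology P) f) :=
  tendsto_weakTopology_iff.2 fun z hz q₁ q₂ =>
    squeeze_zero (fun _ => norm_nonneg _) (fun _ => norm_integral_le_integral_norm _)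
      (tendsto_strongTopology_iff.1 h z hz q₁ q₂)

/-! ### Continuous dependence -/

theorem hasUniformSandwichBounds_of_mem {E : Set (LC N)} (hL : SatisfiesLx E)
    (hKx : ∀ f ∈ E, f.Kx) (hKy : ∀ f ∈ E, f.Ky) {fs : ℕ → LC N} (hfs : ∀ n, fs n ∈ E) :
    HasUniformSandwichBounds fs := by
  intro ρ hρ
  obtain ⟨U, hU, hC⟩ := hL.exists_sandwich hKx hKy hρ
  refine ⟨fun n => U (fs n), fun n => hU _ (hfs n), fun r hr => ?_⟩
  obtain ⟨C, hC⟩ := hC r hr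
  exact ⟨C, fun n => hC _ (hfs n)⟩

theorem HasEquicontinuousMBounds.hasEquicontinuousPrimitives {E : Set (LC N)}
    (hE : HasEquicontinuousMBounds E) {fs : ℕ → LC N} (hfs : ∀ n, fs n ∈ E) :
    HasEquicontinuousPrimitives fs := by
  intro ρ r ε hρ hr hε
  obtain ⟨j, hj⟩ := exists_nat_ge (N * ρ + N * ρ)
  obtain ⟨m, hm, heq⟩ := hE j
  obtain ⟨δ, hδ, h⟩ := heq r hr ε hε
  refine ⟨δ, hδ, Eventually.of_forall fun n x y hx hy hxb hyb s t hs hst ht hd => ?_⟩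
  refine (intervalIntegral.norm_integral_le_of_norm_le hst ?_
    (intervalIntegrable_of_locallyIntegrable (hm _ (hfs n)).1 _ _)).trans
    (h s t hs hst ht hd _ (mem_image_of_mem _ (hfs n))).le
  filter_upwards [(hm _ (hfs n)).2] with u hu _
  exact hu (x u, y u) ((norm2_le_of_mem_box (hxb u) (hyb u)).trans hj)

/-- At every point of a cube, a vector field with a one-sided Lipschitz estimate is controlled by its
values on a finite grid. -/
theorem HasSandwichBound.ae_abs_apply_le {g : LC N} {ρ η : ℝ} {U : ℝ → ℝ}
    (hU : HasSandwichBound g (ρ + 1) U) (hU0 : ∀ t, 0 ≤ U t) (hη0 : 0 < η) (hη1 : η ≤ 1)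
    {G : Finset (Vec N × Vec N)}
    (hG : ∀ x ∈ box N (ρ + 1), ∀ y ∈ box N (ρ + 1), ∃ z ∈ G, ∀ i,
      (x i ≤ z.1 i ∧ z.1 i ≤ x i + η) ∧ (y i ≤ z.2 i ∧ z.2 i ≤ y i + η)) :
    ∀ᵐ u : ℝ, ∀ x ∈ box N ρ, ∀ y ∈ box N ρ, ∀ k,
      |g u x y k| ≤ ∑ z ∈ G, ‖g u z.1 z.2‖ + η * U u := by
  have hbig := box_mono (N := N) (show ρ ≤ ρ + 1 by linarith)
  have hbox : ∀ v ∈ box N ρ, ∀ w : Vec N, (∀ i, |w i - v i| ≤ 1) → w ∈ box N (ρ + 1) := by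
    intro v hv w hw i
    have h1 := abs_le.1 (hv i)
    have h2 := abs_le.1 (hw i)
    exact abs_le.2 ⟨by linarith [h1.1, h2.1], by linarith [h1.2, h2.2]⟩
  filter_upwards [hU] with u hu x hxb y hyb k
  have hsum : ∀ z ∈ G, |g u z.1 z.2 k| ≤ ∑ z ∈ G, ‖g u z.1 z.2‖ := by
    intro z hz
    have h1 : ‖g u z.1 z.2‖ ≤ ∑ w ∈ G, ‖g u w.1 w.2‖ :=
      Finset.single_le_sum (f := fun w : Vec N × Vec N => ‖g u w.1 w.2‖)
        (fun w _ => norm_nonneg _) hz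
    exact (abs_apply_le_norm (g u z.1 z.2) k).trans h1
  obtain ⟨z, hz, hzb⟩ := hG x (hbig hxb) y (hbig hyb)
  obtain ⟨w, hw, hwb⟩ := hG (WithLp.toLp 2 fun i => x i - η)
    (hbox _ hxb _ fun i => by simp [abs_of_pos hη0, hη1])
    (WithLp.toLp 2 fun i => y i - η) (hbox _ hyb _ fun i => by simp [abs_of_pos hη0, hη1])
  simp only at hwb
  have h1 := hu x (hbig hxb) z.1
    (hbox _ hxb _ fun i => abs_le.2 ⟨by linarith [(hzb i).1.1], by linarith [(hzb i).1.2]⟩)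
    y (hbig hyb) z.2
    (hbox _ hyb _ fun i => abs_le.2 ⟨by linarith [(hzb i).2.1], by linarith [(hzb i).2.2]⟩)
    (fun i => (hzb i).1.1) (fun i => (hzb i).2.1) k
  have h2 := hu w.1
    (hbox _ hxb _ fun i => abs_le.2 ⟨by linarith [(hwb i).1.1], by linarith [(hwb i).1.2]⟩)
    x (hbig hxb) w.2
    (hbox _ hyb _ fun i => abs_le.2 ⟨by linarith [(hwb i).2.1], by linarith [(hwb i).2.2]⟩)
    y (hbig hyb) (fun i => by linarith [(hwb i).1.2]) (fun i => by linarith [(hwb i).2.2]) k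
  have h3 := mul_le_mul_of_nonneg_left (show z.1 k - x k ≤ η by linarith [(hzb k).1.2]) (hU0 u)
  have h4 := mul_le_mul_of_nonneg_left (show x k - w.1 k ≤ η by linarith [(hwb k).1.1]) (hU0 u)
  have h5 := abs_le.1 (hsum z hz)
  have h6 := abs_le.1 (hsum w hw)
  exact abs_le.2 ⟨by linarith [h6.1], by linarith [h5.2]⟩

/-- Strong convergence and the one-sided Lipschitz estimates yield the equicontinuity of
primitives: at any point of a cube the vector field is bounded by its values at finitely many
points, up to a small multiple of the Lipschitz coefficients. -/
theorem hasEquicontinuousPrimitives_of_tendsto {P : Set (Vec N × Vec N)} (hP : Dense P)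
    {fs : ℕ → LC N} {f : LC N} (h : Tendsto fs atTop (@nhds (LC N) (strongTopology P) f))
    (hS : HasUniformSandwichBounds fs) : HasEquicontinuousPrimitives fs := by
  intro ρ r ε hρ hr hε
  obtain ⟨U, hU, hUb⟩ := hS (ρ + 1) (by linarith)
  obtain ⟨C, hC⟩ := hUb r hr
  set η := min 1 (ε / (3 * (N + 1) * (max C 0 + 1))) with hη
  have hη0 : 0 < η := lt_min one_pos (by positivity)
  have hη1 : η ≤ 1 := min_le_left _ _
  have hηC : N * (η * max C 0) ≤ ε / 3 := by
    have h1 : η * (3 * (N + 1) * (max C 0 + 1)) ≤ ε := by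
      have := min_le_right 1 (ε / (3 * (N + 1) * (max C 0 + 1)))
      rwa [← hη, le_div_iff₀ (by positivity)] at this
    have h2 : 0 ≤ η * (max C 0 + 1) := by positivity
    have h3 : (0 : ℝ) ≤ N * η := by positivity
    nlinarith [le_max_right C 0]
  obtain ⟨G, hGP, hG⟩ := exists_finite_grid hP (ρ + 1) hη0
  have hfG : LocallyIntegrable (fun u => ∑ z ∈ G, ‖f u z.1 z.2‖) volume :=
    locallyIntegrable_finsetSum _ fun z _ =>
      (f.locallyIntegrable_apply z.1 z.2).mono
        (f.locallyIntegrable_apply z.1 z.2).aestronglyMeasurable.norm (ae_of_all _ fun u => by simp)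
  obtain ⟨δ, hδ, hfδ⟩ := exists_delta_integral_lt hfG r (show 0 < ε / (3 * (N + 1)) by positivity)
  obtain ⟨R, hR⟩ := exists_nat_ge r
  have hdist : ∀ᶠ n in atTop, ∑ z ∈ G, strongDist (-(R : ℚ)) R z (fs n) f < ε / (3 * (N + 1)) := by
    have : Tendsto (fun n => ∑ z ∈ G, strongDist (-(R : ℚ)) R z (fs n) f) atTop
        (𝓝 (∑ z ∈ G, (0 : ℝ))) :=
      tendsto_finsetSum _ fun z hz => tendsto_strongTopology_iff.1 h z (hGP z hz) _ _
    rw [Finset.sum_const_zero] at this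
    exact this.eventually_lt_const (by positivity)
  refine ⟨δ, hδ, hdist.mono fun n hn x y hx hy hxb hyb s t hs hst ht hd => ?_⟩
  have hpt : ∀ᵐ u : ℝ, ∀ k, |fs n u (x u) (y u) k| ≤
      ∑ z ∈ G, ‖fs n u z.1 z.2‖ + η * U n u := by
    filter_upwards [(hU n).2.2.ae_abs_apply_le (hU n).2.1 hη0 hη1 hG] with u hu k
    exact hu _ (hxb u) _ (hyb u) k
  have inorm : ∀ z : Vec N × Vec N, ∀ a b, IntervalIntegrable (fun u => ‖fs n u z.1 z.2‖)
      volume a b := fun z a b => (intervalIntegrable_of_locallyIntegrable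
        ((fs n).locallyIntegrable_apply z.1 z.2) a b).norm
  have iU := intervalIntegrable_of_locallyIntegrable (hU n).1
  have isum : ∀ a b, IntervalIntegrable (fun u => ∑ z ∈ G, ‖fs n u z.1 z.2‖) volume a b :=
    fun a b => by
      have := IntervalIntegrable.sum G (f := fun z u => ‖fs n u z.1 z.2‖) (μ := volume) (a := a)
        (b := b) fun z _ => inorm z a b
      simpa [Finset.sum_fn] using this
  have h1 : ∀ k, |(∫ u in s..t, fs n u (x u) (y u)) k| ≤
      ∫ u in s..t, (∑ z ∈ G, ‖fs n u z.1 z.2‖ + η * U n u) := by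
    intro k
    rw [integral_apply (intervalIntegrable_of_locallyIntegrable
      ((fs n).locallyIntegrable_comp hx hy hxb hyb) _ _), ← Real.norm_eq_abs]
    exact intervalIntegral.norm_integral_le_of_norm_le hst (hpt.mono fun u hu _ => hu k)
      ((isum _ _).add ((iU _ _).const_mul _))
  have h2 : ∫ u in s..t, (∑ z ∈ G, ‖fs n u z.1 z.2‖) ≤
      (∫ u in s..t, ∑ z ∈ G, ‖f u z.1 z.2‖) + ∑ z ∈ G, strongDist (-(R : ℚ)) R z (fs n) f := by
    have ifn : ∀ z : Vec N × Vec N, ∀ a b, IntervalIntegrable (fun u => ‖f u z.1 z.2‖)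
      volume a b := fun z a b => (intervalIntegrable_of_locallyIntegrable
        (f.locallyIntegrable_apply z.1 z.2) a b).norm
    have idn : ∀ z : Vec N × Vec N, ∀ a b, IntervalIntegrable
      (fun u => ‖fs n u z.1 z.2 - f u z.1 z.2‖) volume a b := fun z a b =>
        (intervalIntegrable_of_locallyIntegrable (((fs n).locallyIntegrable_apply z.1 z.2).sub
          (f.locallyIntegrable_apply z.1 z.2)) a b).norm
    rw [intervalIntegral.integral_finsetSum fun z _ => inorm z _ _,
      intervalIntegral.integral_finsetSum fun z _ => ifn z _ _, ← Finset.sum_add_distrib]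
    refine Finset.sum_le_sum fun z _ => ?_
    have hq : (-(R : ℚ)) ≤ R := by
      have : (0 : ℚ) ≤ R := Nat.cast_nonneg R
      linarith
    have e : ∫ u in s..t, ‖fs n u z.1 z.2‖ ≤
        ∫ u in s..t, (‖f u z.1 z.2‖ + ‖fs n u z.1 z.2 - f u z.1 z.2‖) :=
      intervalIntegral.integral_mono_on hst (inorm z _ _) ((ifn z _ _).add (idn z _ _))
        fun u _ => by
          have := norm_add_le (f u z.1 z.2) (fs n u z.1 z.2 - f u z.1 z.2)
          rwa [add_sub_cancel] at this
    rw [intervalIntegral.integral_add (ifn z _ _) (idn z _ _)] at e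
    refine e.trans (add_le_add le_rfl ?_)
    rw [strongDist_eq hq]
    push_cast
    exact intervalIntegral.integral_mono_interval (by linarith) hst (by linarith)
      (ae_of_all _ fun u => norm_nonneg _) (idn z _ _)
  have h3 : ∫ u in s..t, U n u ≤ max C 0 :=
    ((intervalIntegral.integral_mono_interval hs hst ht (ae_of_all _ (hU n).2.1) (iU _ _)).trans
      (hC n)).trans (le_max_left _ _)
  have h4 := hfδ s t hs hst ht hd
  refine (norm_le_of_abs_le h1).trans ?_
  rw [intervalIntegral.integral_add (isum _ _) ((iU _ _).const_mul _),
    intervalIntegral.integral_const_mul]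
  have h5 : N * (ε / (3 * (N + 1))) ≤ ε / 3 := by
    rw [← mul_div_assoc, div_le_div_iff₀ (by positivity) (by positivity)]
    nlinarith
  have hN : (0 : ℝ) ≤ N := Nat.cast_nonneg N
  have h6 := mul_le_mul_of_nonneg_left (h2.trans (add_le_add h4.le hn.le)) hN
  have h7 := mul_le_mul_of_nonneg_left (mul_le_mul_of_nonneg_left h3 hη0.le) hN
  linarith

theorem continuousDependence_of_forall_seq {τ : TopologicalSpace (LC N)} {E : Set (LC N)}
    {P : Set (Vec N × Vec N)} (hP : Dense P)
    (h : ∀ (fs : ℕ → LC N) (f : LC N), (∀ n, fs n ∈ E) → Tendsto fs atTop (@nhds (LC N) τ f) →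
      ConvergesWeakly P fs f ∧ HasUniformSandwichBounds fs ∧ HasEquicontinuousPrimitives fs) :
    ContinuousDependence τ E := by
  intro φs φ fs f hφ hfs hf T hT
  obtain ⟨hW, hS, hM⟩ := h fs f hfs hf
  have hT' : max 0 T ∈ existenceInterval f φ := by
    rcases le_total T 0 with h0 | h0
    · rw [max_eq_left h0]
      exact zero_mem_existenceInterval f φ
    · rw [max_eq_right h0]
      exact hT ⟨by linarith, le_rfl⟩
  obtain ⟨h1, h2⟩ := tendstoUniformlyOn_sol hP hW hS hM hφ (le_max_left 0 T) hT'
  have hsub : Icc (-1) T ⊆ Icc (-1) (max 0 T) := Icc_subset_Icc_right (le_max_right _ _)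
  exact ⟨h1.mono fun n hn => hsub.trans (Icc_subset_existenceInterval hn), h2.mono hsub⟩

theorem continuousDependence_strongTopology {E : Set (LC N)} (hL : SatisfiesLx E)
    (hKx : ∀ f ∈ E, f.Kx) (hKy : ∀ f ∈ E, f.Ky) {P : Set (Vec N × Vec N)} (hP : Dense P) :
    ContinuousDependence (strongTopology P) E :=
  continuousDependence_of_forall_seq hP fun _ _ hfs hf =>
    have hS := hasUniformSandwichBounds_of_mem hL hKx hKy hfs
    ⟨convergesWeakly_of_tendsto_weakTopology (tendsto_weakTopology_of_strongTopology hf), hS,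
      hasEquicontinuousPrimitives_of_tendsto hP hf hS⟩

theorem continuousDependence_weakTopology {E : Set (LC N)} (hL : SatisfiesLx E)
    (hKx : ∀ f ∈ E, f.Kx) (hKy : ∀ f ∈ E, f.Ky) {P : Set (Vec N × Vec N)} (hP : Dense P)
    (hE : HasEquicontinuousMBounds E) : ContinuousDependence (weakTopology P) E :=
  continuousDependence_of_forall_seq hP fun _ _ hfs hf =>
    ⟨convergesWeakly_of_tendsto_weakTopology hf, hasUniformSandwichBounds_of_mem hL hKx hKy hfs,
      hE.hasEquicontinuousPrimitives hfs⟩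

/-! ### The cocycle property -/

theorem LC.translate_apply (f : LC N) (s t : ℝ) (x y : Vec N) :
    f.translate s t x y = f (s + t) x y := rfl

theorem LC.translate_zero (f : LC N) : f.translate 0 = f := by
  ext1
  funext t x y
  rw [f.translate_apply, zero_add]

theorem LC.translate_add (f : LC N) (s t : ℝ) :
    f.translate (s + t) = (f.translate s).translate t := by
  ext1
  funext u x y
  simp only [LC.translate_apply, add_assoc]

theorem hist_apply {f : LC N} {φ : Hist N} {t : ℝ} (ht : 0 ≤ t) (h : t ∈ existenceInterval f φ)
    (s : Icc (-1 : ℝ) 0) : hist f φ t s = sol f φ (t + s) := by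
  have hc : Continuous fun s : Icc (-1 : ℝ) 0 => sol f φ (t + s) := by
    refine (isSolutionOn_sol ht h).continuousOn.comp_continuous (by fun_prop) fun s => ?_
    exact ⟨by linarith [s.2.1], by linarith [s.2.2]⟩
  rw [hist, dif_pos hc]
  rfl

theorem IsSolutionOn.translate {f : LC N} {φ : Hist N} {s t : ℝ} (hs : 0 ≤ s)
    (ht : 0 ≤ t) (h : s + t ∈ existenceInterval f φ) :
    IsSolutionOn (f.translate s) (hist f φ s) t fun u => sol f φ (s + u) := by
  have hx := isSolutionOn_sol (add_nonneg hs ht) h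
  have e : (fun u => f.translate s u (sol f φ (s + u)) (sol f φ (s + (u - 1)))) =
      fun u => (fun v => f v (sol f φ v) (sol f φ (v - 1))) (s + u) := by
    funext u
    rw [f.translate_apply, ← add_sub_assoc]
  have hint : ∀ u ∈ Icc 0 t, IntervalIntegrable
      (fun v => f v (sol f φ v) (sol f φ (v - 1))) volume s (s + u) := fun u hu =>
    hx.intervalIntegrable ⟨hs, by linarith⟩ ⟨by linarith [hu.1], by linarith [hu.2]⟩
  refine ⟨hx.continuousOn.comp (by fun_prop) fun u hu => ⟨by linarith [hu.1], by linarith [hu.2]⟩,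
    fun u => ?_, fun u hu => ?_, fun u hu => ?_⟩
  · rw [hist_apply hs (mem_existenceInterval_of_le h (by linarith) (by linarith))]
  · rw [e]
    have := (hint u hu).comp_add_left s
    simpa using this
  · rw [e, intervalIntegral.integral_comp_add_left (fun v => f v (sol f φ v) (sol f φ (v - 1))) s,
      add_zero, ← hx.sub_eq ⟨hs, by linarith⟩ ⟨by linarith [hu.1], by linarith [hu.2]⟩]
    abel

theorem sol_add {f : LC N} {φ : Hist N} {s t : ℝ} (hs : 0 ≤ s) (ht : 0 ≤ t)
    (h : s + t ∈ existenceInterval f φ) {u : ℝ} (hu : u ∈ Icc (-1) t) :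
    sol f φ (s + u) = sol (f.translate s) (hist f φ s) u :=
  ((IsSolutionOn.translate hs ht h).sol_eqOn ht hu).symm

/-- If the solution from the state at time `s` exists up to time `t`, the original solution is bounded
on `[0,s+t]` as long as it exists, so that it reaches `s+t` and no gluing of solutions is needed. -/
theorem add_mem_existenceInterval_iff {f : LC N} {φ : Hist N} {s t : ℝ} (hs : 0 ≤ s) (ht : 0 ≤ t)
    (h : s ∈ existenceInterval f φ) :
    t ∈ existenceInterval (f.translate s) (hist f φ s) ↔ s + t ∈ existenceInterval f φ := by
  constructor
  · intro h'
    obtain ⟨M, -, hM⟩ := (isSolutionOn_sol hs h).exists_bound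
    obtain ⟨M', -, hM'⟩ := (isSolutionOn_sol ht h').exists_bound
    refine mem_existenceInterval_of_bounded (M := max M M') (add_nonneg hs ht) fun u hu huI => ?_
    rcases le_total u s with hus | hus
    · exact (hM u ⟨by linarith [hu.1], hus⟩).trans (le_max_left _ _)
    · have e := sol_add hs (sub_nonneg.2 hus) (by rwa [add_sub_cancel])
        (u := u - s) ⟨by linarith, le_rfl⟩
      rw [add_sub_cancel] at e
      rw [e]
      exact (hM' (u - s) ⟨by linarith, by linarith [hu.2]⟩).trans (le_max_right _ _)
  · intro h'
    exact (IsSolutionOn.translate hs ht h').mem_existenceInterval ht ⟨by linarith, le_rfl⟩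

theorem hist_add {f : LC N} {φ : Hist N} {s t : ℝ} (hs : 0 ≤ s) (ht : 0 ≤ t)
    (h : s + t ∈ existenceInterval f φ) :
    hist f φ (s + t) = hist (f.translate s) (hist f φ s) t := by
  have h1 : s ∈ existenceInterval f φ :=
    mem_existenceInterval_of_le h (by linarith) (by linarith)
  ext1 u
  rw [hist_apply (add_nonneg hs ht) h, hist_apply ht ((add_mem_existenceInterval_iff hs ht h1).2 h),
    add_assoc, sol_add hs ht h ⟨by linarith [u.2.1], by linarith [u.2.2]⟩]

theorem hist_zero (f : LC N) (φ : Hist N) : hist f φ 0 = φ := by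
  ext1 s
  rw [hist_apply le_rfl (zero_mem_existenceInterval f φ), zero_add, sol_of_mem_initial]

/-! ### From continuous dependence to a semiflow -/

theorem eventually_nhdsWithin_of_seq {X : Type*} [TopologicalSpace X] [FirstCountableTopology X]
    {s : Set X} {a : X} {p : X → Prop}
    (h : ∀ x : ℕ → X, (∀ n, x n ∈ s) → Tendsto x atTop (𝓝 a) → ∀ᶠ n in atTop, p (x n)) :
    ∀ᶠ y in 𝓝[s] a, p y := by
  by_contra hcon
  have hf : ∃ᶠ y in 𝓝[s] a, ¬ p y ∧ y ∈ s :=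
    (not_eventually.1 hcon).and_eventually self_mem_nhdsWithin
  obtain ⟨x, hx, hxp⟩ := exists_seq_forall_of_frequently hf
  obtain ⟨n, hn⟩ := (h x (fun n => (hxp n).2) (hx.mono_right nhdsWithin_le_nhds)).exists
  exact (hxp n).1 hn

/-- The neighbourhood form of continuous dependence. -/
theorem ContinuousDependence.eventually {τ : TopologicalSpace (LC N)} [FirstCountableTopology (LC N)]
    {E : Set (LC N)} (hE : ContinuousDependence τ E) {f : LC N} {φ : Hist N} {T : ℝ} (hT : 0 ≤ T)
    (h : T ∈ existenceInterval f φ) {ε : ℝ} (hε : 0 < ε) :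
    ∀ᶠ p in 𝓝[E ×ˢ univ] (f, φ), T ∈ existenceInterval p.1 p.2 ∧
      ∀ t ∈ Icc (-1) T, dist (sol p.1 p.2 t) (sol f φ t) < ε := by
  refine eventually_nhdsWithin_of_seq fun x hx hxt => ?_
  rw [nhds_prod_eq, tendsto_prod_iff'] at hxt
  obtain ⟨h1, h2⟩ := hE (fun n => (x n).2) φ (fun n => (x n).1) f hxt.2 (fun n => (hx n).1) hxt.1 T
    (Icc_subset_existenceInterval h)
  filter_upwards [h1, Metric.tendstoUniformlyOn_iff.1 h2 ε hε] with n hn1 hn2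
  refine ⟨hn1 ⟨by linarith, le_rfl⟩, fun t ht => ?_⟩
  rw [dist_comm]
  exact hn2 t ht

/-- Continuous dependence extends to the closure: a solution over the closure is approximated by
solutions over `E`, which by continuous dependence are close to the given one. In particular it
stays bounded, hence exists long enough. -/
theorem ContinuousDependence.eventually_closure {τ : TopologicalSpace (LC N)}
    [FirstCountableTopology (LC N)] {E : Set (LC N)} (hE : ContinuousDependence τ E) {f : LC N}
    {φ : Hist N} {T : ℝ} (hT : 0 ≤ T) (h : T ∈ existenceInterval f φ) {ε : ℝ} (hε : 0 < ε) :
    ∀ᶠ p in 𝓝[closure E ×ˢ univ] (f, φ), T ∈ existenceInterval p.1 p.2 ∧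
      ∀ t ∈ Icc (-1) T, dist (sol p.1 p.2 t) (sol f φ t) < ε := by
  obtain ⟨O, hO, hfO, hOE⟩ := mem_nhdsWithin.1 (hE.eventually hT h (half_pos hε))
  refine mem_nhdsWithin.2 ⟨O, hO, hfO, ?_⟩
  rintro ⟨g, ψ⟩ ⟨hgO, hg, -⟩
  have key : ∀ T', 0 ≤ T' → T' ≤ T → T' ∈ existenceInterval g ψ →
      ∀ t ∈ Icc (-1) T', dist (sol g ψ t) (sol f φ t) < ε := by
    intro T' hT' hTT' h' t ht
    have htend : Tendsto (fun g' => (g', ψ)) (𝓝[E] g) (𝓝[E ×ˢ univ] (g, ψ)) := by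
      refine tendsto_nhdsWithin_iff.2 ⟨?_, ?_⟩
      · exact ((Continuous.prodMk_left ψ).tendsto g).mono_left nhdsWithin_le_nhds
      · filter_upwards [self_mem_nhdsWithin] with g' hg' using ⟨hg', mem_univ _⟩
    have := mem_closure_iff_nhdsWithin_neBot.1 hg
    obtain ⟨g', h1, h2, h3⟩ := ((htend.eventually (hE.eventually hT' h' (half_pos hε))).and
      ((htend.eventually (mem_nhdsWithin_of_mem_nhds (hO.mem_nhds hgO))).and
        self_mem_nhdsWithin)).exists
    have h4 := (hOE ⟨h2, h3, mem_univ _⟩).2 t ⟨ht.1, ht.2.trans hTT'⟩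
    have h5 := h1.2 t ht
    rw [dist_comm] at h5
    linarith [dist_triangle (sol g ψ t) (sol g' ψ t) (sol f φ t)]
  have hmem : T ∈ existenceInterval g ψ := by
    obtain ⟨M, -, hM⟩ := (isSolutionOn_sol hT h).exists_bound
    refine mem_existenceInterval_of_bounded (M := M + ε) hT fun t ht htI => ?_
    have h1 := key t ht.1 ht.2 htI t ⟨by linarith [ht.1], le_rfl⟩
    rw [dist_eq_norm] at h1
    have h2 := norm_le_norm_add_norm_sub (sol f φ t) (sol g ψ t)
    rw [norm_sub_rev] at h2
    linarith [hM t ⟨by linarith [ht.1], ht.2⟩]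
  exact ⟨hmem, key T hT le_rfl hmem⟩

theorem isMonotoneOver_closure {τ : TopologicalSpace (LC N)} [FirstCountableTopology (LC N)]
    {E : Set (LC N)} (hE : ContinuousDependence τ E) (hKx : ∀ f ∈ E, f.Kx)
    (hKy : ∀ f ∈ E, f.Ky) : IsMonotoneOver (closure E) := by
  intro f hf φ ψ hφψ t ht i
  rcases le_total t 0 with h0 | h0
  · obtain ⟨T, -, hT, -⟩ := ht.1
    rw [sol_of_mem_initial f φ ⟨t, hT.1, h0⟩, sol_of_mem_initial f ψ ⟨t, hT.1, h0⟩]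
    exact hφψ _ i
  obtain ⟨g, hgE, hg⟩ := mem_closure_iff_seq_limit.1 hf
  have hmem : t ∈ Icc (-1) t := ⟨by linarith, le_rfl⟩
  obtain ⟨h1, h2⟩ := hE (fun _ => φ) φ g f tendsto_const_nhds hgE hg t
    (Icc_subset_existenceInterval ht.1)
  obtain ⟨h3, h4⟩ := hE (fun _ => ψ) ψ g f tendsto_const_nhds hgE hg t
    (Icc_subset_existenceInterval ht.2)
  have hc : Continuous fun v : Vec N => v i := (EuclideanSpace.proj i : Vec N →L[ℝ] ℝ).continuous
  refine le_of_tendsto_of_tendsto ((hc.tendsto _).comp (h2.tendsto_at hmem))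
    ((hc.tendsto _).comp (h4.tendsto_at hmem)) ?_
  filter_upwards [h1, h3] with n h1 h3
  exact (isSolutionOn_sol h0 (h1 hmem)).le_of_kamke (hKx _ (hgE n)) (hKy _ (hgE n)) hφψ
    (isSolutionOn_sol h0 (h3 hmem)) t hmem i

/-- Continuous dependence over `E`, together with the continuity of the base flow on the closure
of `E`, gives a skew-product semiflow over this closure. -/
theorem isMonotoneContinuousSemiflow_closure {τ : TopologicalSpace (LC N)}
    [FirstCountableTopology (LC N)] {E : Set (LC N)} (hE : ContinuousDependence τ E)
    (hKx : ∀ f ∈ E, f.Kx) (hKy : ∀ f ∈ E, f.Ky) (hinv : BaseInvariant E)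
    (hflow : ∀ (fs : ℕ → LC N) (f : LC N) (ts : ℕ → ℝ) (t : ℝ), (∀ n, fs n ∈ closure E) →
      f ∈ closure E → Tendsto fs atTop (𝓝 f) → Tendsto ts atTop (𝓝 t) →
      Tendsto (fun n => (fs n).translate (ts n)) atTop (𝓝 (f.translate t))) :
    IsMonotoneContinuousSemiflow τ (closure E) := by
  have hcl : ∀ f ∈ closure E, ∀ t : ℝ, f.translate t ∈ closure E := by
    intro f hf t
    obtain ⟨g, hgE, hg⟩ := mem_closure_iff_seq_limit.1 hf
    exact mem_closure_of_tendsto (hflow g f (fun _ => t) t (fun n => subset_closure (hgE n)) hf hg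
      tendsto_const_nhds) (Eventually.of_forall fun n => hinv _ (hgE n) t)
  have hsnd : ∀ p : ℝ≥0 × LC N × Hist N, Tendsto (fun q : ℝ≥0 × LC N × Hist N => q.2)
      (𝓝[univ ×ˢ (closure E ×ˢ univ)] p) (𝓝[closure E ×ˢ univ] (p.2.1, p.2.2)) := by
    intro p
    refine tendsto_nhdsWithin_iff.2 ⟨?_, ?_⟩
    · exact (continuous_snd.tendsto p).mono_left nhdsWithin_le_nhds
    · filter_upwards [self_mem_nhdsWithin] with q hq using hq.2
  have hfst : ∀ p : ℝ≥0 × LC N × Hist N, ∀ S : Set (ℝ≥0 × LC N × Hist N),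
      Tendsto (fun q : ℝ≥0 × LC N × Hist N => (q.1 : ℝ)) (𝓝[S] p) (𝓝 p.1) := fun p S =>
    ((NNReal.continuous_coe.comp continuous_fst).tendsto p).mono_left nhdsWithin_le_nhds
  have hsub : skewDomain (closure E) ⊆ univ ×ˢ (closure E ×ˢ (univ : Set (Hist N))) :=
    fun p hp => ⟨mem_univ _, hp.1, mem_univ _⟩
  have hnhds : ∀ p ∈ skewDomain (closure E),
      skewDomain (closure E) ∈ 𝓝[univ ×ˢ (closure E ×ˢ univ)] p := by
    rintro p ⟨hp, hpI⟩
    obtain ⟨T, hT, hTI⟩ := exists_gt_mem_existenceInterval p.1.coe_nonneg hpI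
    have hT0 : 0 ≤ T := p.1.coe_nonneg.trans hT.le
    filter_upwards [(hsnd p).eventually (hE.eventually_closure hT0 hTI one_pos),
      (hfst p _).eventually_lt_const hT, self_mem_nhdsWithin] with q h1 h2 h3
    exact ⟨h3.2.1, mem_existenceInterval_of_le h1.1 (by linarith [q.1.coe_nonneg]) h2.le⟩
  refine ⟨⟨hsub, ?_, ?_, ?_, ?_, ?_, ?_, ?_, ?_⟩, isMonotoneOver_closure hE hKx hKy⟩
  · refine ⟨interior (skewDomain (closure E) ∪ (univ ×ˢ (closure E ×ˢ univ))ᶜ), isOpen_interior,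
      Subset.antisymm (fun p hp => ⟨mem_interior_iff_mem_nhds.2 ?_, hsub hp⟩) ?_⟩
    · filter_upwards [mem_nhdsWithin_iff_eventually.1 (hnhds p hp)] with q hq
      exact or_iff_not_imp_right.2 fun h => hq (not_not.1 h)
    · rintro p ⟨hp, hpA⟩
      exact (interior_subset hp).resolve_right fun h => h hpA
  · rintro s t p hst ⟨hp, hpI⟩
    exact ⟨hp, mem_existenceInterval_of_le hpI (by linarith [s.coe_nonneg]) (by exact_mod_cast hst)⟩
  · rintro p ⟨hp, -⟩
    exact ⟨hp, by simpa using zero_mem_existenceInterval p.1 p.2⟩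
  · rintro p ⟨hp, -⟩
    exact ⟨hcl _ hp _, mem_univ _⟩
  · rintro p -
    simp only [skewMap, NNReal.coe_zero, LC.translate_zero, hist_zero]
  · rintro s t p ⟨hp, hpI⟩
    have := add_mem_existenceInterval_iff s.coe_nonneg t.coe_nonneg hpI
    constructor
    · rintro ⟨-, h⟩
      exact ⟨hp, by simpa using this.1 h⟩
    · rintro ⟨-, h⟩
      exact ⟨hcl _ hp _, this.2 (by simpa using h)⟩
  · rintro s t p ⟨hp, hpI⟩
    have h : (s : ℝ) + t ∈ existenceInterval p.1 p.2 := by simpa using hpI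
    simp only [skewMap, NNReal.coe_add, LC.translate_add, hist_add s.coe_nonneg t.coe_nonneg h]
  · rintro p ⟨hp, hpI⟩
    refine Tendsto.prodMk_nhds ?_ ?_
    · rw [tendsto_def]
      intro V hV
      refine eventually_nhdsWithin_of_seq
        (p := fun q : ℝ≥0 × LC N × Hist N => q.2.1.translate (q.1 : ℝ) ∈ V)
        fun x hx hxt => ?_
      have h1 : Tendsto (fun n => (x n).2.1) atTop (𝓝 p.2.1) :=
        (continuous_fst.comp continuous_snd).continuousAt.tendsto.comp hxt
      have h2 : Tendsto (fun n => ((x n).1 : ℝ)) atTop (𝓝 p.1) :=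
        (NNReal.continuous_coe.comp continuous_fst).continuousAt.tendsto.comp hxt
      exact hflow _ _ _ _ (fun n => (hx n).1) hp h1 h2 hV
    · obtain ⟨T, hT, hTI⟩ := exists_gt_mem_existenceInterval p.1.coe_nonneg hpI
      have hT0 : 0 ≤ T := p.1.coe_nonneg.trans hT.le
      rw [Metric.tendsto_nhds]
      intro ε hε
      obtain ⟨δ, hδ, hunif⟩ := Metric.uniformContinuousOn_iff.1
        (isCompact_Icc.uniformContinuousOn_of_continuous
          (isSolutionOn_sol hT0 hTI).continuousOn) (ε / 3) (by positivity)
      have hmono := nhdsWithin_mono p hsub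
      filter_upwards [((hsnd p).mono_left hmono).eventually
          (hE.eventually_closure hT0 hTI (show 0 < ε / 3 by positivity)),
        (hfst p _).eventually_lt_const hT, (hfst p _).eventually (Metric.ball_mem_nhds _ hδ),
        self_mem_nhdsWithin] with q h1 h2 h3 h4
      refine lt_of_le_of_lt ((ContinuousMap.dist_le (show 0 ≤ 2 * ε / 3 by positivity)).2
        fun s => ?_) (show 2 * ε / 3 < ε by linarith)
      have hq : (q.1 : ℝ) + s ∈ Icc (-1) T :=
        ⟨by linarith [s.2.1, q.1.coe_nonneg], by linarith [s.2.2]⟩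
      have hp' : (p.1 : ℝ) + s ∈ Icc (-1) T :=
        ⟨by linarith [s.2.1, p.1.coe_nonneg], by linarith [s.2.2]⟩
      change dist (hist q.2.1 q.2.2 q.1 s) (hist p.2.1 p.2.2 p.1 s) ≤ _
      rw [hist_apply q.1.coe_nonneg h4.2, hist_apply p.1.coe_nonneg hpI]
      have e1 := h1.2 _ hq
      have e2 := hunif _ hq _ hp' (by rw [dist_add_right]; exact h3)
      have e3 := dist_triangle (sol q.2.1 q.2.2 (q.1 + s)) (sol p.2.1 p.2.2 (q.1 + s))
        (sol p.2.1 p.2.2 (p.1 + s))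
      linarith

/-! ### Continuity of the base flow -/

theorem locallyIntegrable_comp_add {E : Type*} [NormedAddCommGroup E] {h : ℝ → E}
    (hh : LocallyIntegrable h volume) (s : ℝ) :
    LocallyIntegrable (fun u => h (s + u)) volume := by
  have e := (locallyIntegrable_map_homeomorph (Homeomorph.addLeft s) (f := h)
    (μ := (volume : Measure ℝ))).1
  rw [show Measure.map (Homeomorph.addLeft s) (volume : Measure ℝ) = volume from
    map_add_left_eq_self volume s] at e
  exact e hh

/-- Translation is continuous in `L¹` on bounded intervals. -/
theorem tendsto_integral_norm_translate_sub {h : ℝ → Vec N} (hh : LocallyIntegrable h volume)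
    (a b t : ℝ) : Tendsto (fun s => ∫ u in a..b, ‖h (s + u) - h (t + u)‖) (𝓝 t) (𝓝 0) := by
  wlog hab : a ≤ b generalizing a b
  · have := (this b a (le_of_not_ge hab)).neg
    simpa [← intervalIntegral.integral_symm] using this
  set R := |t| + |a| + |b| + 1 with hR
  set H := (Icc (-R) R).indicator h with hH
  have hHi : Integrable H volume :=
    (hh.integrableOn_isCompact isCompact_Icc).integrable_indicator measurableSet_Icc
  rw [Metric.tendsto_nhds]
  intro ε hε
  obtain ⟨g, -, hgε, hgc, hgi⟩ :=
    hHi.exists_hasCompactSupport_integral_sub_le (show 0 < ε / 4 by positivity)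
  have hcont : Continuous fun s => ∫ u in a..b, ‖g (s + u) - g (t + u)‖ :=
    intervalIntegral.continuous_parametric_intervalIntegral_of_continuous'
      (by unfold Function.uncurry; fun_prop) a b
  have hlim : ∀ᶠ s in 𝓝 t, ∫ u in a..b, ‖g (s + u) - g (t + u)‖ < ε / 4 := by
    have := hcont.tendsto t
    simp only [sub_self, norm_zero, intervalIntegral.integral_zero] at this
    exact this.eventually_lt_const (by positivity)
  have hd : Integrable (fun u => ‖H u - g u‖) volume := (hHi.sub hgi).norm
  have hbd : ∀ s, ∫ u in a..b, ‖H (s + u) - g (s + u)‖ ≤ ε / 4 := by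
    intro s
    rw [intervalIntegral.integral_comp_add_left (fun u => ‖H u - g u‖) s,
      intervalIntegral.integral_of_le (by linarith)]
    exact (setIntegral_le_integral hd (ae_of_all _ fun u => norm_nonneg _)).trans hgε
  have hball : ∀ᶠ s in 𝓝 t, |s - t| < 1 := by
    filter_upwards [Metric.ball_mem_nhds t one_pos] with s hs
    rwa [Metric.mem_ball, Real.dist_eq] at hs
  filter_upwards [hlim, hball] with s h1 h2
  have heq : ∀ r, |r - t| < 1 → ∀ u ∈ Icc a b, h (r + u) = H (r + u) := by
    intro r hr u hu
    have hmem : r + u ∈ Icc (-R) R := by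
      have h3 := abs_lt.1 hr
      constructor <;> linarith [neg_abs_le t, le_abs_self t, neg_abs_le a, le_abs_self a,
        neg_abs_le b, le_abs_self b, hu.1, hu.2, abs_nonneg a, abs_nonneg b]
    rw [hH, indicator_of_mem hmem]
  have iH : ∀ r, IntervalIntegrable (fun u => ‖H (r + u) - g (r + u)‖) volume a b := fun r =>
    (hd.comp_add_left r).intervalIntegrable
  have ig : IntervalIntegrable (fun u => ‖g (s + u) - g (t + u)‖) volume a b :=
    (by fun_prop : Continuous fun u => ‖g (s + u) - g (t + u)‖).intervalIntegrable _ _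
  have ih : IntervalIntegrable (fun u => ‖h (s + u) - h (t + u)‖) volume a b :=
    (intervalIntegrable_of_locallyIntegrable ((locallyIntegrable_comp_add hh s).sub
      (locallyIntegrable_comp_add hh t)) a b).norm
  have hle : ∫ u in a..b, ‖h (s + u) - h (t + u)‖ ≤ ∫ u in a..b,
      (‖H (s + u) - g (s + u)‖ + ‖g (s + u) - g (t + u)‖ + ‖H (t + u) - g (t + u)‖) := by
    refine intervalIntegral.integral_mono_on hab ih (((iH s).add ig).add (iH t)) fun u hu => ?_
    rw [heq s h2 u hu, heq t (by simp) u hu]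
    have := norm_add₃_le (a := H (s + u) - g (s + u)) (b := g (s + u) - g (t + u))
      (c := g (t + u) - H (t + u))
    rw [norm_sub_rev (g (t + u)) (H (t + u))] at this
    refine le_trans (le_of_eq ?_) this
    congr 1
    abel
  rw [intervalIntegral.integral_add ((iH s).add ig) (iH t),
    intervalIntegral.integral_add (iH s) ig] at hle
  rw [Real.dist_eq, sub_zero, abs_of_nonneg (intervalIntegral.integral_nonneg hab fun u _ =>
    norm_nonneg _)]
  linarith [hbd s, hbd t]

theorem tendsto_translate_strongTopology {P : Set (Vec N × Vec N)} {fs : ℕ → LC N} {f : LC N}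
    {ts : ℕ → ℝ} {t : ℝ} (hf : Tendsto fs atTop (@nhds (LC N) (strongTopology P) f))
    (ht : Tendsto ts atTop (𝓝 t)) : Tendsto (fun n => (fs n).translate (ts n)) atTop
      (@nhds (LC N) (strongTopology P) (f.translate t)) := by
  refine tendsto_strongTopology_iff.2 fun z hz q₁ q₂ => ?_
  rcases lt_or_ge q₂ q₁ with hq | hq
  · have : ∀ g g' : LC N, strongDist q₁ q₂ z g g' = 0 := fun g g' => by
      rw [strongDist, Icc_eq_empty (by simpa using hq), setIntegral_empty]
    simp [this]
  have hq' : (q₁ : ℝ) ≤ q₂ := by exact_mod_cast hq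
  simp only [strongDist_eq hq, LC.translate_apply]
  obtain ⟨R, hR⟩ := exists_nat_ge (|t| + |(q₁ : ℝ)| + |(q₂ : ℝ)| + 1)
  have hRq : (-(R : ℚ)) ≤ R := by
    have : (0 : ℚ) ≤ R := Nat.cast_nonneg R
    linarith
  have hlim := (tendsto_strongTopology_iff.1 hf z hz (-(R : ℚ)) R).add
    ((tendsto_integral_norm_translate_sub (f.locallyIntegrable_apply z.1 z.2) q₁ q₂ t).comp ht)
  rw [add_zero] at hlim
  have hball : ∀ᶠ n in atTop, |ts n - t| < 1 := by
    simpa [Real.dist_eq] using ht.eventually (Metric.ball_mem_nhds t one_pos)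
  refine squeeze_zero' (Eventually.of_forall fun n => intervalIntegral.integral_nonneg hq'
    fun u _ => norm_nonneg _) ?_ hlim
  filter_upwards [hball] with n hn
  have i1 : LocallyIntegrable (fun u => fs n u z.1 z.2 - f u z.1 z.2) volume :=
    ((fs n).locallyIntegrable_apply z.1 z.2).sub (f.locallyIntegrable_apply z.1 z.2)
  have i2 : LocallyIntegrable (fun u => f (ts n + u) z.1 z.2 - f (t + u) z.1 z.2) volume :=
    (locallyIntegrable_comp_add (f.locallyIntegrable_apply z.1 z.2) (ts n)).sub
      (locallyIntegrable_comp_add (f.locallyIntegrable_apply z.1 z.2) t)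
  have i3 : LocallyIntegrable (fun u => fs n (ts n + u) z.1 z.2 - f (t + u) z.1 z.2) volume :=
    (locallyIntegrable_comp_add ((fs n).locallyIntegrable_apply z.1 z.2) (ts n)).sub
      (locallyIntegrable_comp_add (f.locallyIntegrable_apply z.1 z.2) t)
  have i1' := (intervalIntegrable_of_locallyIntegrable
    (locallyIntegrable_comp_add i1 (ts n)) q₁ q₂).norm
  have i2' := (intervalIntegrable_of_locallyIntegrable i2 q₁ q₂).norm
  have i3' := (intervalIntegrable_of_locallyIntegrable i3 q₁ q₂).norm
  have hle := intervalIntegral.integral_mono_on hq' i3' (i1'.add i2') fun u _ =>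
    norm_sub_le_norm_sub_add_norm_sub (fs n (ts n + u) z.1 z.2) (f (ts n + u) z.1 z.2)
      (f (t + u) z.1 z.2)
  rw [intervalIntegral.integral_add i1' i2'] at hle
  refine hle.trans (add_le_add ?_ le_rfl)
  rw [intervalIntegral.integral_comp_add_left (fun u => ‖fs n u z.1 z.2 - f u z.1 z.2‖) (ts n),
    strongDist_eq hRq]
  have h3 := abs_lt.1 hn
  push_cast
  refine intervalIntegral.integral_mono_interval ?_ (by linarith) ?_
    (ae_of_all _ fun u => norm_nonneg _) (intervalIntegrable_of_locallyIntegrable i1 _ _).norm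
  · linarith [neg_abs_le t, neg_abs_le (q₁ : ℝ), abs_nonneg (q₂ : ℝ)]
  · linarith [le_abs_self t, le_abs_self (q₂ : ℝ), abs_nonneg (q₁ : ℝ)]

theorem norm_sub_le_of_forall_rat {E : Type*} [NormedAddCommGroup E] {A : ℝ → E}
    (hA : Continuous A) {r δ ε : ℝ}
    (h : ∀ p q : ℚ, |(p : ℝ)| < r → |(q : ℝ)| < r → |(q : ℝ) - p| < δ → ‖A q - A p‖ ≤ ε)
    (a b : ℝ) (ha : |a| < r) (hb : |b| < r) (hab : |b - a| < δ) : ‖A b - A a‖ ≤ ε := by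
  let O : Set (ℝ × ℝ) := {p | |p.1| < r ∧ |p.2| < r ∧ |p.2 - p.1| < δ}
  have hO : IsOpen O := (isOpen_lt (continuous_abs.comp continuous_fst) continuous_const).inter
    ((isOpen_lt (continuous_abs.comp continuous_snd) continuous_const).inter
      (isOpen_lt (continuous_abs.comp (continuous_snd.sub continuous_fst)) continuous_const))
  have hD : DenseRange (Prod.map ((↑) : ℚ → ℝ) ((↑) : ℚ → ℝ)) :=
    Rat.denseRange_cast.prodMap Rat.denseRange_cast
  have hcl : IsClosed {p : ℝ × ℝ | ‖A p.2 - A p.1‖ ≤ ε} :=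
    isClosed_le (by fun_prop) continuous_const
  have hsub : O ∩ range (Prod.map ((↑) : ℚ → ℝ) ((↑) : ℚ → ℝ)) ⊆
      {p : ℝ × ℝ | ‖A p.2 - A p.1‖ ≤ ε} := by
    rintro _ ⟨⟨h1, h2, h3⟩, ⟨⟨p, q⟩, rfl⟩⟩
    exact h p q h1 h2 h3
  exact closure_minimal hsub hcl (hD.open_subset_closure_inter hO
    (show (a, b) ∈ O from ⟨ha, hb, hab⟩))

/-- The primitives of `f(·,z)`, for `f` in the weak closure of a set with equicontinuous
`m`-bounds, are equicontinuous. -/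
theorem HasEquicontinuousMBounds.exists_delta_closure {E : Set (LC N)}
    (hE : HasEquicontinuousMBounds E) {P : Set (Vec N × Vec N)} {z : Vec N × Vec N} (hz : z ∈ P)
    {r ε : ℝ} (hr : 0 < r) (hε : 0 < ε) : ∃ δ : ℝ, 0 < δ ∧
      ∀ f ∈ @closure (LC N) (weakTopology P) E, ∀ a b : ℝ, |a| < r → |b| < r → |b - a| < δ →
        ‖∫ u in a..b, f u z.1 z.2‖ ≤ ε := by
  obtain ⟨j, hj⟩ := exists_nat_ge (norm2 z.1 z.2)
  obtain ⟨m, hm, heq⟩ := hE j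
  obtain ⟨δ, hδ, h⟩ := heq r hr ε hε
  refine ⟨δ, hδ, fun f hf => ?_⟩
  have hgE : ∀ g ∈ E, ∀ a b : ℝ, |a| < r → |b| < r → |b - a| < δ → a ≤ b →
      ‖∫ u in a..b, g u z.1 z.2‖ ≤ ε := by
    intro g hg a b ha hb hab hle
    refine (intervalIntegral.norm_integral_le_of_norm_le hle ?_
      (intervalIntegrable_of_locallyIntegrable (hm g hg).1 _ _)).trans
      (h a b (abs_lt.1 ha).1.le hle (abs_lt.1 hb).2.le ((le_abs_self _).trans_lt hab) _
        (mem_image_of_mem _ hg)).le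
    filter_upwards [(hm g hg).2] with u hu _ using hu z hj
  have hrat : ∀ a b : ℚ, |(a : ℝ)| < r → |(b : ℝ)| < r → |(b : ℝ) - a| < δ → a ≤ b →
      ‖∫ u in (a : ℝ)..b, f u z.1 z.2‖ ≤ ε := by
    intro a b ha hb hab hle
    let := weakTopology P
    have := mem_closure_iff_nhdsWithin_neBot.1 hf
    have hid : Tendsto id (𝓝[E] f) (@nhds (LC N) (weakTopology P) f) :=
      tendsto_id.mono_left nhdsWithin_le_nhds
    have hlim := tendsto_weakTopology_iff.1 hid z hz a b
    have hlim' : Tendsto (fun g : LC N => ε + weakDist a b z g f) (𝓝[E] f) (𝓝 (ε + 0)) :=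
      tendsto_const_nhds.add hlim
    rw [add_zero] at hlim'
    refine ge_of_tendsto hlim' ?_
    filter_upwards [self_mem_nhdsWithin] with g hg
    have h1 := hgE g hg a b ha hb hab (by exact_mod_cast hle)
    rw [weakDist_eq hle, intervalIntegral.integral_sub
      (intervalIntegrable_of_locallyIntegrable (g.locallyIntegrable_apply _ _) _ _)
      (intervalIntegrable_of_locallyIntegrable (f.locallyIntegrable_apply _ _) _ _)]
    have h2 := norm_le_norm_add_norm_sub (∫ u in (a : ℝ)..b, g u z.1 z.2)
      (∫ u in (a : ℝ)..b, f u z.1 z.2)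
    linarith
  have hfi := intervalIntegrable_of_locallyIntegrable (f.locallyIntegrable_apply z.1 z.2)
  have hsub : ∀ a b, ∫ u in a..b, f u z.1 z.2 =
      (∫ u in (0 : ℝ)..b, f u z.1 z.2) - ∫ u in (0 : ℝ)..a, f u z.1 z.2 := fun a b =>
    (intervalIntegral.integral_interval_sub_left (hfi _ _) (hfi _ _)).symm
  intro a b ha hb hab
  rw [hsub]
  refine norm_sub_le_of_forall_rat (continuous_primitive_of_locallyIntegrable
    (f.locallyIntegrable_apply z.1 z.2) 0) (fun p q h1 h2 h3 => ?_) a b ha hb hab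
  rcases le_total p q with hpq | hpq
  · rw [← hsub]
    exact hrat p q h1 h2 h3 hpq
  · rw [norm_sub_rev, ← hsub]
    exact hrat q p h2 h1 (by rwa [abs_sub_comm]) hpq

theorem tendsto_translate_weakTopology {E : Set (LC N)} (hE : HasEquicontinuousMBounds E)
    {P : Set (Vec N × Vec N)} {fs : ℕ → LC N} {f : LC N} {ts : ℕ → ℝ} {t : ℝ}
    (hfsE : ∀ n, fs n ∈ @closure (LC N) (weakTopology P) E)
    (hfE : f ∈ @closure (LC N) (weakTopology P) E)
    (hf : Tendsto fs atTop (@nhds (LC N) (weakTopology P) f))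
    (ht : Tendsto ts atTop (𝓝 t)) : Tendsto (fun n => (fs n).translate (ts n)) atTop
      (@nhds (LC N) (weakTopology P) (f.translate t)) := by
  refine tendsto_weakTopology_iff.2 fun z hz q₁ q₂ => ?_
  rcases lt_or_ge q₂ q₁ with hq | hq
  · have : ∀ g g' : LC N, weakDist q₁ q₂ z g g' = 0 := fun g g' => by
      rw [weakDist, Icc_eq_empty (by simpa using hq), setIntegral_empty, norm_zero]
    simp [this]
  have hW := convergesWeakly_of_tendsto_weakTopology hf
  have ii : ∀ g : LC N, ∀ a b, IntervalIntegrable (fun u => g u z.1 z.2) volume a b := fun g =>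
    intervalIntegrable_of_locallyIntegrable (g.locallyIntegrable_apply z.1 z.2)
  have hrat : ∀ p : ℚ, Tendsto (fun n => ∫ u in (0 : ℝ)..p, (fs n u z.1 z.2 - f u z.1 z.2)) atTop
      (𝓝 0) := by
    intro p
    rcases le_total 0 p with hp | hp
    · simpa using hW z hz 0 p hp
    · have := (hW z hz p 0 hp).neg
      simpa [← intervalIntegral.integral_symm] using this
  have hend : ∀ q : ℝ, Tendsto (fun n => ∫ u in (0 : ℝ)..ts n + q, fs n u z.1 z.2) atTop
      (𝓝 (∫ u in (0 : ℝ)..t + q, f u z.1 z.2)) := by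
    intro q
    rw [Metric.tendsto_nhds]
    intro ε hε
    obtain ⟨δ, hδ, h⟩ := hE.exists_delta_closure hz (r := |t + q| + 1) (ε := ε / 4)
      (by positivity) (by positivity)
    have hδ' : 0 < min δ 1 := lt_min hδ one_pos
    obtain ⟨p, hp⟩ := Rat.denseRange_cast.exists_dist_lt (t + q) (half_pos hδ')
    rw [Real.dist_eq] at hp
    have h1 : ∀ᶠ n in atTop, |ts n - t| < min δ 1 / 2 := by
      simpa [Real.dist_eq] using ht.eventually (Metric.ball_mem_nhds t (half_pos hδ'))
    have h2 := (hrat p).norm.eventually_lt_const (u := ε / 4) (by simpa using by positivity)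
    filter_upwards [h1, h2] with n h1 h2
    have hp' := abs_lt.1 hp
    have hn' := abs_lt.1 h1
    have habs1 : |(p : ℝ)| < |t + q| + 1 := by
      rw [abs_lt]
      constructor <;> linarith [neg_abs_le (t + q), le_abs_self (t + q), min_le_right δ 1]
    have habs2 : |ts n + q| < |t + q| + 1 := by
      rw [abs_lt]
      constructor <;> linarith [neg_abs_le (t + q), le_abs_self (t + q), min_le_right δ 1]
    have g1 := h (fs n) (hfsE n) p (ts n + q) habs1 habs2 (by
      rw [abs_lt]
      constructor <;> linarith [min_le_left δ 1])
    have g2 := h f hfE p (t + q) habs1 (by linarith) (by linarith [min_le_left δ 1])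
    rw [dist_eq_norm, ← intervalIntegral.integral_add_adjacent_intervals (ii (fs n) 0 p) (ii _ _ _),
      ← intervalIntegral.integral_add_adjacent_intervals (ii f 0 p) (ii _ _ _)]
    rw [intervalIntegral.integral_sub (ii _ _ _) (ii _ _ _)] at h2
    have g3 := norm_add_le ((∫ u in (0 : ℝ)..p, fs n u z.1 z.2) - ∫ u in (0 : ℝ)..p, f u z.1 z.2)
      ((∫ u in (p : ℝ)..ts n + q, fs n u z.1 z.2) - ∫ u in (p : ℝ)..t + q, f u z.1 z.2)
    have g4 := norm_sub_le (∫ u in (p : ℝ)..ts n + q, fs n u z.1 z.2)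
      (∫ u in (p : ℝ)..t + q, f u z.1 z.2)
    rw [add_sub_add_comm]
    linarith
  have hlim := (((hend q₂).sub (hend q₁)).sub_const
    ((∫ u in (0 : ℝ)..t + q₂, f u z.1 z.2) - ∫ u in (0 : ℝ)..t + q₁, f u z.1 z.2)).norm
  rw [sub_self, norm_zero] at hlim
  refine hlim.congr fun n => ?_
  have j1 : IntervalIntegrable (fun u => fs n (ts n + u) z.1 z.2) volume q₁ q₂ :=
    intervalIntegrable_of_locallyIntegrable
      (locallyIntegrable_comp_add ((fs n).locallyIntegrable_apply z.1 z.2) (ts n)) _ _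
  have j2 : IntervalIntegrable (fun u => f (t + u) z.1 z.2) volume q₁ q₂ :=
    intervalIntegrable_of_locallyIntegrable
      (locallyIntegrable_comp_add (f.locallyIntegrable_apply z.1 z.2) t) _ _
  simp only [weakDist_eq hq, LC.translate_apply]
  rw [intervalIntegral.integral_sub j1 j2,
    intervalIntegral.integral_comp_add_left (fun u => fs n u z.1 z.2) (ts n),
    intervalIntegral.integral_comp_add_left (fun u => f u z.1 z.2) t,
    intervalIntegral.integral_interval_sub_left (ii _ _ _) (ii _ _ _),
    intervalIntegral.integral_interval_sub_left (ii _ _ _) (ii _ _ _)]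

end CaratheodoryDelay
end

open CaratheodoryDelay in
theorem theorem3p14 (N : ℕ) (E : Set (LC N)) (hLx : SatisfiesLx E)
    (hKx : ∀ f ∈ E, f.Kx) (hKy : ∀ f ∈ E, f.Ky)
    (P : Set (Vec N × Vec N)) (hPc : P.Countable) (hPd : Dense P) :
    -- the solutions x(·,f,φ) are well defined
    (∀ (f : LC N) (φ : Hist N), HasUniqueMaximalSolution f φ) ∧
    -- continuous dependence in the strong topology
    ContinuousDependence (strongTopology P) E ∧
    -- semiflow in the strong topology
    (BaseInvariant E →
      IsMonotoneContinuousSemiflow (strongTopology P) (@closure (LC N) (strongTopology P) E)) ∧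
    -- both results in the weak topology
    (HasEquicontinuousMBounds E →
      ContinuousDependence (weakTopology P) E ∧
      (BaseInvariant E →
        IsMonotoneContinuousSemiflow (weakTopology P)
          (@closure (LC N) (weakTopology P) E))) := by
  have := firstCountable_strongTopology hPc
  have := firstCountable_weakTopology hPc
  have hs := continuousDependence_strongTopology hLx hKx hKy hPd
  refine ⟨hasUniqueMaximalSolution, hs, fun hinv => ?_, fun hE => ?_⟩
  · exact isMonotoneContinuousSemiflow_closure hs hKx hKy hinv
      fun fs f ts t _ _ => tendsto_translate_strongTopology
  · have hw := continuousDependence_weakTopology hLx hKx hKy hPd hE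
    exact ⟨hw, fun hinv => isMonotoneContinuousSemiflow_closure hw hKx hKy hinv
      fun fs f ts t => tendsto_translate_weakTopology hE⟩
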